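/- Let $G$ be a group. A $G$-bornological coarse space is a $G$-set with a $G$-invariant bornology and a coarse structure in which the invariant entourages are cofinal, such that coarse thickenings of bounded sets are bounded; morphisms are equivariant, controlled, proper maps. A $G$-uniform bornological coarse space carries in addition a uniform structure in which the invariant uniform entourages are cofinal and some uniform entourage is a coarse entourage; its morphisms are in addition uniformly continuous. $\otimes$ denotes the cartesian product with the product structures. For a $G$-uniform bornological coarse space $X$ let $\mathcal O(X)_-$ be $\mathbb R\otimes X$ with its coarse structure replaced by the hybrid one, whose entourages are the entourages $V$ of $\mathbb R\otimes X$ such that for every uniform entourage $U$ of $\mathbb R\otimes X$ there is $n\in\mathbb N$ with $V\subseteq U\cup((-\infty,n]\times X)^2$; the cone $\mathcal O(X)$ is the subspace $[0,\infty)\times X$ of $\mathcal O(X)_-$. Let $\mathrm{Yo}^s:G\mathbf{BornCoarse}\to G\mathbf{Sp}\mathcal X$ be the universal equivariant coarse homology theory, that is, the localization of presheaves of spectra on $G\mathbf{BornCoarse}$ that forces coarse invariance, excision for equivariant complementary pairs, vanishing on flasques and $u$-continuity. Call $X$ weakly flasque if there is a morphism $f:X\to X$ with $\mathrm{Yo}^s(f)\simeq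 \mathrm{id}$, such that $\bigcup_n (f^n\times f^n)(U)$ is an entourage for every entourage $U$ and for every bounded $B$ there is $n$ with $f^n(X)\cap GB=\emptyset$. Let $\mathrm{Yo}=\mathrm{Yo}^s_{wfl}:G\mathbf{BornCoarse}\to G\mathbf{Sp}\mathcal X_{wfl}$ be the further localization that forces vanishing on weakly flasque spaces. All quotients below are cofibres. Let $W_\infty$ be a $G$-uniform bornological coarse space with invariant subsets $M_\infty,W$ such that $W_\infty=M_\infty\cup W$, put $M:=W\cap M_\infty$, and assume that there is an isomorphism $M_\infty\cong[0,\infty)\otimes M$ which on $M$ is $m\mapsto(0,m)$. Let $M_-:=(-\infty,0]\times M$ and $M_+:=[0,\infty)\times M$ as subspaces of $\mathbb R\otimes M$, and identify $M_+\cong M_\infty$. Then: 1. The canonical morphism $c:\mathrm{Yo}(\mathcal O(\mathbb R\otimes M))\to \mathrm{Yo}(\mathcal O(\mathbb R\otimes M))/\mathrm{Yo}(\mathcal O(M_-))$ is an equivalence. 2. The boundary morphism $\delta:\mathrm{Yo}(\mathcal O(M_+))/\mathrm{Yo}(\mathcal O(M))\to\Sigma\mathrm{Yo}(\mathcal O(M))$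 is an equivalence. 3. The morphism $v:\mathrm{Yo}(\mathcal O(M_+))/\mathrm{Yo}(\mathcal O(M))\to \mathrm{Yo}(\mathcal O(\mathbb R\otimes M))/\mathrm{Yo}(\mathcal O(M_-))$ induced by the inclusions is an equivalence, and hence the suspension morphism $\mathrm{susp}:=\delta\circ v^{-1}\circ c:\mathrm{Yo}(\mathcal O(\mathbb R\otimes M))\to\Sigma\mathrm{Yo}(\mathcal O(M))$ is an equivalence. 4. Let $Y:=(-\infty,0]\times W\cup[0,\infty)\times W_\infty$ and $\mathbb R\times W\subseteq Y$ carry the structures induced from $\mathcal O(W_\infty)_-$, let $q:\mathrm{Yo}(Y)\to\mathrm{Yo}(Y)/\mathrm{Yo}(\mathbb R\times W)$ be the canonical morphism and $v':\mathrm{Yo}(\mathcal O(M_+))/\mathrm{Yo}(\mathcal O(M))\to \mathrm{Yo}(Y)/\mathrm{Yo}(\mathbb R\times W)$ the morphism induced by the inclusions. Whenever the Mayer–Vietoris boundary $\partial':=\delta\circ v'^{-1}\circ q:\mathrm{Yo}(Y)\to\Sigma\mathrm{Yo}(\mathcal O(M))$ of the decomposition $(\mathbb R\times W,[0,\infty)\times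 M_\infty)$ of $Y$ is defined, i.e. $v'$ is an equivalence, it is compatible with the suspension: $\partial'=\mathrm{susp}\circ c^{-1}\circ v\circ v'^{-1}\circ q$. -/

import Mathlib

open CategoryTheory Opposite Limits

universe v u w

namespace CoarseMotives

/-! ## Bornological coarse spaces and uniform bornological coarse spaces with group action -/

section Spaces

/-- A coarse structure on a set: a family of entourages containing the diagonal and closed under
subsets, finite unions, inverses and compositions. -/
structure CoarseStructure (X : Type u) where
  IsEntourage : Set (X × X) → Prop
  diag : IsEntourage {p | p.1 = p.2}
  subset : ∀ {U V : Set (X × X)}, IsEntourage V → U ⊆ V → IsEntourage U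
  union : ∀ {U V : Set (X × X)}, IsEntourage U → IsEntourage V → IsEntourage (U ∪ V)
  inv : ∀ {U : Set (X × X)}, IsEntourage U → IsEntourage (Prod.swap ⁻¹' U)
  comp : ∀ {U V : Set (X × X)}, IsEntourage U → IsEntourage V →
    IsEntourage {p | ∃ y, (p.1, y) ∈ U ∧ (y, p.2) ∈ V}

/-- The thickening `U[B]` of a subset `B` by a relation `U`. -/
def thicken {X : Type u} (U : Set (X × X)) (B : Set X) : Set X := {x | ∃ b ∈ B, (x, b) ∈ U}

/-- Invariance of a subset under the action of a group. -/
def InvariantSet (G : Type v) {X : Type u} [SMul G X] (A : Set X) : Prop :=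
  ∀ (g : G) (x : X), x ∈ A → g • x ∈ A

/-- Invariance of a relation under the diagonal action of a group. -/
def InvariantRel (G : Type v) {X : Type u} [SMul G X] (U : Set (X × X)) : Prop :=
  ∀ (g : G) (x y : X), (x, y) ∈ U → (g • x, g • y) ∈ U

lemma invariant_inter {G : Type v} {X : Type u} [SMul G X] {A B : Set X} (hA : InvariantSet G A)
    (hB : InvariantSet G B) : InvariantSet G (A ∩ B) :=
  fun g x hx => ⟨hA g x hx.1, hB g x hx.2⟩

/-- A `G`-bornological coarse space: a `G`-set with an invariant bornology (a Mathlib `Bornology`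
is the same as a family of bounded sets that covers the set and is closed under subsets and finite
unions) and a coarse structure in which the invariant entourages are cofinal, such that
thickenings of bounded sets are bounded. -/
structure GBornCoarse (G : Type v) [Group G] where
  carrier : Type u
  [action : MulAction G carrier]
  [bornology : Bornology carrier]
  coarse : CoarseStructure carrier
  smul_bounded : ∀ (g : G) (B : Set carrier),
    Bornology.IsBounded B → Bornology.IsBounded ((fun x => g • x) '' B)
  invariant_cofinal : ∀ U, coarse.IsEntourage U →
    ∃ V, coarse.IsEntourage V ∧ U ⊆ V ∧ InvariantRel G V
  thicken_bounded : ∀ U B, coarse.IsEntourage U → Bornology.IsBounded B →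
    Bornology.IsBounded (thicken U B)

variable {G : Type v} [Group G]

namespace GBornCoarse

instance : CoeSort (GBornCoarse.{v, u} G) (Type u) := ⟨GBornCoarse.carrier⟩
instance (X : GBornCoarse.{v, u} G) : MulAction G X := X.action
instance (X : GBornCoarse.{v, u} G) : Bornology X := X.bornology

/-- A morphism of `G`-bornological coarse spaces: an equivariant, controlled and proper map. -/
@[ext]
structure Hom (X Y : GBornCoarse.{v, u} G) where
  toFun : X → Y
  equivariant : ∀ (g : G) (x : X), toFun (g • x) = g • toFun x
  controlled : ∀ U, X.coarse.IsEntourage U → Y.coarse.IsEntourage (Prod.map toFun toFun '' U)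
  proper : ∀ B : Set Y, Bornology.IsBounded B → Bornology.IsBounded (toFun ⁻¹' B)

instance : Category (GBornCoarse.{v, u} G) where
  Hom := Hom
  id X := ⟨fun x => x, fun _ _ => rfl, fun U hU => X.coarse.subset hU (by
    rintro _ ⟨p, hp, rfl⟩; exact hp), fun _ hB => hB⟩
  comp {X Y Z} f g :=
    ⟨fun x => g.toFun (f.toFun x), fun a x => by rw [f.equivariant, g.equivariant],
      fun U hU => Z.coarse.subset (g.controlled _ (f.controlled U hU)) (by
        rintro _ ⟨p, hp, rfl⟩
        exact ⟨_, ⟨p, hp, rfl⟩, rfl⟩),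
      fun B hB => f.proper _ (g.proper B hB)⟩

/-- The underlying map of a morphism. -/
def fn {X Y : GBornCoarse.{v, u} G} (f : X ⟶ Y) : X → Y := Hom.toFun f

@[simp] lemma fn_id (X : GBornCoarse.{v, u} G) (x : X) : fn (𝟙 X) x = x := rfl
@[simp] lemma fn_comp {X Y Z : GBornCoarse.{v, u} G} (f : X ⟶ Y) (g : Y ⟶ Z) (x : X) :
    fn (f ≫ g) x = fn g (fn f x) := rfl

lemma hom_ext {X Y : GBornCoarse.{v, u} G} {f g : X ⟶ Y} (h : ∀ x, fn f x = fn g x) : f = g :=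
  Hom.ext (funext h)

/-- An invariant subset with the induced structures. -/
def sub (X : GBornCoarse.{v, u} G) (A : Set X) (hA : InvariantSet G A) : GBornCoarse.{v, u} G :=
  letI : MulAction G A :=
    { smul := fun g a => ⟨g • a.1, hA g a.1 a.2⟩
      one_smul := fun a => Subtype.ext (one_smul G a.1)
      mul_smul := fun g h a => Subtype.ext (mul_smul g h a.1) }
  { carrier := A
    bornology := inferInstanceAs (Bornology (Subtype fun x => x ∈ A))
    coarse :=
      { IsEntourage := fun U => X.coarse.IsEntourage (Prod.map Subtype.val Subtype.val '' U)
        diag := X.coarse.subset X.coarse.diag (by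
          rintro _ ⟨p, hp, rfl⟩
          exact congrArg Subtype.val hp)
        subset := fun hV h => X.coarse.subset hV (Set.image_mono h)
        union := fun hU hV => by rw [Set.image_union]; exact X.coarse.union hU hV
        inv := fun hU => X.coarse.subset (X.coarse.inv hU) (by
          rintro _ ⟨⟨a, b⟩, h, rfl⟩
          exact ⟨(b, a), h, rfl⟩)
        comp := fun hU hV => X.coarse.subset (X.coarse.comp hU hV) (by
          rintro _ ⟨⟨a, b⟩, ⟨c, h1, h2⟩, rfl⟩
          exact ⟨c.1, ⟨(a, c), h1, rfl⟩, ⟨(c, b), h2, rfl⟩⟩) }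
    smul_bounded := fun g B hB => by
      rw [← Bornology.isBounded_image_subtype_val] at hB ⊢
      refine (X.smul_bounded g _ hB).subset ?_
      rintro _ ⟨_, ⟨b, hb, rfl⟩, rfl⟩
      exact ⟨b.1, ⟨b, hb, rfl⟩, rfl⟩
    invariant_cofinal := fun U hU => by
      obtain ⟨V, hV, hUV, hi⟩ := X.invariant_cofinal _ hU
      refine ⟨Prod.map Subtype.val Subtype.val ⁻¹' V, X.coarse.subset hV ?_, ?_, ?_⟩
      · exact Set.image_preimage_subset _ _
      · exact Set.image_subset_iff.1 hUV
      · intro g x y h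
        exact hi g x.1 y.1 h
    thicken_bounded := fun U B hU hB => by
      rw [← Bornology.isBounded_image_subtype_val] at hB ⊢
      refine (X.thicken_bounded _ _ hU hB).subset ?_
      rintro _ ⟨x, ⟨b, hb, hxb⟩, rfl⟩
      exact ⟨b.1, ⟨b, hb, rfl⟩, ⟨(x, b), hxb, rfl⟩⟩ }

/-- The point of `X` underlying a point of a subspace. -/
def val {X : GBornCoarse.{v, u} G} {A : Set X} {hA : InvariantSet G A} (a : X.sub A hA) : X :=
  Subtype.val (p := fun x => x ∈ A) a

/-- The inclusion of a subspace. -/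
def incl (X : GBornCoarse.{v, u} G) (A : Set X) (hA : InvariantSet G A) : X.sub A hA ⟶ X where
  toFun := val
  equivariant _ _ := rfl
  controlled _ hU := hU
  proper B hB := (Bornology.isBounded_image_subtype_val (p := fun x => x ∈ A)).1
    (hB.subset (by rintro _ ⟨x, hx, rfl⟩; exact hx))

/-- The factorization through a subspace of a morphism that takes values in it. -/
def lift {T X : GBornCoarse.{v, u} G} (f : T ⟶ X) (A : Set X) (hA : InvariantSet G A)
    (h : ∀ t, fn f t ∈ A) : T ⟶ X.sub A hA where
  toFun t := ⟨fn f t, h t⟩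
  equivariant g t := Subtype.ext (f.equivariant g t)
  controlled U hU := X.coarse.subset (f.controlled U hU) (by
    rintro _ ⟨_, ⟨p, hp, rfl⟩, rfl⟩
    exact ⟨p, hp, rfl⟩)
  proper B hB := (f.proper _ ((Bornology.isBounded_image_subtype_val
    (p := fun x => x ∈ A)).2 hB)).subset (fun t ht => ⟨⟨fn f t, h t⟩, ht, rfl⟩)

/-- The tensor product: the cartesian product with the coarse structure generated by the products
of entourages and the bornology generated by the products of bounded sets. -/
def tensor (X : GBornCoarse.{v, w} G) (Y : GBornCoarse.{v, u} G) : GBornCoarse.{v, max w u} G where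
  carrier := X × Y
  coarse :=
    { IsEntourage := fun W => ∃ U V, X.coarse.IsEntourage U ∧ Y.coarse.IsEntourage V ∧
        ∀ p ∈ W, (p.1.1, p.2.1) ∈ U ∧ (p.1.2, p.2.2) ∈ V
      diag := ⟨_, _, X.coarse.diag, Y.coarse.diag, fun p hp =>
        ⟨congrArg Prod.fst hp, congrArg Prod.snd hp⟩⟩
      subset := by
        rintro W W' ⟨U, V, hU, hV, h⟩ hW
        exact ⟨U, V, hU, hV, fun p hp => h p (hW hp)⟩
      union := by
        rintro W W' ⟨U, V, hU, hV, h⟩ ⟨U', V', hU', hV', h'⟩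
        refine ⟨_, _, X.coarse.union hU hU', Y.coarse.union hV hV', ?_⟩
        rintro p (hp | hp)
        · exact ⟨Or.inl (h p hp).1, Or.inl (h p hp).2⟩
        · exact ⟨Or.inr (h' p hp).1, Or.inr (h' p hp).2⟩
      inv := by
        rintro W ⟨U, V, hU, hV, h⟩
        exact ⟨_, _, X.coarse.inv hU, Y.coarse.inv hV, fun p hp => h p.swap hp⟩
      comp := by
        rintro W W' ⟨U, V, hU, hV, h⟩ ⟨U', V', hU', hV', h'⟩
        refine ⟨_, _, X.coarse.comp hU hU', Y.coarse.comp hV hV', ?_⟩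
        rintro p ⟨y, hy, hy'⟩
        exact ⟨⟨y.1, (h _ hy).1, (h' _ hy').1⟩, ⟨y.2, (h _ hy).2, (h' _ hy').2⟩⟩ }
  smul_bounded g B hB := by
    rw [← Bornology.isBounded_image_fst_and_snd] at hB ⊢
    refine ⟨(X.smul_bounded g _ hB.1).subset ?_, (Y.smul_bounded g _ hB.2).subset ?_⟩
    · rintro _ ⟨_, ⟨b, hb, rfl⟩, rfl⟩
      exact ⟨b.1, ⟨b, hb, rfl⟩, rfl⟩
    · rintro _ ⟨_, ⟨b, hb, rfl⟩, rfl⟩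
      exact ⟨b.2, ⟨b, hb, rfl⟩, rfl⟩
  invariant_cofinal := by
    rintro W ⟨U, V, hU, hV, h⟩
    obtain ⟨U', hU', hUU', hi⟩ := X.invariant_cofinal U hU
    obtain ⟨V', hV', hVV', hi'⟩ := Y.invariant_cofinal V hV
    exact ⟨{p | (p.1.1, p.2.1) ∈ U' ∧ (p.1.2, p.2.2) ∈ V'}, ⟨U', V', hU', hV', fun _ hp => hp⟩,
      fun p hp => ⟨hUU' (h p hp).1, hVV' (h p hp).2⟩,
      fun g x y hxy => ⟨hi g _ _ hxy.1, hi' g _ _ hxy.2⟩⟩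
  thicken_bounded := by
    rintro W B ⟨U, V, hU, hV, h⟩ hB
    rw [← Bornology.isBounded_image_fst_and_snd] at hB ⊢
    refine ⟨(X.thicken_bounded U _ hU hB.1).subset ?_, (Y.thicken_bounded V _ hV hB.2).subset ?_⟩
    · rintro _ ⟨x, ⟨b, hb, hxb⟩, rfl⟩
      exact ⟨b.1, ⟨b, hb, rfl⟩, (h _ hxb).1⟩
    · rintro _ ⟨x, ⟨b, hb, hxb⟩, rfl⟩
      exact ⟨b.2, ⟨b, hb, rfl⟩, (h _ hxb).2⟩

/-- The two-point space `{0,1}` with trivial action and maximal coarse structure and bornology. -/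
def twoPoint (G : Type v) [Group G] : GBornCoarse.{v, 0} G :=
  letI : MulAction G Bool :=
    { smul := fun _ b => b, one_smul := fun _ => rfl, mul_smul := fun _ _ _ => rfl }
  letI : Bornology Bool := ⟨⊥, bot_le⟩
  have hb : ∀ B : Set Bool, Bornology.IsBounded B := fun _ => Filter.mem_bot
  { carrier := Bool
    coarse :=
      { IsEntourage := fun _ => True
        diag := trivial
        subset := fun _ _ => trivial
        union := fun _ _ => trivial
        inv := fun _ => trivial
        comp := fun _ _ => trivial }
    smul_bounded := fun _ _ _ => hb _
    invariant_cofinal := fun _ _ =>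
      ⟨Set.univ, trivial, Set.subset_univ _, fun _ _ _ _ => trivial⟩
    thicken_bounded := fun _ _ _ _ => hb _ }

/-- The projection `{0,1} ⊗ X ⟶ X`. -/
def twoPointProj (X : GBornCoarse.{v, u} G) : (twoPoint G).tensor X ⟶ X where
  toFun p := p.2
  equivariant _ _ := rfl
  controlled := by
    rintro W ⟨U, V, hU, hV, h⟩
    refine X.coarse.subset hV ?_
    rintro _ ⟨p, hp, rfl⟩
    exact (h p hp).2
  proper B hB := by
    refine Bornology.isBounded_image_fst_and_snd.1 ⟨Filter.mem_bot, hB.subset ?_⟩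
    rintro _ ⟨p, hp, rfl⟩
    exact hp

/-- An equivariant big family: a filtered family of invariant subsets that absorbs thickenings. -/
structure IsBigFamily (X : GBornCoarse.{v, u} G) (F : Set (Set X)) : Prop where
  nonempty : F.Nonempty
  directed : DirectedOn (· ⊆ ·) F
  invariant : ∀ A ∈ F, InvariantSet G A
  absorbs : ∀ A ∈ F, ∀ U, X.coarse.IsEntourage U → ∃ B ∈ F, thicken U A ⊆ B

/-- An equivariant complementary pair: an invariant subset `Z` and an equivariant big family `F`
such that `Z` and some member of `F` cover the space. -/
structure IsComplementaryPair (X : GBornCoarse.{v, u} G) (Z : Set X) (F : Set (Set X)) :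
    Prop where
  invariant : InvariantSet G Z
  big : X.IsBigFamily F
  cover : ∃ A ∈ F, Z ∪ A = Set.univ

/-- The last two conditions on an endomorphism that implements (weak) flasqueness. -/
structure IsShift {X : GBornCoarse.{v, u} G} (f : X ⟶ X) : Prop where
  union_entourage : ∀ U, X.coarse.IsEntourage U →
    X.coarse.IsEntourage (⋃ n : ℕ, Prod.map (fn f)^[n] (fn f)^[n] '' U)
  leaves_bounded : ∀ B : Set X, Bornology.IsBounded B →
    ∃ n : ℕ, Set.range (fn f)^[n] ∩ {x | ∃ (g : G) (b : X), b ∈ B ∧ x = g • b} = ∅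

/-- Flasqueness: there is a shift that is close to the identity. -/
def IsFlasque (X : GBornCoarse.{v, u} G) : Prop :=
  ∃ f : X ⟶ X, X.coarse.IsEntourage {p | p.1 = fn f p.2} ∧ IsShift f

/-- Membership in the coarse structure generated by a single relation. -/
def InGenerated {X : Type u} (U V : Set (X × X)) : Prop :=
  ∀ S : CoarseStructure X, S.IsEntourage U → S.IsEntourage V

end GBornCoarse

/-- A `G`-uniform bornological coarse space: a `G`-bornological coarse space with a uniform
structure in which the invariant uniform entourages are cofinal and which has a uniform entourage
that is also a coarse entourage. -/
structure GUBC (G : Type v) [Group G] extends GBornCoarse.{v, u} G where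
  [uniform : UniformSpace carrier]
  uniform_invariant : ∀ U ∈ uniformity carrier,
    ∃ V ∈ uniformity carrier, V ⊆ U ∧ InvariantRel G V
  compatible : ∃ U ∈ uniformity carrier, coarse.IsEntourage U

namespace GUBC

instance : CoeSort (GUBC.{v, u} G) (Type u) := ⟨fun X => X.carrier⟩
instance (X : GUBC.{v, u} G) : UniformSpace X := X.uniform

/-- A morphism of `G`-uniform bornological coarse spaces: a morphism of the underlying
`G`-bornological coarse spaces that is uniformly continuous. -/
@[ext]
structure Hom (X Y : GUBC.{v, u} G) where
  base : X.toGBornCoarse ⟶ Y.toGBornCoarse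
  uniformContinuous : UniformContinuous (GBornCoarse.fn base : X → Y)

instance : Category (GUBC.{v, u} G) where
  Hom := Hom
  id X := ⟨𝟙 _, uniformContinuous_id⟩
  comp f g := ⟨f.base ≫ g.base, g.uniformContinuous.comp f.uniformContinuous⟩

/-- The underlying map of a morphism. -/
def fn {X Y : GUBC.{v, u} G} (f : X ⟶ Y) : X → Y := GBornCoarse.fn f.base

@[simp] lemma fn_id (X : GUBC.{v, u} G) (x : X) : fn (𝟙 X) x = x := rfl
@[simp] lemma fn_comp {X Y Z : GUBC.{v, u} G} (f : X ⟶ Y) (g : Y ⟶ Z) (x : X) :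
    fn (f ≫ g) x = fn g (fn f x) := rfl

lemma hom_ext {X Y : GUBC.{v, u} G} {f g : X ⟶ Y} (h : ∀ x, fn f x = fn g x) : f = g :=
  Hom.ext (GBornCoarse.hom_ext h)

/-- An invariant subset with the induced structures. -/
def sub (X : GUBC.{v, u} G) (A : Set X) (hA : InvariantSet G A) : GUBC.{v, u} G where
  toGBornCoarse := X.toGBornCoarse.sub A hA
  uniform := UniformSpace.comap
    (fun a : X.toGBornCoarse.sub A hA => (GBornCoarse.val a : X.carrier)) X.uniform
  uniform_invariant := by
    rintro U ⟨V, hV, hVU⟩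
    obtain ⟨V', hV', hVV', hi⟩ := X.uniform_invariant V hV
    exact ⟨Prod.map Subtype.val Subtype.val ⁻¹' V', ⟨V', hV', fun _ h => h⟩,
      fun p hp => hVU (hVV' hp), fun g x y h => hi g x.1 y.1 h⟩
  compatible := by
    obtain ⟨U, hU, hU'⟩ := X.compatible
    exact ⟨Prod.map Subtype.val Subtype.val ⁻¹' U, ⟨U, hU, fun _ h => h⟩,
      X.coarse.subset hU' (Set.image_preimage_subset _ _)⟩

/-- The point of `X` underlying a point of a subspace. -/
def val {X : GUBC.{v, u} G} {A : Set X} {hA : InvariantSet G A} (a : X.sub A hA) : X :=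
  Subtype.val (p := fun x => x ∈ A) a

/-- The inclusion of a subspace. -/
def incl (X : GUBC.{v, u} G) (A : Set X) (hA : InvariantSet G A) : X.sub A hA ⟶ X where
  base := X.toGBornCoarse.incl A hA
  uniformContinuous := uniformContinuous_subtype_val (p := fun x => x ∈ A)

/-- The factorization through a subspace of a morphism that takes values in it. -/
def lift {T X : GUBC.{v, u} G} (f : T ⟶ X) (A : Set X) (hA : InvariantSet G A)
    (h : ∀ t, fn f t ∈ A) : T ⟶ X.sub A hA where
  base := GBornCoarse.lift f.base A hA h
  uniformContinuous := f.uniformContinuous.subtype_mk h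

/-- The tensor product, with the product uniform structure. -/
def tensor (X : GUBC.{v, w} G) (Y : GUBC.{v, u} G) : GUBC.{v, max w u} G where
  toGBornCoarse := X.toGBornCoarse.tensor Y.toGBornCoarse
  uniform := @instUniformSpaceProd X.carrier Y.carrier X.uniform Y.uniform
  uniform_invariant := by
    intro U hU
    obtain ⟨A, hA, B, hB, h⟩ := entourageProd_subset (α := X) (β := Y) hU
    obtain ⟨A', hA', hAA', hi⟩ := X.uniform_invariant A hA
    obtain ⟨B', hB', hBB', hi'⟩ := Y.uniform_invariant B hB
    exact ⟨entourageProd A' B', entourageProd_mem_uniformity hA' hB',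
      fun p hp => h ⟨hAA' hp.1, hBB' hp.2⟩, fun g x y hxy => ⟨hi g _ _ hxy.1, hi' g _ _ hxy.2⟩⟩
  compatible := by
    obtain ⟨U, hU, hU'⟩ := X.compatible
    obtain ⟨V, hV, hV'⟩ := Y.compatible
    exact ⟨entourageProd U V, entourageProd_mem_uniformity hU hV, U, V, hU', hV',
      fun p hp => hp⟩

/-- The real line with trivial action and its metric structures. -/
def line (G : Type v) [Group G] : GUBC.{v, 0} G :=
  letI : MulAction G ℝ :=
    { smul := fun _ b => b, one_smul := fun _ => rfl, mul_smul := fun _ _ _ => rfl }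
  { carrier := ℝ
    bornology := inferInstance
    uniform := inferInstance
    coarse :=
      { IsEntourage := fun U => ∃ c : ℝ, ∀ p ∈ U, |p.1 - p.2| ≤ c
        diag := ⟨0, fun p hp => by
          rw [show p.1 = p.2 from hp, sub_self, abs_zero]⟩
        subset := fun ⟨c, hc⟩ h => ⟨c, fun p hp => hc p (h hp)⟩
        union := fun ⟨c, hc⟩ ⟨d, hd⟩ => ⟨max c d, fun p hp => hp.elim
          (fun h => (hc p h).trans (le_max_left _ _)) (fun h => (hd p h).trans (le_max_right _ _))⟩
        inv := fun ⟨c, hc⟩ => ⟨c, fun p hp => by rw [abs_sub_comm]; exact hc p.swap hp⟩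
        comp := fun ⟨c, hc⟩ ⟨d, hd⟩ => ⟨c + d, fun p ⟨y, h1, h2⟩ =>
          (abs_sub_le p.1 y p.2).trans (add_le_add (hc _ h1) (hd _ h2))⟩ }
    smul_bounded := fun g B hB => hB.subset (by rintro _ ⟨b, hb, rfl⟩; exact hb)
    invariant_cofinal := fun U hU => ⟨U, hU, subset_rfl, fun _ _ _ h => h⟩
    thicken_bounded := fun U B ⟨c, hc⟩ hB =>
      (hB.cthickening (δ := c)).subset (fun x ⟨b, hb, hxb⟩ =>
        Metric.mem_cthickening_of_dist_le x b c B hb (by rw [Real.dist_eq]; exact hc _ hxb))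
    uniform_invariant := fun U hU => ⟨U, hU, subset_rfl, fun _ _ _ h => h⟩
    compatible := ⟨{p | dist p.1 p.2 < 1}, Metric.dist_mem_uniformity one_pos,
      1, fun p hp => by rw [← Real.dist_eq]; exact le_of_lt hp⟩ }

/-- The `G`-bornological coarse space `𝒪(X)_- = (ℝ ⊗ X)_h`. Its entourages are the entourages of
`ℝ ⊗ X` that become uniformly small outside of the members `(-∞, n] × X` of the big family. -/
def coneMinus (X : GUBC.{v, u} G) : GBornCoarse.{v, u} G :=
  let T : GUBC.{v, u} G := (line G).tensor X
  { carrier := ℝ × X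
    action := T.action
    bornology := T.bornology
    coarse :=
      { IsEntourage := fun V => T.coarse.IsEntourage V ∧ ∀ U ∈ uniformity T,
          ∃ n : ℕ, ∀ p ∈ V, p ∈ U ∨ (p.1.1 ≤ (n : ℝ) ∧ p.2.1 ≤ (n : ℝ))
        diag := ⟨T.coarse.diag, fun U hU => ⟨0, fun p hp => Or.inl (by
          obtain ⟨a, b⟩ := p
          obtain rfl : a = b := hp
          exact refl_mem_uniformity hU)⟩⟩
        subset := fun hV h => ⟨T.coarse.subset hV.1 h, fun U hU => by
          obtain ⟨n, hn⟩ := hV.2 U hU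
          exact ⟨n, fun p hp => hn p (h hp)⟩⟩
        union := fun hV hW => ⟨T.coarse.union hV.1 hW.1, fun U hU => by
          obtain ⟨n, hn⟩ := hV.2 U hU
          obtain ⟨m, hm⟩ := hW.2 U hU
          have h1 : (n : ℝ) ≤ ((max n m : ℕ) : ℝ) := by exact_mod_cast le_max_left n m
          have h2 : (m : ℝ) ≤ ((max n m : ℕ) : ℝ) := by exact_mod_cast le_max_right n m
          refine ⟨max n m, ?_⟩
          rintro p (hp | hp)
          · exact (hn p hp).imp_right fun h => ⟨h.1.trans h1, h.2.trans h1⟩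
          · exact (hm p hp).imp_right fun h => ⟨h.1.trans h2, h.2.trans h2⟩⟩
        inv := fun hV => ⟨T.coarse.inv hV.1, fun U hU => by
          obtain ⟨n, hn⟩ := hV.2 _ (symm_le_uniformity hU)
          exact ⟨n, fun p hp => (hn p.swap hp).imp (fun h => h) fun h => ⟨h.2, h.1⟩⟩⟩
        comp := fun {V W} hV hW => ⟨T.coarse.comp hV.1 hW.1, fun U hU => by
          obtain ⟨U', hU', hUU⟩ := comp_mem_uniformity_sets hU
          obtain ⟨n, hn⟩ := hV.2 U' hU'
          obtain ⟨m, hm⟩ := hW.2 U' hU'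
          obtain ⟨A, A', ⟨c, hc⟩, hA', hA⟩ := hV.1
          obtain ⟨B, B', ⟨d, hd⟩, hB', hB⟩ := hW.1
          obtain ⟨N, hN⟩ := exists_nat_ge (max (n : ℝ) m + |c| + |d|)
          refine ⟨N, ?_⟩
          rintro ⟨x, z⟩ ⟨y, hxy, hyz⟩
          have e1 : |x.1 - y.1| ≤ c := hc _ (hA _ hxy).1
          have e2 : |y.1 - z.1| ≤ d := hd _ (hB _ hyz).1
          have e3 := abs_le.1 e1
          have e4 := abs_le.1 e2
          have a1 := le_abs_self c
          have a2 := le_abs_self d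
          have a3 := abs_nonneg c
          have a4 := abs_nonneg d
          have m1 := le_max_left (n : ℝ) m
          have m2 := le_max_right (n : ℝ) m
          by_cases hx : x.1 ≤ (N : ℝ) ∧ z.1 ≤ (N : ℝ)
          · exact Or.inr hx
          · left
            have hbig : (n : ℝ) < y.1 ∧ (m : ℝ) < y.1 := by
              rcases not_and_or.1 hx with h | h
              · rw [not_le] at h
                constructor <;> linarith
              · rw [not_le] at h
                constructor <;> linarith
            refine hUU ⟨y, (hn _ hxy).resolve_right ?_, (hm _ hyz).resolve_right ?_⟩
            · exact fun h => absurd h.2 (not_le.2 hbig.1)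
            · exact fun h => absurd h.1 (not_le.2 hbig.2)⟩ }
    smul_bounded := T.smul_bounded
    invariant_cofinal := fun V hV => by
      obtain ⟨W, hW, hVW, hi⟩ := T.invariant_cofinal V hV.1
      refine ⟨{p | ∃ (g : G) (q : T × T), q ∈ V ∧ p = (g • q.1, g • q.2)},
        ⟨T.coarse.subset hW ?_, ?_⟩, ?_, ?_⟩
      · rintro _ ⟨g, q, hq, rfl⟩
        exact hi g _ _ (hVW hq)
      · intro U hU
        obtain ⟨U', hU', hUU, hUi⟩ := T.uniform_invariant U hU
        obtain ⟨n, hn⟩ := hV.2 U' hU'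
        refine ⟨n, ?_⟩
        rintro _ ⟨g, q, hq, rfl⟩
        exact (hn q hq).imp (fun h => hUU (hUi g _ _ h)) fun h => h
      · intro q hq
        exact ⟨1, q, hq, Prod.ext (one_smul G (α := T) q.1).symm (one_smul G (α := T) q.2).symm⟩
      · rintro h x y ⟨g, q, hq, hxy⟩
        obtain ⟨rfl, rfl⟩ := Prod.mk.inj hxy
        exact ⟨h * g, q, hq, by
          rw [mul_smul, mul_smul]
          rfl⟩
    thicken_bounded := fun U B hU hB => T.thicken_bounded U B hU.1 hB }

/-- The functoriality of `𝒪(X)_-`. -/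
def coneMinusMap {X Y : GUBC.{v, u} G} (f : X ⟶ Y) : coneMinus X ⟶ coneMinus Y where
  toFun p := (p.1, fn f p.2)
  equivariant g p := Prod.ext rfl (f.base.equivariant g p.2)
  controlled := by
    rintro V ⟨⟨A, B, hA, hB, hV⟩, hu⟩
    refine ⟨⟨A, _, hA, f.base.controlled B hB, ?_⟩, ?_⟩
    · rintro _ ⟨p, hp, rfl⟩
      exact ⟨(hV p hp).1, ⟨_, (hV p hp).2, rfl⟩⟩
    · intro U hU
      have hc : UniformContinuous (fun p : ℝ × X => ((p.1, fn f p.2) : ℝ × Y)) :=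
        uniformContinuous_fst.prodMk (f.uniformContinuous.comp uniformContinuous_snd)
      obtain ⟨n, hn⟩ := hu _ (hc hU)
      refine ⟨n, ?_⟩
      rintro _ ⟨p, hp, rfl⟩
      exact hn p hp
  proper B hB := by
    have hB2 := (Bornology.isBounded_image_fst_and_snd (α := ℝ) (β := Y)).2 hB
    refine (Bornology.isBounded_image_fst_and_snd (α := ℝ) (β := X)).1 ⟨?_, ?_⟩
    · refine hB2.1.subset ?_
      rintro _ ⟨p, hp, rfl⟩
      exact ⟨_, hp, rfl⟩
    · refine (f.base.proper _ hB2.2).subset ?_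
      rintro _ ⟨p, hp, rfl⟩
      exact ⟨_, hp, rfl⟩

lemma invariant_nonneg (X : GUBC.{v, u} G) :
    InvariantSet G (X := coneMinus X) {p : ℝ × X | 0 ≤ p.1} := fun _ _ h => h

/-- The cone `𝒪(X)`: the subset `[0, ∞) × X` of `𝒪(X)_-`. -/
def cone : GUBC.{v, u} G ⥤ GBornCoarse.{v, u} G where
  obj X := (coneMinus X).sub _ (invariant_nonneg X)
  map {X Y} f := GBornCoarse.lift ((coneMinus X).incl _ (invariant_nonneg X) ≫ coneMinusMap f) _
    (invariant_nonneg Y) (fun t => t.2)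
  map_id _ := rfl
  map_comp _ _ := rfl

/-- The morphism `X ⟶ ℝ ⊗ X`, `x ↦ (0, x)`. -/
def zeroSection (X : GUBC.{v, u} G) : X ⟶ (line G).tensor X where
  base :=
    { toFun := fun x => ((0 : ℝ), x)
      equivariant := fun _ _ => rfl
      controlled := fun U hU => ⟨_, U, (line G).coarse.diag, hU, by
        rintro _ ⟨p, hp, rfl⟩
        exact ⟨rfl, hp⟩⟩
      proper := fun B hB =>
        ((Bornology.isBounded_image_fst_and_snd (α := ℝ) (β := X)).2 hB).2.subset
          (fun x hx => ⟨_, hx, rfl⟩) }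
  uniformContinuous := uniformContinuous_const.prodMk uniformContinuous_id

lemma invariant_nonpos_line (X : GUBC.{v, u} G) :
    InvariantSet G (X := (line G).tensor X) {p : ℝ × X | p.1 ≤ 0} := fun _ _ h => h

lemma invariant_nonneg_line (X : GUBC.{v, u} G) :
    InvariantSet G (X := (line G).tensor X) {p : ℝ × X | 0 ≤ p.1} := fun _ _ h => h

/-- The subspace `M_- = (-∞, 0] × M` of `ℝ ⊗ M`. -/
def minusPart (M : GUBC.{v, u} G) : GUBC.{v, u} G :=
  ((line G).tensor M).sub _ (invariant_nonpos_line M)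

/-- The subspace `M_+ = [0, ∞) × M` of `ℝ ⊗ M`, that is, `[0, ∞) ⊗ M`. -/
def plusPart (M : GUBC.{v, u} G) : GUBC.{v, u} G :=
  ((line G).tensor M).sub _ (invariant_nonneg_line M)

/-- `M_- ⟶ ℝ ⊗ M`. -/
def minusIncl (M : GUBC.{v, u} G) : minusPart M ⟶ (line G).tensor M := incl _ _ _

/-- `M_+ ⟶ ℝ ⊗ M`. -/
def plusIncl (M : GUBC.{v, u} G) : plusPart M ⟶ (line G).tensor M := incl _ _ _

/-- `M ⟶ M_-`, `m ↦ (0, m)`. -/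
def toMinus (M : GUBC.{v, u} G) : M ⟶ minusPart M :=
  lift (zeroSection M) _ _ (fun _ => le_refl (0 : ℝ))

/-- `M ⟶ M_+`, `m ↦ (0, m)`. -/
def toPlus (M : GUBC.{v, u} G) : M ⟶ plusPart M :=
  lift (zeroSection M) _ _ (fun _ => le_refl (0 : ℝ))

end GUBC

end Spaces

/-! ## Presheaves of spectra -/

section Spectra

variable (C : Type u) [Category.{v} C]

/-- Pointed simplicial presheaves on `C` (with values in sets of size `w`). -/
abbrev PtSPsh := Cᵒᵖ × SimplexCategoryᵒᵖ ⥤ Pointed.{w}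

variable {C}

/-- The `j`-simplices of the simplicial interval `Δ[1]`, where only the simplicial component of
`j` matters. -/
abbrev Itv (j : Cᵒᵖ × SimplexCategoryᵒᵖ) := j.2.unop ⟶ (SimplexCategory.mk 1)

/-- The degenerate simplices on the vertices `0` and `1` of `Δ[1]`. -/
abbrev itvEnd (j : Cᵒᵖ × SimplexCategoryᵒᵖ) (i : Fin 2) : Itv j :=
  SimplexCategory.const j.2.unop (SimplexCategory.mk 1) i

/-- The simplices of the boundary of `Δ[1]`. -/
def InBoundary {j : Cᵒᵖ × SimplexCategoryᵒᵖ} (t : Itv j) : Prop := ∃ i, t = itvEnd j i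

lemma itvEnd_map {j k : Cᵒᵖ × SimplexCategoryᵒᵖ} (φ : j ⟶ k) (i : Fin 2) :
    φ.2.unop ≫ itvEnd j i = itvEnd k i := rfl

lemma InBoundary.map {j k : Cᵒᵖ × SimplexCategoryᵒᵖ} (φ : j ⟶ k) {t : Itv j}
    (h : InBoundary t) : InBoundary (j := k) (φ.2.unop ≫ t) := by
  obtain ⟨i, rfl⟩ := h
  exact ⟨i, rfl⟩

/-- A sequential spectrum in pointed simplicial presheaves on `C`, i.e. a presheaf of sequential
spectra. The structure map `level n ∧ S¹ ⟶ level (n + 1)`, with `S¹ = Δ[1]/∂Δ[1]`, is given by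
its components `x ↦ σ (x ∧ t)` for the simplices `t` of `Δ[1]`. -/
structure PshSp (C : Type u) [Category.{v} C] where
  level : ℕ → PtSPsh.{v, u, w} C
  σ : ∀ (n : ℕ) (j : Cᵒᵖ × SimplexCategoryᵒᵖ) (_ : Itv j),
    (level n).obj j ⟶ (level (n + 1)).obj j
  σ_naturality : ∀ (n : ℕ) {j k : Cᵒᵖ × SimplexCategoryᵒᵖ} (φ : j ⟶ k) (t : Itv j),
    (level n).map φ ≫ σ n k (φ.2.unop ≫ t) = σ n j t ≫ (level (n + 1)).map φ
  σ_boundary : ∀ (n : ℕ) (j : Cᵒᵖ × SimplexCategoryᵒᵖ) (t : Itv j), InBoundary t →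
    ∀ x, (σ n j t).toFun x = ((level (n + 1)).obj j).point

namespace PshSp

/-- Morphisms of sequential spectra: levelwise morphisms compatible with the structure maps. -/
@[ext]
structure Hom (X Y : PshSp.{v, u, w} C) where
  app : ∀ n, X.level n ⟶ Y.level n
  comm : ∀ n j (t : Itv j), (app n).app j ≫ Y.σ n j t = X.σ n j t ≫ (app (n + 1)).app j

instance : Category (PshSp.{v, u, w} C) where
  Hom := Hom
  id X := ⟨fun _ => 𝟙 _, fun _ _ _ => rfl⟩
  comp f g := ⟨fun n => f.app n ≫ g.app n, fun n j t => by
    rw [NatTrans.comp_app, NatTrans.comp_app, Category.assoc, g.comm, ← Category.assoc, f.comm,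
      Category.assoc]⟩

@[simp] lemma id_app (X : PshSp.{v, u, w} C) (n : ℕ) : Hom.app (𝟙 X) n = 𝟙 _ := rfl
@[simp] lemma comp_app {X Y Z : PshSp.{v, u, w} C} (f : X ⟶ Y) (g : Y ⟶ Z) (n : ℕ) :
    (f ≫ g).app n = f.app n ≫ g.app n := rfl

lemma hom_ext {X Y : PshSp.{v, u, w} C} {f g : X ⟶ Y} (h : ∀ n, f.app n = g.app n) : f = g :=
  Hom.ext (funext h)

end PshSp

/-! ### Suspensions -/

/-- The points of `F × Δ[1]` that are collapsed in `F ∧ S¹`. -/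
def Collapsed {F : PtSPsh.{v, u, w} C} {j : Cᵒᵖ × SimplexCategoryᵒᵖ}
    (p : (F.obj j).X × Itv j) : Prop := p.1 = (F.obj j).point ∨ InBoundary p.2

/-- The relation on `F × Δ[1]` whose quotient is `F ∧ S¹`. -/
def SuspRel (F : PtSPsh.{v, u, w} C) (j : Cᵒᵖ × SimplexCategoryᵒᵖ)
    (p q : (F.obj j).X × Itv j) : Prop := Collapsed p ∧ Collapsed q

lemma Collapsed.map {F : PtSPsh.{v, u, w} C} {j k : Cᵒᵖ × SimplexCategoryᵒᵖ} (φ : j ⟶ k)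
    {p : (F.obj j).X × Itv j} (h : Collapsed p) :
    Collapsed (F := F) (j := k) ((F.map φ).toFun p.1, φ.2.unop ≫ p.2) := by
  rcases h with h | h
  · left
    change (F.map φ).toFun p.1 = _
    rw [h]
    exact (F.map φ).map_point
  · exact Or.inr (h.map φ)

/-- The suspension `F ∧ S¹` of a pointed simplicial presheaf. -/
def susp (F : PtSPsh.{v, u, w} C) : PtSPsh.{v, u, w} C where
  obj j := ⟨Quot (SuspRel F j), Quot.mk _ ((F.obj j).point, itvEnd j 0)⟩
  map {j k} φ :=
    ⟨Quot.map (fun p => ((F.map φ).toFun p.1, φ.2.unop ≫ p.2))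
      (fun _ _ h => ⟨h.1.map φ, h.2.map φ⟩),
      congrArg (Quot.mk _) (Prod.ext (F.map φ).map_point rfl)⟩
  map_id j := by
    apply Pointed.Hom.ext
    funext x
    induction x using Quot.ind with
    | mk p =>
      refine congrArg (Quot.mk _) (Prod.ext ?_ ?_)
      · exact congrFun (congrArg Pointed.Hom.toFun (F.map_id j)) p.1
      · exact Category.id_comp _
  map_comp {j k l} φ ψ := by
    apply Pointed.Hom.ext
    funext x
    induction x using Quot.ind with
    | mk p =>
      refine congrArg (Quot.mk _) (Prod.ext ?_ ?_)
      · exact congrFun (congrArg Pointed.Hom.toFun (F.map_comp φ ψ)) p.1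
      · exact Category.assoc _ _ _

/-- The map on suspensions at a fixed stage induced by a pointed map. -/
def suspMk {F F' : PtSPsh.{v, u, w} C} {j : Cᵒᵖ × SimplexCategoryᵒᵖ}
    (f : F.obj j ⟶ F'.obj j) : (susp F).obj j ⟶ (susp F').obj j :=
  ⟨Quot.map (fun p => (f.toFun p.1, p.2)) (by
    have key : ∀ p : (F.obj j).X × Itv j, Collapsed p →
        Collapsed (F := F') (j := j) (f.toFun p.1, p.2) := by
      rintro p (h | h)
      · left
        change f.toFun p.1 = _
        rw [h]
        exact f.map_point
      · exact Or.inr h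
    exact fun _ _ h => ⟨key _ h.1, key _ h.2⟩),
    congrArg (Quot.mk _) (Prod.ext f.map_point rfl)⟩

/-- The functoriality of the suspension. -/
def suspMap {F F' : PtSPsh.{v, u, w} C} (f : F ⟶ F') : susp F ⟶ susp F' where
  app j := suspMk (f.app j)
  naturality j k φ := by
    apply Pointed.Hom.ext
    funext x
    induction x using Quot.ind with
    | mk p =>
      refine congrArg (Quot.mk _) (Prod.ext ?_ rfl)
      exact congrFun (congrArg Pointed.Hom.toFun (f.naturality φ)) p.1

lemma susp_mk_eq_point (F : PtSPsh.{v, u, w} C) (j : Cᵒᵖ × SimplexCategoryᵒᵖ)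
    (p : (F.obj j).X × Itv j) (h : Collapsed p) :
    (Quot.mk _ p : Quot (SuspRel F j)) = ((susp F).obj j).point :=
  Quot.sound ⟨h, Or.inl rfl⟩

/-- The iterated suspension `F ∧ S¹ ∧ … ∧ S¹`. -/
def iterSusp (F : PtSPsh.{v, u, w} C) : ℕ → PtSPsh.{v, u, w} C
  | 0 => F
  | n + 1 => susp (iterSusp F n)

/-- The functoriality of the iterated suspension. -/
def iterSuspMap {F F' : PtSPsh.{v, u, w} C} (f : F ⟶ F') : ∀ n, iterSusp F n ⟶ iterSusp F' n
  | 0 => f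
  | n + 1 => suspMap (iterSuspMap f n)

lemma iterSuspMap_id (F : PtSPsh.{v, u, w} C) : ∀ n, iterSuspMap (𝟙 F) n = 𝟙 (iterSusp F n)
  | 0 => rfl
  | n + 1 => by
    rw [iterSuspMap, iterSuspMap_id F n]
    ext j x
    induction x using Quot.ind with
    | mk p => rfl

lemma iterSuspMap_comp {F F' F'' : PtSPsh.{v, u, w} C} (f : F ⟶ F') (g : F' ⟶ F'') :
    ∀ n, iterSuspMap (f ≫ g) n = iterSuspMap f n ≫ iterSuspMap g n
  | 0 => rfl
  | n + 1 => by
    rw [iterSuspMap, iterSuspMap_comp f g n]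
    ext j x
    induction x using Quot.ind with
    | mk p => rfl

/-- The suspension spectrum functor `Σ^∞`. -/
def suspSpectrum : PtSPsh.{v, u, w} C ⥤ PshSp.{v, u, w} C where
  obj F :=
    { level := iterSusp F
      σ := fun _ _ t => ⟨fun x => Quot.mk _ (x, t), susp_mk_eq_point _ _ _ (Or.inl rfl)⟩
      σ_naturality := fun _ _ _ _ _ => rfl
      σ_boundary := fun _ _ _ ht _ => susp_mk_eq_point _ _ _ (Or.inr ht) }
  map f := ⟨iterSuspMap f, fun _ _ _ => rfl⟩
  map_id F := PshSp.hom_ext fun n => iterSuspMap_id F n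
  map_comp f g := PshSp.hom_ext fun n => iterSuspMap_comp f g n

/-- A presheaf of sets with a disjoint base point, as a discrete pointed simplicial presheaf. -/
def plusFunctor : (Cᵒᵖ ⥤ Type w) ⥤ PtSPsh.{v, u, w} C where
  obj P := CategoryTheory.Prod.fst _ _ ⋙ P ⋙ typeToPointed
  map f := Functor.whiskerLeft (CategoryTheory.Prod.fst _ _) (Functor.whiskerRight f typeToPointed)

/-- The functor `Σ^∞_+` from presheaves of sets to presheaves of spectra. -/
def suspSpectrumPlus : (Cᵒᵖ ⥤ Type w) ⥤ PshSp.{v, u, w} C := plusFunctor ⋙ suspSpectrum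

/-! ### Cofibres -/

/-- The relation on `X ⊔ (A × Δ[1])` whose quotient is the reduced mapping cone. -/
inductive ConeRel {A X : PtSPsh.{v, u, w} C} (f : A ⟶ X) (j : Cᵒᵖ × SimplexCategoryᵒᵖ) :
    (X.obj j).X ⊕ ((A.obj j).X × Itv j) → (X.obj j).X ⊕ ((A.obj j).X × Itv j) → Prop
  | zero (a : (A.obj j).X) : ConeRel f j (Sum.inr (a, itvEnd j 0)) (Sum.inl (X.obj j).point)
  | point (t : Itv j) : ConeRel f j (Sum.inr ((A.obj j).point, t)) (Sum.inl (X.obj j).point)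
  | one (a : (A.obj j).X) :
      ConeRel f j (Sum.inr (a, itvEnd j 1)) (Sum.inl ((f.app j).toFun a))

/-- The map of mapping cones induced by a commutative square (of which only the evaluation at
possibly different stages `j`, `k` is used, together with a map of intervals). -/
def coneMk {A X A' X' : PtSPsh.{v, u, w} C} {f : A ⟶ X} {f' : A' ⟶ X'}
    {j k : Cᵒᵖ × SimplexCategoryᵒᵖ} (a : A.obj j ⟶ A'.obj k) (x : X.obj j ⟶ X'.obj k)
    (τ : Itv j → Itv k) (hτ : ∀ i, τ (itvEnd j i) = itvEnd k i)
    (h : a ≫ f'.app k = f.app j ≫ x) : Quot (ConeRel f j) → Quot (ConeRel f' k) :=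
  Quot.map (Sum.map x.toFun (Prod.map a.toFun τ)) (by
    rintro _ _ (b | t | b)
    · simp only [Sum.map_inr, Sum.map_inl, Prod.map, hτ, x.map_point]
      exact ConeRel.zero _
    · simp only [Sum.map_inr, Sum.map_inl, Prod.map, x.map_point, a.map_point]
      exact ConeRel.point _
    · simp only [Sum.map_inr, Sum.map_inl, Prod.map, hτ]
      have := congrFun (congrArg Pointed.Hom.toFun h) b
      simp only [Pointed.Hom.comp_toFun', Function.comp_apply] at this
      rw [← this]
      exact ConeRel.one _)

/-- The reduced mapping cone of a morphism of pointed simplicial presheaves. -/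
def coneLevel {A X : PtSPsh.{v, u, w} C} (f : A ⟶ X) : PtSPsh.{v, u, w} C where
  obj j := ⟨Quot (ConeRel f j), Quot.mk _ (Sum.inl (X.obj j).point)⟩
  map {j k} φ := ⟨coneMk (A.map φ) (X.map φ) (fun t => φ.2.unop ≫ t) (fun _ => rfl)
    (f.naturality φ), congrArg (fun y => Quot.mk _ (Sum.inl y)) (X.map φ).map_point⟩
  map_id j := by
    apply Pointed.Hom.ext
    funext x
    induction x using Quot.ind with
    | mk p =>
      rcases p with x | ⟨a, t⟩
      · exact congrArg (fun y => Quot.mk _ (Sum.inl y))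
          (congrFun (congrArg Pointed.Hom.toFun (X.map_id j)) x)
      · exact congrArg (fun y => Quot.mk _ (Sum.inr y)) (Prod.ext
          (congrFun (congrArg Pointed.Hom.toFun (A.map_id j)) a) (Category.id_comp _))
  map_comp {j k l} φ ψ := by
    apply Pointed.Hom.ext
    funext x
    induction x using Quot.ind with
    | mk p =>
      rcases p with x | ⟨a, t⟩
      · exact congrArg (fun y => Quot.mk _ (Sum.inl y))
          (congrFun (congrArg Pointed.Hom.toFun (X.map_comp φ ψ)) x)
      · exact congrArg (fun y => Quot.mk _ (Sum.inr y)) (Prod.ext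
          (congrFun (congrArg Pointed.Hom.toFun (A.map_comp φ ψ)) a) (Category.assoc _ _ _))

namespace PshSp

/-- The suspension `Σ X` of a spectrum, levelwise the suspension. -/
def suspension (X : PshSp.{v, u, w} C) : PshSp.{v, u, w} C where
  level n := susp (X.level n)
  σ n j t := suspMk (X.σ n j t)
  σ_naturality n j k φ t := by
    apply Pointed.Hom.ext
    funext x
    induction x using Quot.ind with
    | mk p =>
      refine congrArg (Quot.mk _) (Prod.ext ?_ rfl)
      exact congrFun (congrArg Pointed.Hom.toFun (X.σ_naturality n φ t)) p.1
  σ_boundary n j t ht x := by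
    induction x using Quot.ind with
    | mk p => exact susp_mk_eq_point _ _ _ (Or.inl (X.σ_boundary n j t ht p.1))

/-- The cofibre `X / A` of a morphism `f : A ⟶ X` of spectra, modelled by the mapping cone. -/
def cofiber {A X : PshSp.{v, u, w} C} (f : A ⟶ X) : PshSp.{v, u, w} C where
  level n := coneLevel (f.app n)
  σ n j t := ⟨coneMk (A.σ n j t) (X.σ n j t) id (fun _ => rfl) (f.comm n j t).symm,
    congrArg (fun y => Quot.mk _ (Sum.inl y)) (X.σ n j t).map_point⟩
  σ_naturality n j k φ t := by
    apply Pointed.Hom.ext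
    funext x
    induction x using Quot.ind with
    | mk p =>
      rcases p with x | ⟨a, s⟩
      · exact congrArg (fun y => Quot.mk _ (Sum.inl y))
          (congrFun (congrArg Pointed.Hom.toFun (X.σ_naturality n φ t)) x)
      · exact congrArg (fun y => Quot.mk _ (Sum.inr y)) (Prod.ext
          (congrFun (congrArg Pointed.Hom.toFun (A.σ_naturality n φ t)) a) rfl)
  σ_boundary n j t ht x := by
    induction x using Quot.ind with
    | mk p =>
      rcases p with x | ⟨a, s⟩
      · exact congrArg (fun y => Quot.mk _ (Sum.inl y)) (X.σ_boundary n j t ht x)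
      · refine Eq.trans ?_ (Quot.sound (ConeRel.point s))
        exact congrArg (fun y => Quot.mk _ (Sum.inr (y, s))) (A.σ_boundary n j t ht a)

/-- The canonical morphism `X ⟶ X / A`. -/
def toCofiber {A X : PshSp.{v, u, w} C} (f : A ⟶ X) : X ⟶ cofiber f where
  app _ :=
    { app := fun _ => ⟨fun x => Quot.mk _ (Sum.inl x), rfl⟩
      naturality := fun _ _ _ => rfl }
  comm _ _ _ := rfl

/-- The boundary morphism `X / A ⟶ Σ A`, which collapses `X`. -/
def boundary {A X : PshSp.{v, u, w} C} (f : A ⟶ X) : cofiber f ⟶ suspension A where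
  app n :=
    { app := fun j => ⟨Quot.lift
        (Sum.elim (fun _ => ((susp (A.level n)).obj j).point) (fun p => Quot.mk _ p)) (by
          rintro _ _ (b | t | b)
          · exact susp_mk_eq_point _ _ _ (Or.inr ⟨0, rfl⟩)
          · exact susp_mk_eq_point _ _ _ (Or.inl rfl)
          · exact susp_mk_eq_point _ _ _ (Or.inr ⟨1, rfl⟩)), rfl⟩
      naturality := fun j k φ => by
        apply Pointed.Hom.ext
        funext x
        induction x using Quot.ind with
        | mk p =>
          rcases p with x | ⟨a, s⟩
          · exact ((susp (A.level n)).map φ).map_point.symm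
          · rfl }
  comm n j t := by
    apply Pointed.Hom.ext
    funext x
    induction x using Quot.ind with
    | mk p =>
      rcases p with x | ⟨a, s⟩
      · exact ((suspension A).σ n j t).map_point
      · rfl

/-- The morphism of cofibres `X / A ⟶ X' / A'` induced by a commutative square. -/
def cofiberMap {A X A' X' : PshSp.{v, u, w} C} (f : A ⟶ X) (f' : A' ⟶ X') (a : A ⟶ A')
    (x : X ⟶ X') (h : a ≫ f' = f ≫ x) : cofiber f ⟶ cofiber f' where
  app n :=
    { app := fun j => ⟨coneMk ((a.app n).app j) ((x.app n).app j) id (fun _ => rfl)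
          (congrFun (congrArg NatTrans.app (congrFun (congrArg Hom.app h) n)) j),
        congrArg (fun y => Quot.mk _ (Sum.inl y)) ((x.app n).app j).map_point⟩
      naturality := fun j k φ => by
        apply Pointed.Hom.ext
        funext y
        induction y using Quot.ind with
        | mk p =>
          rcases p with y | ⟨b, s⟩
          · exact congrArg (fun y => Quot.mk _ (Sum.inl y))
              (congrFun (congrArg Pointed.Hom.toFun ((x.app n).naturality φ)) y)
          · exact congrArg (fun y => Quot.mk _ (Sum.inr y)) (Prod.ext
              (congrFun (congrArg Pointed.Hom.toFun ((a.app n).naturality φ)) b) rfl) }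
  comm n j t := by
    apply Pointed.Hom.ext
    funext y
    induction y using Quot.ind with
    | mk p =>
      rcases p with y | ⟨b, s⟩
      · exact congrArg (fun y => Quot.mk _ (Sum.inl y))
          (congrFun (congrArg Pointed.Hom.toFun (x.comm n j t)) y)
      · exact congrArg (fun y => Quot.mk _ (Sum.inr y)) (Prod.ext
          (congrFun (congrArg Pointed.Hom.toFun (a.comm n j t)) b) rfl)

/-! ### Equivalences -/

/-- The `n`-th space of the spectrum of sections over `T`, as a simplicial set. -/
def space (X : PshSp.{v, u, w} C) (n : ℕ) (T : Cᵒᵖ) : SSet.{w} :=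
  (show SimplexCategoryᵒᵖ ⥤ Type w from Prod.sectR T SimplexCategoryᵒᵖ ⋙ X.level n ⋙ forget Pointed)

/-- The induced map on `n`-th spaces over `T`. -/
def spaceMap {X Y : PshSp.{v, u, w} C} (f : X ⟶ Y) (n : ℕ) (T : Cᵒᵖ) : X.space n T ⟶ Y.space n T :=
  Functor.whiskerLeft (Prod.sectR T SimplexCategoryᵒᵖ) (Functor.whiskerRight (f.app n) (forget Pointed))

end PshSp

/-- Simplicial homotopy classes of maps. -/
def HtpyClasses (K Z : SSet.{w}) : Type w := Quot fun f g : K ⟶ Z => Nonempty (SSet.Homotopy f g)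

/-- A weak homotopy equivalence of simplicial sets: a map that induces a bijection on homotopy
classes of maps into every Kan complex. -/
def IsWeakHtpyEquiv {K L : SSet.{w}} (f : K ⟶ L) : Prop :=
  ∀ Z : SSet.{w}, SSet.KanComplex Z →
    ∃ e : HtpyClasses L Z → HtpyClasses K Z,
      (∀ g : L ⟶ Z, e (Quot.mk _ g) = Quot.mk _ (f ≫ g)) ∧ Function.Bijective e

/-- A morphism of presheaves of spectra that is a weak homotopy equivalence on the `n`-th spaces
for all sufficiently large `n`. Such morphisms are stable equivalences, and together they generate
the stable equivalences. -/
def EventualEquiv : MorphismProperty (PshSp.{v, u, w} C) := fun _ _ f =>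
  ∃ N : ℕ, ∀ n ≥ N, ∀ T : Cᵒᵖ, IsWeakHtpyEquiv (PshSp.spaceMap f n T)

/-- Levelwise injectivity. -/
def LevelInjective : MorphismProperty (PshSp.{v, u, w} C) := fun _ _ f =>
  ∀ n j, Function.Injective ((f.app n).app j).toFun

/-- The closure properties of a class of equivalences coming from an exact localization of the
stable presentable `∞`-category of presheaves of spectra (a strongly saturated class closed under
desuspension): two-out-of-three, compatibility with homotopy (co)cartesian squares (i.e. push-outs
in which one of the two legs is levelwise injective) and closure under small coproducts and small
filtered colimits. -/
structure IsSaturatedClass (S : MorphismProperty (PshSp.{v, u, w} C)) : Prop where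
  two_of_three : S.HasTwoOutOfThreeProperty
  homotopy_cocartesian : ∀ {A X B Y : PshSp.{v, u, w} C} {i : A ⟶ X} {f : A ⟶ B} {g : X ⟶ Y}
    {j : B ⟶ Y}, IsPushout i f g j → (LevelInjective i ∨ LevelInjective f) → (S f ↔ S g)
  coproducts : MorphismProperty.IsStableUnderCoproducts.{w} S
  filtered : MorphismProperty.IsStableUnderFilteredColimits.{w, w} S

/-- The smallest class of equivalences, in the sense of exact localizations, that contains the
given morphisms and all stable equivalences. -/
def localEquivalences (S : MorphismProperty (PshSp.{v, u, w} C)) :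
    MorphismProperty (PshSp.{v, u, w} C) := fun _ _ f =>
  ∀ L : MorphismProperty (PshSp.{v, u, w} C), IsSaturatedClass L → EventualEquiv ≤ L → S ≤ L → L f

end Spectra

/-! ## Equivariant coarse motivic spectra -/

section Motives

variable (G : Type u) [Group G]

/-- Presheaves of spectra on the category of `G`-bornological coarse spaces. The spaces live in the
universe `u`, the presheaves take values in the next one, where the category is small. -/
abbrev CoarsePshSp := PshSp.{u, u + 1, u + 1} (GBornCoarse.{u, u} G)

variable {G}

/-- The represented presheaf of sets. -/
abbrev yo (X : GBornCoarse.{u, u} G) : (GBornCoarse.{u, u} G)ᵒᵖ ⥤ Type (u + 1) :=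
  uliftYoneda.{u + 1}.obj X

/-- The presheaf of spectra `Σ^∞_+ yo(X)`. -/
def yoSp : GBornCoarse.{u, u} G ⥤ CoarsePshSp G := uliftYoneda.{u + 1} ⋙ suspSpectrumPlus

/-- The subpresheaf of `yo X` of morphisms with image in `Z` or in a member of `F`. For an
equivariant complementary pair `(Z, F)` this is the push-out (and homotopy push-out) of
`yo Z` and `colim_{A ∈ F} yo A` along `colim_{A ∈ F} yo (Z ∩ A)`. -/
def excisionSub (X : GBornCoarse.{u, u} G) (Z : Set X) (F : Set (Set X)) : Subfunctor (yo X) where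
  obj _ := {f | (∀ t, GBornCoarse.fn f.down t ∈ Z) ∨ ∃ A ∈ F, ∀ t, GBornCoarse.fn f.down t ∈ A}
  map φ f := by
    rintro (h | ⟨A, hA, h⟩)
    · exact Or.inl fun t => h _
    · exact Or.inr ⟨A, hA, fun t => h _⟩

/-- The subpresheaf of `yo X` of morphisms that are controlled with respect to the coarse structure
generated by some invariant entourage `U` of `X`; this is `colim_U yo (X_U)`. -/
def continuitySub (X : GBornCoarse.{u, u} G) : Subfunctor (yo X) where
  obj T := {f | ∃ U, X.coarse.IsEntourage U ∧ InvariantRel G U ∧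
    ∀ V, T.unop.coarse.IsEntourage V → GBornCoarse.InGenerated U
      (Prod.map (GBornCoarse.fn f.down) (GBornCoarse.fn f.down) '' V)}
  map {T T'} φ f := by
    rintro ⟨U, hU, hi, h⟩
    refine ⟨U, hU, hi, fun V hV S hS => S.subset (h _ (φ.unop.controlled V hV) S hS) ?_⟩
    rintro _ ⟨p, hp, rfl⟩
    exact ⟨_, ⟨p, hp, rfl⟩, rfl⟩

/-- `Σ^∞_+` of the inclusion of a subpresheaf of `yo X`. -/
abbrev subIncl {X : GBornCoarse.{u, u} G} (P : Subfunctor (yo X)) :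
    suspSpectrumPlus.obj P.toFunctor ⟶ yoSp.obj X := suspSpectrumPlus.map P.ι

/-- The morphisms that are inverted by the universal equivariant coarse homology theory: they
express coarse invariance, excision, vanishing on flasques and `u`-continuity. -/
inductive CoarseGenerator : MorphismProperty (CoarsePshSp G)
  | invariance (X : GBornCoarse.{u, u} G) : CoarseGenerator (yoSp.map X.twoPointProj)
  | excision (X : GBornCoarse.{u, u} G) (Z : Set X) (F : Set (Set X))
      (h : X.IsComplementaryPair Z F) : CoarseGenerator (subIncl (excisionSub X Z F))
  | flasque (X : GBornCoarse.{u, u} G) (h : X.IsFlasque) :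
      CoarseGenerator (subIncl (⊥ : Subfunctor (yo X)))
  | continuity (X : GBornCoarse.{u, u} G) : CoarseGenerator (subIncl (continuitySub X))

variable (G) in
/-- The homotopy category of the stable `∞`-category `G Sp𝒳` of equivariant coarse motivic spectra,
presented as a localization of presheaves of spectra. -/
abbrev GSpX := (localEquivalences (CoarseGenerator (G := G))).Localization

/-- The functor `Yo^s : G BornCoarse ⥤ G Sp𝒳`, on the level of homotopy categories. -/
noncomputable def motive : GBornCoarse.{u, u} G ⥤ GSpX G :=
  yoSp ⋙ (localEquivalences (CoarseGenerator (G := G))).Q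

/-- Weak flasqueness: there is a shift that induces the identity on motives. -/
def GBornCoarse.IsWeaklyFlasque (X : GBornCoarse.{u, u} G) : Prop :=
  ∃ f : X ⟶ X, motive.map f = 𝟙 (motive.obj X) ∧ GBornCoarse.IsShift f

/-- The generators for the universal strong equivariant coarse homology theory: in addition,
vanishing on weakly flasque spaces. -/
inductive StrongGenerator : MorphismProperty (CoarsePshSp G)
  | coarse {X Y : CoarsePshSp G} (f : X ⟶ Y) (h : CoarseGenerator f) : StrongGenerator f
  | weaklyFlasque (X : GBornCoarse.{u, u} G) (h : X.IsWeaklyFlasque) :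
      StrongGenerator (subIncl (⊥ : Subfunctor (yo X)))

variable (G) in
/-- The homotopy category of the stable `∞`-category `G Sp𝒳_wfl`. A morphism of presheaves of
spectra becomes an equivalence in `G Sp𝒳_wfl` if and only if it becomes an isomorphism here. -/
abbrev GSpXwfl := (localEquivalences (StrongGenerator (G := G))).Localization

variable (G) in
/-- The localization functor from presheaves of spectra to (the homotopy category of)
`G Sp𝒳_wfl`. Note that `Yo^s_wfl` is the composition `yoSp ⋙ toWfl G`. -/
abbrev toWfl : CoarsePshSp G ⥤ GSpXwfl G := (localEquivalences (StrongGenerator (G := G))).Q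

end Motives

/-! ## The diagram -/

section Diagram

variable {G : Type u} [Group G]

/-- `Yo(𝒪(M_-)) ⟶ Yo(𝒪(ℝ ⊗ M))`. -/
abbrev yoMinusIncl (M : GUBC.{u, u} G) :
    yoSp.obj (GUBC.cone.obj M.minusPart) ⟶ yoSp.obj (GUBC.cone.obj ((GUBC.line G).tensor M)) :=
  yoSp.map (GUBC.cone.map M.minusIncl)

/-- `Yo(𝒪(M)) ⟶ Yo(𝒪(M_+))`. -/
abbrev yoToPlus (M : GUBC.{u, u} G) :
    yoSp.obj (GUBC.cone.obj M) ⟶ yoSp.obj (GUBC.cone.obj M.plusPart) :=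
  yoSp.map (GUBC.cone.map M.toPlus)

/-- The first marked morphism `Yo(𝒪(ℝ ⊗ M)) ⟶ Yo(𝒪(ℝ ⊗ M)) / Yo(𝒪(M_-))`. -/
abbrev markedOne (M : GUBC.{u, u} G) :
    yoSp.obj (GUBC.cone.obj ((GUBC.line G).tensor M)) ⟶ PshSp.cofiber (yoMinusIncl M) :=
  PshSp.toCofiber (yoMinusIncl M)

/-- The second marked morphism `Yo(𝒪(M_+)) / Yo(𝒪(M)) ⟶ Σ Yo(𝒪(M))`. -/
abbrev markedTwo (M : GUBC.{u, u} G) :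
    PshSp.cofiber (yoToPlus M) ⟶ PshSp.suspension (yoSp.obj (GUBC.cone.obj M)) :=
  PshSp.boundary (yoToPlus M)

/-- The upper vertical morphism
`Yo(𝒪(M_+)) / Yo(𝒪(M)) ⟶ Yo(𝒪(ℝ ⊗ M)) / Yo(𝒪(M_-))`. -/
def upperVertical (M : GUBC.{u, u} G) :
    PshSp.cofiber (yoToPlus M) ⟶ PshSp.cofiber (yoMinusIncl M) :=
  PshSp.cofiberMap _ _ (yoSp.map (GUBC.cone.map M.toMinus)) (yoSp.map (GUBC.cone.map M.plusIncl))
    (by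
      rw [← yoSp.map_comp, ← yoSp.map_comp, ← GUBC.cone.map_comp, ← GUBC.cone.map_comp]
      rfl)

section Lower

variable (N : GUBC.{u, u} G) (W A : Set N) (hW : InvariantSet G W) (hA : InvariantSet G A)

/-- The subspace `M = W ∩ M_∞`. -/
abbrev interface : GUBC.{u, u} G := N.sub (W ∩ A) (invariant_inter hW hA)

lemma invariant_stripSet {W : Set N} (hW : InvariantSet G W) :
    InvariantSet G (X := GUBC.coneMinus N) {p : ℝ × N | p.2 ∈ W} := fun g _ h => hW g _ h

lemma invariant_ySet {W : Set N} (hW : InvariantSet G W) :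
    InvariantSet G (X := GUBC.coneMinus N) {p : ℝ × N | (p.1 ≤ 0 ∧ p.2 ∈ W) ∨ 0 ≤ p.1} := by
  rintro g p (h | h)
  · exact Or.inl ⟨h.1, hW g _ h.2⟩
  · exact Or.inr h

/-- The subspace `ℝ × W` of `𝒪(W_∞)_-`. -/
def strip : GBornCoarse.{u, u} G := (GUBC.coneMinus N).sub _ (invariant_stripSet N hW)

/-- The subspace `Y = (-∞, 0] × W ∪ [0, ∞) × W_∞` of `𝒪(W_∞)_-`. -/
def ySpace : GBornCoarse.{u, u} G := (GUBC.coneMinus N).sub _ (invariant_ySet N hW)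

variable {W} in
/-- The inclusion of `ℝ × W` into `Y`. -/
def stripIncl : strip N W hW ⟶ ySpace N W hW :=
  GBornCoarse.lift ((GUBC.coneMinus N).incl _ (invariant_stripSet N hW)) _ (invariant_ySet N hW)
    (fun t => (le_total (GBornCoarse.val t).1 0).imp (fun h => ⟨h, t.2⟩) id)

variable {W A} in
/-- The inclusion of `𝒪(M) = [0, ∞) × M` into `ℝ × W`. -/
def coneToStrip : GUBC.cone.obj (interface N W A hW hA) ⟶ strip N W hW :=
  GBornCoarse.lift (GUBC.cone.map (N.incl _ (invariant_inter hW hA)) ≫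
    (GUBC.coneMinus N).incl _ (GUBC.invariant_nonneg N)) _ (invariant_stripSet N hW)
    (fun t => And.left (a := (GUBC.val t.1.2 : N.carrier) ∈ W)
      (Subtype.property (p := fun x => x ∈ W ∩ A) t.1.2))

variable {W A} in
/-- The morphism `𝒪(M_+) ⟶ Y` given by an identification of `M_+` with `M_∞`. -/
def conePlusToY (φ : (interface N W A hW hA).plusPart ≅ N.sub A hA) :
    GUBC.cone.obj (interface N W A hW hA).plusPart ⟶ ySpace N W hW :=
  GBornCoarse.lift (GUBC.cone.map (φ.hom ≫ N.incl A hA) ≫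
    (GUBC.coneMinus N).incl _ (GUBC.invariant_nonneg N)) _ (invariant_ySet N hW)
    (fun t => Or.inr t.2)

/-- The identification of `M_+ = [0, ∞) ⊗ M` with `M_∞` extends the inclusion of `M` into `M_∞`. -/
def IsCollar (φ : (interface N W A hW hA).plusPart ≅ N.sub A hA) : Prop :=
  ∀ m : interface N W A hW hA,
    GUBC.val (GUBC.fn φ.hom (GUBC.fn (interface N W A hW hA).toPlus m)) = GUBC.val m

/-- The morphism `Yo((ℝ × W)) ⟶ Yo(Y)`, both with the structures induced from `𝒪(W_∞)_-`. -/
abbrev yoStripIncl : yoSp.obj (strip N W hW) ⟶ yoSp.obj (ySpace N W hW) :=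
  yoSp.map (stripIncl N hW)

/-- The lower vertical morphism `Yo(𝒪(M_+)) / Yo(𝒪(M)) ⟶ Yo(Y) / Yo(ℝ × W)`. -/
def lowerVertical (φ : (interface N W A hW hA).plusPart ≅ N.sub A hA)
    (hφ : IsCollar N W A hW hA φ) :
    PshSp.cofiber (yoToPlus (interface N W A hW hA)) ⟶ PshSp.cofiber (yoStripIncl N W hW) :=
  PshSp.cofiberMap _ _ (yoSp.map (coneToStrip N hW hA)) (yoSp.map (conePlusToY N hW hA φ)) (by
    rw [← yoSp.map_comp, ← yoSp.map_comp]
    refine congrArg yoSp.map (GBornCoarse.hom_ext fun t => Subtype.ext ?_)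
    exact congrArg (Prod.mk (t.1.1 : ℝ)) (hφ t.1.2).symm)

/-- The morphism `susp : Yo_wfl(𝒪(ℝ ⊗ M)) ⟶ Σ Yo_wfl(𝒪(M))` of the upper part of the diagram. -/
noncomputable def suspMor (M : GUBC.{u, u} G) (_ : IsIso ((toWfl G).map (upperVertical M))) :
    (toWfl G).obj (yoSp.obj (GUBC.cone.obj ((GUBC.line G).tensor M))) ⟶
      (toWfl G).obj (PshSp.suspension (yoSp.obj (GUBC.cone.obj M))) :=
  (toWfl G).map (markedOne M) ≫ inv ((toWfl G).map (upperVertical M)) ≫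
    (toWfl G).map (markedTwo M)

/-- The Mayer-Vietoris boundary `∂' : Yo_wfl(Y) ⟶ Σ Yo_wfl(𝒪(M))` of the lower part of the
diagram, which is defined when the lower left square is a push-out, that is, when the induced
morphism of the horizontal cofibres is an equivalence. -/
noncomputable def boundaryPrime (φ : (interface N W A hW hA).plusPart ≅ N.sub A hA)
    (hφ : IsCollar N W A hW hA φ) (_ : IsIso ((toWfl G).map (lowerVertical N W A hW hA φ hφ))) :
    (toWfl G).obj (yoSp.obj (ySpace N W hW)) ⟶
      (toWfl G).obj (PshSp.suspension (yoSp.obj (GUBC.cone.obj (interface N W A hW hA)))) :=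
  (toWfl G).map (PshSp.toCofiber (yoStripIncl N W hW)) ≫
    inv ((toWfl G).map (lowerVertical N W A hW hA φ hφ)) ≫
      (toWfl G).map (markedTwo (interface N W A hW hA))

end Lower

end Diagram

end CoarseMotives

open CoarseMotives

namespace CoarseMotives

/-! ### Mapping cones of spectra and their universal properties -/

section SpectraLemmas

variable {C : Type u} [Category.{v} C]

namespace PshSp

/-! Two facts carry the theorem: the cones over both half lines `M_+` and `M_-` vanish in the strong
theory, and `𝒪(ℝ ⊗ M)` satisfies Mayer–Vietoris for its decomposition into these cones.

Vanishing (`isWeaklyFlasque_of_halfLine`). On the cone over `ℝ ⊗ M`, with coordinates `(t, r, m)`,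
the translation `r ↦ r ± 1` preserves the half line in question. It keeps `t`, `m` and all
differences of `r`, so the union of all its iterates of an entourage is still an entourage, and it
moves every point out of each bounded set and its `G`-translates. The displacement does not shrink
as `t → ∞`, so closeness to the identity in the hybrid structure cannot be expected. However, there
is a coarse homotopy on a cylinder of height `1 + t`: at parameter `s` the point has moved by `s /
(1 + t)`, and bounded changes of `s` and `t` change this by a quantity of order `1 / (1 + t)`. Hence
the translation induces the identity on `Yo^s`, and the cone is weakly flasque.

Homotopy invariance is not among the generators. It is deduced (`bottom_mem`,
`motive_map_eq_of_homotopy`) from excision and flasqueness: the region of `ℝ ⊗ X` below a graph is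
flasque by shifting downwards, and the cylinder is the part of such a region above height zero.

Mayer–Vietoris (`mayerVietoris`). Excision concerns a subset `Z` and a big family. With the
thickenings of `P` as the big family, a coarse retraction `ρ` onto `P` that preserves `Z` lets one
replace every thickening by `P`, and `Z` intersected with it by `Z ∩ P`. This makes the map of
cofibres `P / (Z ∩ P) ⟶ D / Z` an equivalence. With `ρ = max(r, 0)` this gives the morphism `v`.

The rest is formal. Dividing by a zero object changes nothing, which gives `c`; the boundary `X / A
⟶ Σ A` is an equivalence if `X` vanishes, which gives `δ`; the last formula is the cancellation of
inverses. A morphism becomes invertible as soon as it lies in every saturated class `L` that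
contains the generators and the eventual equivalences, so all arguments take place in a fixed `L`,
with explicit mapping cones and with push-outs that have a levelwise injective leg. -/

lemma ext_toFun {X Y : PshSp.{v, u, w} C} {f g : X ⟶ Y}
    (h : ∀ n j x, ((f.app n).app j).toFun x = ((g.app n).app j).toFun x) : f = g :=
  hom_ext fun n => NatTrans.ext (funext fun j => Pointed.Hom.ext (funext (h n j)))

lemma congr_toFun {X Y : PshSp.{v, u, w} C} {f g : X ⟶ Y} (h : f = g) (n : ℕ)
    (j : Cᵒᵖ × SimplexCategoryᵒᵖ) (x : ((X.level n).obj j).X) :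
    ((f.app n).app j).toFun x = ((g.app n).app j).toFun x := by rw [h]

lemma map_toFun {X Y : PshSp.{v, u, w} C} (f : X ⟶ Y) (n : ℕ) {j k : Cᵒᵖ × SimplexCategoryᵒᵖ}
    (φ : j ⟶ k) (x : ((X.level n).obj j).X) :
    ((f.app n).app k).toFun (((X.level n).map φ).toFun x) =
      ((Y.level n).map φ).toFun (((f.app n).app j).toFun x) :=
  congrFun (congrArg Pointed.Hom.toFun ((f.app n).naturality φ)) x

lemma σ_toFun {X Y : PshSp.{v, u, w} C} (f : X ⟶ Y) (n : ℕ) (j : Cᵒᵖ × SimplexCategoryᵒᵖ)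
    (t : Itv j) (x : ((X.level n).obj j).X) :
    (Y.σ n j t).toFun (((f.app n).app j).toFun x) =
      ((f.app (n + 1)).app j).toFun ((X.σ n j t).toFun x) :=
  congrFun (congrArg Pointed.Hom.toFun (f.comm n j t)) x

/-- A morphism of spectra from compatible pointed maps. -/
def homMk {X Y : PshSp.{v, u, w} C} (f : ∀ n j, ((X.level n).obj j).X → ((Y.level n).obj j).X)
    (hp : ∀ n j, f n j ((X.level n).obj j).point = ((Y.level n).obj j).point)
    (hm : ∀ n {j k : Cᵒᵖ × SimplexCategoryᵒᵖ} (φ : j ⟶ k) x,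
      f n k (((X.level n).map φ).toFun x) = ((Y.level n).map φ).toFun (f n j x))
    (hσ : ∀ n j t x, (Y.σ n j t).toFun (f n j x) = f (n + 1) j ((X.σ n j t).toFun x)) :
    X ⟶ Y where
  app n :=
    { app := fun j => ⟨f n j, hp n j⟩
      naturality := fun _ _ φ => Pointed.Hom.ext (funext (hm n φ)) }
  comm n j t := Pointed.Hom.ext (funext (hσ n j t))

variable (C) in
/-- The zero spectrum. -/
def zero : PshSp.{v, u, w} C where
  level _ := (Functor.const _).obj ⟨PUnit, PUnit.unit⟩
  σ _ _ _ := ⟨id, rfl⟩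
  σ_naturality _ _ _ _ _ := rfl
  σ_boundary _ _ _ _ _ := rfl

lemma isZero_of_subsingleton (X : PshSp.{v, u, w} C)
    (h : ∀ n j, Subsingleton ((X.level n).obj j).X) : IsZero X where
  unique_to Y := ⟨⟨⟨homMk (fun n j _ => ((Y.level n).obj j).point) (fun _ _ => rfl)
    (fun n _ _ φ _ => ((Y.level n).map φ).map_point.symm)
    (fun n j t _ => (Y.σ n j t).map_point)⟩, fun f => ext_toFun fun n j x => by
      rw [(h n j).elim x ((X.level n).obj j).point]
      exact ((f.app n).app j).map_point⟩⟩
  unique_from Y := ⟨⟨⟨homMk (fun n j _ => ((X.level n).obj j).point) (fun _ _ => rfl)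
    (fun n _ _ φ _ => ((X.level n).map φ).map_point.symm)
    (fun n j t _ => (X.σ n j t).map_point)⟩, fun f => ext_toFun fun n j x => (h n j).elim _ _⟩⟩

lemma isZero_zero : IsZero (zero.{v, u, w} C) :=
  isZero_of_subsingleton _ fun _ _ => inferInstanceAs (Subsingleton PUnit)

lemma cofiber_ext {A X T : PshSp.{v, u, w} C} {f : A ⟶ X} {p q : cofiber f ⟶ T}
    (h : ∀ n j x, ((p.app n).app j).toFun (Quot.mk _ (Sum.inl x)) =
      ((q.app n).app j).toFun (Quot.mk _ (Sum.inl x)))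
    (h' : ∀ n j a, ((p.app n).app j).toFun (Quot.mk _ (Sum.inr a)) =
      ((q.app n).app j).toFun (Quot.mk _ (Sum.inr a))) : p = q := by
  refine ext_toFun fun n j x => ?_
  induction x using Quot.ind with
  | mk x =>
    rcases x with x | a
    · exact h n j x
    · exact h' n j a

/-- The reduced cone on a spectrum. -/
abbrev coneOn (A : PshSp.{v, u, w} C) : PshSp.{v, u, w} C := cofiber (𝟙 A)

/-- The inclusion of the base into the reduced cone. -/
abbrev toCone (A : PshSp.{v, u, w} C) : A ⟶ coneOn A := toCofiber (𝟙 A)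

/-- The functoriality of the reduced cone. -/
abbrev coneOnMap {A B : PshSp.{v, u, w} C} (a : A ⟶ B) : coneOn A ⟶ coneOn B :=
  cofiberMap (𝟙 A) (𝟙 B) a a rfl

/-- The canonical morphism from the cone of the source to the mapping cone. -/
abbrev coneToCofiber {A X : PshSp.{v, u, w} C} (f : A ⟶ X) : coneOn A ⟶ cofiber f :=
  cofiberMap (𝟙 A) f (𝟙 A) f rfl

/-- The universal property of the mapping cone. -/
def cofiberDesc {A X T : PshSp.{v, u, w} C} (f : A ⟶ X) (x : X ⟶ T) (c : coneOn A ⟶ T)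
    (h : f ≫ x = toCone A ≫ c) : cofiber f ⟶ T :=
  homMk (fun n j => Quot.lift (Sum.elim ((x.app n).app j).toFun
      (fun a => ((c.app n).app j).toFun (Quot.mk _ (Sum.inr a)))) (by
        rintro _ _ (a | t | a)
        · refine (congrArg ((c.app n).app j).toFun (Quot.sound (ConeRel.zero a))).trans ?_
          exact ((c.app n).app j).map_point.trans ((x.app n).app j).map_point.symm
        · refine (congrArg ((c.app n).app j).toFun (Quot.sound (ConeRel.point t))).trans ?_
          exact ((c.app n).app j).map_point.trans ((x.app n).app j).map_point.symm
        · exact (congrArg ((c.app n).app j).toFun (Quot.sound (ConeRel.one a))).trans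
            (congr_toFun h n j a).symm))
    (fun n j => ((x.app n).app j).map_point)
    (fun n j k φ y => by
      induction y using Quot.ind with
      | mk y =>
        rcases y with y | ⟨a, s⟩
        · exact map_toFun x n φ y
        · exact map_toFun c n φ (Quot.mk _ (Sum.inr (a, s))))
    (fun n j t y => by
      induction y using Quot.ind with
      | mk y =>
        rcases y with y | ⟨a, s⟩
        · exact σ_toFun x n j t y
        · exact σ_toFun c n j t (Quot.mk _ (Sum.inr (a, s))))

/-- Since the leg `toCone A` is levelwise injective, this square is homotopy cocartesian; it is the
link between mapping cones and the axioms of a saturated class. -/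
lemma isPushout_cofiber {A X : PshSp.{v, u, w} C} (f : A ⟶ X) :
    IsPushout f (toCone A) (toCofiber f) (coneToCofiber f) where
  w := rfl
  isColimit' := ⟨PushoutCocone.IsColimit.mk _ (fun s => cofiberDesc f s.inl s.inr s.condition)
    (fun _ => rfl)
    (fun s => cofiber_ext (fun n j a => (congr_toFun s.condition n j a)) fun _ _ _ => rfl)
    (fun _ _ h1 h2 => cofiber_ext (fun n j x => congr_toFun h1 n j x)
      fun n j a => congr_toFun h2 n j (Quot.mk _ (Sum.inr a)))⟩

lemma toCofiber_injective {A X : PshSp.{v, u, w} C} (f : A ⟶ X) :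
    LevelInjective (toCofiber f) := by
  classical
  intro n j x y h
  -- A left inverse at a single stage: the end `1` goes to `X` by `f`, all other points of the
  -- cylinder go to the base point. It need not be simplicial.
  have hr : ∀ p q, ConeRel (f.app n) j p q →
      Sum.elim id (fun a => if a.2 = itvEnd j 1 then ((f.app n).app j).toFun a.1 else
        ((X.level n).obj j).point) p =
      Sum.elim id (fun a => if a.2 = itvEnd j 1 then ((f.app n).app j).toFun a.1 else
        ((X.level n).obj j).point) q := by
    rintro _ _ (a | t | a)
    · have h01 : itvEnd j 0 ≠ itvEnd j 1 := fun h =>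
        absurd (congrArg (fun φ => SimplexCategory.Hom.toOrderHom φ 0) h) (by simp)
      simp [h01]
    · simp only [Sum.elim_inr, Sum.elim_inl, id]
      split_ifs
      · exact ((f.app n).app j).map_point
      · rfl
    · simp
  exact congrArg (Quot.lift _ hr) h

/-- Collapsing `X` sends both ends of the cylinder to the base point, which leaves `A ∧ S¹`. As
`toCofiber f` is injective, the boundary is an equivalence whenever `X ⟶ 0` is. -/
lemma cofiber_isPushout_boundary {A X : PshSp.{v, u, w} C} (f : A ⟶ X) :
    IsPushout (toCofiber f) (isZero_zero.from_ X) (boundary f)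
      (isZero_zero.to_ (suspension A)) where
  w := ext_toFun fun n j _ => (((isZero_zero.to_ (suspension A)).app n).app j).map_point.symm
  isColimit' := ⟨PushoutCocone.IsColimit.mk _
    (fun s => homMk (fun n j => Quot.lift
        (fun a => ((s.inl.app n).app j).toFun (Quot.mk _ (Sum.inr a))) (by
          have key : ∀ p : ((A.level n).obj j).X × Itv j, Collapsed p →
              ((s.inl.app n).app j).toFun (Quot.mk _ (Sum.inr p)) =
                ((s.pt.level n).obj j).point := by
            rintro ⟨a, t⟩ (h | ⟨i, h⟩)
            · obtain rfl : a = _ := h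
              exact (congrArg ((s.inl.app n).app j).toFun (Quot.sound (ConeRel.point t))).trans
                ((s.inl.app n).app j).map_point
            · obtain rfl : t = _ := h
              fin_cases i
              · exact (congrArg ((s.inl.app n).app j).toFun (Quot.sound (ConeRel.zero a))).trans
                  ((s.inl.app n).app j).map_point
              · refine (congrArg ((s.inl.app n).app j).toFun (Quot.sound (ConeRel.one a))).trans ?_
                refine (congr_toFun s.condition n j _).trans ?_
                exact ((s.inr.app n).app j).map_point
          intro a b h
          rw [key a h.1, key b h.2]))
      (fun n j => (congrArg ((s.inl.app n).app j).toFun (Quot.sound (ConeRel.point _))).trans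
                ((s.inl.app n).app j).map_point)
      (fun n j k φ y => by
        induction y using Quot.ind with
        | mk y => exact map_toFun s.inl n φ (Quot.mk _ (Sum.inr y)))
      (fun n j t y => by
        induction y using Quot.ind with
        | mk y => exact σ_toFun s.inl n j t (Quot.mk _ (Sum.inr y))))
    (fun s => cofiber_ext (fun n j a => by
        refine Eq.trans ?_ (congr_toFun s.condition n j a).symm
        refine Eq.trans ?_ ((s.inr.app n).app j).map_point.symm
        refine (congrArg ((s.inl.app n).app j).toFun (Quot.sound (ConeRel.point _))).trans
                ((s.inl.app n).app j).map_point) fun _ _ _ => rfl)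
    (fun _ => isZero_zero.eq_of_src _ _)
    (fun _ _ h1 _ => ext_toFun fun n j x => by
      induction x using Quot.ind with
      | mk x => exact congr_toFun h1 n j (Quot.mk _ (Sum.inr x)))⟩

end PshSp

end SpectraLemmas

/-! ### Weak equivalences from explicit homotopies; contractibility of reduced cones -/

section SpectraLemmas

variable {C : Type u} [Category.{v} C]

open MonoidalCategory Simplicial in
/-- A homotopy of maps of simplicial sets from its underlying map. -/
lemma nonempty_homotopy {K L : SSet.{w}} {f g : K ⟶ L} (h : K ⊗ Δ[1] ⟶ L)
    (h0 : SSet.ι₀ ≫ h = f) (h1 : SSet.ι₁ ≫ h = g) : Nonempty (SSet.Homotopy f g) :=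
  ⟨{ h := h
     h₀ := h0
     h₁ := h1
     -- The homotopy is relative to the empty subcomplex, so this condition is vacuous.
     rel := NatTrans.ext (funext fun _ => ConcreteCategory.hom_ext _ _ fun x => x.1.2.elim) }⟩

open MonoidalCategory Simplicial in
-- Precompositions with `f` and with `r` are mutually inverse on homotopy classes: one composite is
-- the identity on the nose, the other one up to the homotopy `h`.
lemma isWeakHtpyEquiv_of_deformation {K L : SSet.{w}} (f : K ⟶ L) (r : L ⟶ K) (hr : f ≫ r = 𝟙 K)
    (h : L ⊗ Δ[1] ⟶ L) (h0 : SSet.ι₀ ≫ h = r ≫ f) (h1 : SSet.ι₁ ≫ h = 𝟙 L) :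
    IsWeakHtpyEquiv f := by
  intro Z _
  have key : ∀ {K L : SSet.{w}} (f : K ⟶ L) (g g' : L ⟶ Z), Nonempty (SSet.Homotopy g g') →
      Nonempty (SSet.Homotopy (f ≫ g) (f ≫ g')) := by
    rintro K L f g g' ⟨H⟩
    exact nonempty_homotopy (f ▷ _ ≫ H.h) (by rw [SSet.ι₀_comp_assoc, H.h₀])
      (by rw [SSet.ι₁_comp_assoc, H.h₁])
  refine ⟨Quot.map (fun g => f ≫ g) (key f), fun _ => rfl, ?_⟩
  refine Function.bijective_iff_has_inverse.2 ⟨Quot.map (fun g => r ≫ g) (key r), ?_, ?_⟩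
  · intro x
    induction x using Quot.ind with
    | mk g =>
      refine Quot.sound (nonempty_homotopy (h ≫ g) ?_ ?_)
      · rw [← Category.assoc, h0, Category.assoc]
      · rw [← Category.assoc, h1, Category.id_comp]
  · intro x
    induction x using Quot.ind with
    | mk g => exact congrArg (Quot.mk _) (by
      change f ≫ r ≫ g = g
      rw [← Category.assoc, hr, Category.id_comp])

open MonoidalCategory Simplicial in
lemma isWeakHtpyEquiv_of_isIso {K L : SSet.{w}} (f : K ⟶ L) [IsIso f] : IsWeakHtpyEquiv f :=
  isWeakHtpyEquiv_of_deformation f (inv f) (by simp) (CartesianMonoidalCategory.fst _ _)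
    (by simp) (by simp)

namespace PshSp

lemma eventualEquiv_of_isIso {X Y : PshSp.{v, u, w} C} (f : X ⟶ Y) [IsIso f] :
    EventualEquiv f := by
  refine ⟨0, fun n _ T => ?_⟩
  have : IsIso (spaceMap f n T) := ⟨spaceMap (inv f) n T, by
    ext k x
    exact congr_toFun (IsIso.hom_inv_id f) n (T, k) x, by
    ext k x
    exact congr_toFun (IsIso.inv_hom_id f) n (T, k) x⟩
  exact isWeakHtpyEquiv_of_isIso _

/-- The minimum of two simplices of the interval. -/
def itvMin {j : Cᵒᵖ × SimplexCategoryᵒᵖ} (s t : Itv j) : Itv j :=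
  SimplexCategory.Hom.mk (s.toOrderHom ⊓ t.toOrderHom)

omit [Category.{v} C] in
lemma itvMin_end_zero {j : Cᵒᵖ × SimplexCategoryᵒᵖ} (s : Itv j) :
    itvMin s (itvEnd j 0) = itvEnd j 0 := by
  ext i : 3
  exact inf_eq_right.2 (Fin.zero_le _)

omit [Category.{v} C] in
lemma itvMin_end_one {j : Cᵒᵖ × SimplexCategoryᵒᵖ} (s : Itv j) :
    itvMin s (itvEnd j 1) = s := by
  ext i : 3
  exact inf_eq_left.2 (Fin.le_last _)

omit [Category.{v} C] in
lemma itvMin_comm {j : Cᵒᵖ × SimplexCategoryᵒᵖ} (s t : Itv j) : itvMin s t = itvMin t s := by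
  ext i : 3
  exact inf_comm _ _

/-- The contraction of the reduced cone. -/
def contract {A : PshSp.{v, u, w} C} (n : ℕ) (j : Cᵒᵖ × SimplexCategoryᵒᵖ) (s : Itv j) :
    Quot (ConeRel ((𝟙 A : A ⟶ A).app n) j) → Quot (ConeRel ((𝟙 A : A ⟶ A).app n) j) :=
  -- The base is glued in at the end `1`, so the formula `(a, min t s)` forces the value `(a, s)` on
  -- a base point `a`.
  Quot.lift (Sum.elim (fun a => Quot.mk _ (Sum.inr (a, s)))
    (fun a => Quot.mk _ (Sum.inr (a.1, itvMin a.2 s)))) (by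
      rintro _ _ (a | t | a)
      · refine (congrArg (fun t => Quot.mk _ (Sum.inr (a, t)))
          ((itvMin_comm _ _).trans (itvMin_end_zero s))).trans ?_
        exact (Quot.sound (ConeRel.zero a)).trans (Quot.sound (ConeRel.point s)).symm
      · exact (Quot.sound (ConeRel.point _)).trans (Quot.sound (ConeRel.point s)).symm
      · exact (congrArg (fun t => Quot.mk _ (Sum.inr (a, t)))
          ((itvMin_comm _ _).trans (itvMin_end_one s))))

/-- The contraction `(a, t) ↦ (a, min t s)` is constant for `s = 0`, because the end `0` is
collapsed, and is the identity for `s = 1`. It exists at every level, so the bound `N` is zero. -/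
lemma eventualEquiv_zero_cone {A : PshSp.{v, u, w} C} (f : zero C ⟶ coneOn A) :
    EventualEquiv f := by
  refine ⟨0, fun n _ T => isWeakHtpyEquiv_of_deformation _ (spaceMap (isZero_zero.from_ _) n T) ?_
    { app := fun k => ↾fun x => contract n (T, k) (SSet.stdSimplex.objEquiv x.2) x.1
      naturality := fun k l φ => ?_ } ?_ ?_⟩
  · ext k x
    exact congr_toFun (isZero_zero.eq_of_src (f ≫ isZero_zero.from_ _) (𝟙 _)) n (T, k) x
  · ext ⟨x, s⟩
    induction x using Quot.ind with
    | mk x =>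
      rcases x with x | ⟨a, t⟩
      · rfl
      · rfl
  · ext k x
    refine Eq.trans ?_ ((f.app n).app (T, k)).map_point.symm
    induction x using Quot.ind with
    | mk x =>
      rcases x with x | ⟨a, t⟩
      · exact Quot.sound (ConeRel.zero x)
      · exact (congrArg (fun t => Quot.mk _ (Sum.inr (a, t))) (itvMin_end_zero t)).trans
          (Quot.sound (ConeRel.zero a))
  · ext k x
    induction x using Quot.ind with
    | mk x =>
      rcases x with x | ⟨a, t⟩
      · exact Quot.sound (ConeRel.one x)
      · exact (congrArg (fun t => Quot.mk _ (Sum.inr (a, t))) (itvMin_end_one t))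

end PshSp

end SpectraLemmas

/-! ### Cofibres and acyclic objects in a saturated class -/

section SpectraLemmas

variable {C : Type u} [Category.{v} C]

namespace PshSp

open Classical in
/-- A normal form for the points of the mapping cone. -/
noncomputable def coneNormal {A X : PtSPsh.{v, u, w} C} (f : A ⟶ X) (j : Cᵒᵖ × SimplexCategoryᵒᵖ) :
    (X.obj j).X ⊕ ((A.obj j).X × Itv j) → (X.obj j).X ⊕ ((A.obj j).X × Itv j) :=
  Sum.elim Sum.inl fun a =>
    if a.2 = itvEnd j 1 then Sum.inl ((f.app j).toFun a.1)
    else if a.2 = itvEnd j 0 ∨ a.1 = (A.obj j).point then Sum.inl (X.obj j).point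
    else Sum.inr a

omit [Category.{v} C] in
lemma itvEnd_zero_ne_one (j : Cᵒᵖ × SimplexCategoryᵒᵖ) : itvEnd j 0 ≠ itvEnd j 1 := fun h =>
  absurd (congrArg (fun φ => SimplexCategory.Hom.toOrderHom φ 0) h) (by simp)

lemma coneNormal_eq_of_rel {A X : PtSPsh.{v, u, w} C} (f : A ⟶ X) (j : Cᵒᵖ × SimplexCategoryᵒᵖ)
    {p q} (h : ConeRel f j p q) : coneNormal f j p = coneNormal f j q := by
  obtain (a | t | a) := h
  · simp [coneNormal, itvEnd_zero_ne_one]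
  · simp [coneNormal, (f.app j).map_point]
  · simp [coneNormal]

lemma mk_coneNormal {A X : PtSPsh.{v, u, w} C} (f : A ⟶ X) (j : Cᵒᵖ × SimplexCategoryᵒᵖ) (p) :
    (Quot.mk (ConeRel f j) (coneNormal f j p)) = Quot.mk _ p := by
  rcases p with x | ⟨a, t⟩
  · rfl
  · simp only [coneNormal, Sum.elim_inr]
    split_ifs with h1 h2
    · obtain rfl : t = _ := h1
      exact (Quot.sound (ConeRel.one a)).symm
    · rcases h2 with h2 | h2
      · obtain rfl : t = _ := h2
        exact (Quot.sound (ConeRel.zero a)).symm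
      · obtain rfl : a = _ := h2
        exact (Quot.sound (ConeRel.point t)).symm
    · rfl

/-- `ConeRel` is not an equivalence relation. The normal form decides equality in the quotient
because it is constant along `ConeRel` and represents the same class as its argument. -/
lemma mk_eq_mk_iff {A X : PtSPsh.{v, u, w} C} (f : A ⟶ X) (j : Cᵒᵖ × SimplexCategoryᵒᵖ) (p q) :
    Quot.mk (ConeRel f j) p = Quot.mk _ q ↔ coneNormal f j p = coneNormal f j q :=
  ⟨fun h => congrArg (Quot.lift (coneNormal f j) fun _ _ => coneNormal_eq_of_rel f j) h,
    fun h => by rw [← mk_coneNormal f j p, h, mk_coneNormal]⟩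

/-- Normal forms commute with the map, since an injective pointed `a` sends only the base point to
the base point; on normal forms the map is a sum of injections. -/
lemma cofiberMap_injective {A X A' X' : PshSp.{v, u, w} C} (f : A ⟶ X) (f' : A' ⟶ X') (a : A ⟶ A')
    (x : X ⟶ X') (h : a ≫ f' = f ≫ x) (ha : LevelInjective a) (hx : LevelInjective x) :
    LevelInjective (cofiberMap f f' a x h) := by
  intro n j y z hyz
  have key : ∀ p, coneNormal (f'.app n) j (Sum.map ((x.app n).app j).toFun
      (Prod.map ((a.app n).app j).toFun id) p) = Sum.map ((x.app n).app j).toFun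
      (Prod.map ((a.app n).app j).toFun id) (coneNormal (f.app n) j p) := by
    rintro (p | ⟨p, t⟩)
    · rfl
    · have hp : ((a.app n).app j).toFun p = ((A'.level n).obj j).point ↔
          p = ((A.level n).obj j).point := by
        rw [← ((a.app n).app j).map_point]
        exact (ha n j).eq_iff
      have hf := congr_toFun h n j p
      by_cases h1 : t = itvEnd j 1
      · simpa [coneNormal, h1] using hf
      · by_cases h2 : t = itvEnd j 0 ∨ p = ((A.level n).obj j).point
        · simp [coneNormal, h1, hp, h2, ((x.app n).app j).map_point]
        · simp [coneNormal, h1, hp, h2]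
  have inj : Function.Injective (Sum.map ((x.app n).app j).toFun
      (Prod.map ((a.app n).app j).toFun (id : Itv j → Itv j))) :=
    (hx n j).sumMap ((ha n j).prodMap Function.injective_id)
  induction y using Quot.ind with
  | mk p =>
    induction z using Quot.ind with
    | mk q =>
      have := (mk_eq_mk_iff _ _ _ _).1 hyz
      rw [key, key] at this
      exact (mk_eq_mk_iff _ _ _ _).2 (inj this)

lemma levelInjective_id (X : PshSp.{v, u, w} C) : LevelInjective (𝟙 X) :=
  fun _ _ _ _ h => h

/-- The cone square of `f ≫ x` is the cone square of `f` pasted with this one. -/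
lemma isPushout_cofiberMap_right {A X X' : PshSp.{v, u, w} C} (f : A ⟶ X) (f' : A ⟶ X')
    (x : X ⟶ X') (h : 𝟙 A ≫ f' = f ≫ x) :
    IsPushout x (toCofiber f) (toCofiber f') (cofiberMap f f' (𝟙 A) x h) := by
  obtain rfl : f' = f ≫ x := h
  have e : coneToCofiber f ≫ cofiberMap f (f ≫ x) (𝟙 A) x rfl = coneToCofiber (f ≫ x) :=
    cofiber_ext (fun _ _ _ => rfl) fun _ _ _ => rfl
  exact IsPushout.of_left (h₁₁ := f) (v₁₁ := toCone A) (h₂₁ := coneToCofiber f)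
    (e ▸ isPushout_cofiber (f ≫ x)) rfl (isPushout_cofiber f)

/-- A change of the subobject along `a` is a cobase change of `cofiber a ⟶ coneOn A'`. That morphism
has acyclic source and target when `a` is an equivalence. -/
lemma isPushout_cofiberMap_left {A A' X' : PshSp.{v, u, w} C} (f : A ⟶ X') (f' : A' ⟶ X')
    (a : A ⟶ A') (h : a ≫ f' = f ≫ 𝟙 X') :
    IsPushout (cofiberMap a f (𝟙 A) f' h.symm) (cofiberMap a (𝟙 A') a (𝟙 A') rfl)
      (cofiberMap f f' a (𝟙 X') h) (coneToCofiber f') := by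
  refine IsPushout.of_top (h₁₁ := f') (v₁₁ := toCofiber a) (v₁₂ := toCofiber f)
    (isPushout_cofiber f') ?_ (isPushout_cofiberMap_right a f f' h.symm)
  exact cofiber_ext (fun _ _ _ => rfl) fun _ _ _ => rfl

/-- The map of cofibres of the two parallel sides of a push-out is a cobase change of a map between
contractible cones. -/
lemma isPushout_cofiberMap {A X B Y : PshSp.{v, u, w} C} {f : A ⟶ X} {i : A ⟶ B} {j : X ⟶ Y}
    {g : B ⟶ Y} (sq : IsPushout f i j g) :
    IsPushout (coneToCofiber f) (coneOnMap i) (cofiberMap f g i j sq.w.symm) (coneToCofiber g) := by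
  refine IsPushout.of_top (h₁₁ := f) (v₁₁ := toCone A) (v₁₂ := toCofiber f)
    (sq.paste_vert (isPushout_cofiber g)) ?_ (isPushout_cofiber f)
  refine cofiber_ext (fun n j a => ?_) fun n j a => ?_
  · exact congrArg (fun y => Quot.mk _ (Sum.inl y)) (congr_toFun sq.w n j a)
  · rfl

end PshSp

namespace IsSaturatedClass

open PshSp

variable {L : MorphismProperty (PshSp.{v, u, w} C)} (hL : IsSaturatedClass L)
  (hE : EventualEquiv ≤ L)

include hL in
lemma comp {X Y Z : PshSp.{v, u, w} C} {f : X ⟶ Y} {g : Y ⟶ Z} (hf : L f) (hg : L g) :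
    L (f ≫ g) :=
  have := hL.two_of_three
  L.comp_mem f g hf hg

include hL in
lemma of_postcomp {X Y Z : PshSp.{v, u, w} C} {f : X ⟶ Y} {g : Y ⟶ Z} (hg : L g)
    (hfg : L (f ≫ g)) : L f :=
  have := hL.two_of_three
  L.of_postcomp f g hg hfg

include hL in
lemma of_precomp {X Y Z : PshSp.{v, u, w} C} {f : X ⟶ Y} {g : Y ⟶ Z} (hf : L f)
    (hfg : L (f ≫ g)) : L g :=
  have := hL.two_of_three
  L.of_precomp f g hf hfg

include hE in
lemma iso {X Y : PshSp.{v, u, w} C} (f : X ⟶ Y) [IsIso f] : L f :=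
  hE _ (eventualEquiv_of_isIso f)

end IsSaturatedClass

/-- Objects that vanish after inverting the morphisms in a given class. -/
def Acyclic (L : MorphismProperty (PshSp.{v, u, w} C)) (X : PshSp.{v, u, w} C) : Prop :=
  L (PshSp.isZero_zero.to_ X)

namespace IsSaturatedClass

open PshSp

variable {L : MorphismProperty (PshSp.{v, u, w} C)} (hL : IsSaturatedClass L)
  (hE : EventualEquiv ≤ L)

include hL in
lemma acyclic_of_mem {X Y : PshSp.{v, u, w} C} {f : X ⟶ Y} (hf : L f) (hX : Acyclic L X) :
    Acyclic L Y := by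
  have := hL.comp hX hf
  rwa [isZero_zero.eq_of_src (isZero_zero.to_ X ≫ f) (isZero_zero.to_ Y)] at this

include hL in
lemma mem_of_acyclic {X Y : PshSp.{v, u, w} C} (f : X ⟶ Y) (hX : Acyclic L X)
    (hY : Acyclic L Y) : L f := by
  refine hL.of_precomp hX ?_
  rwa [isZero_zero.eq_of_src (isZero_zero.to_ X ≫ f) (isZero_zero.to_ Y)]

include hL hE in
lemma acyclic_of_isZero {Z X : PshSp.{v, u, w} C} (hZ : IsZero Z) {f : Z ⟶ X} (hf : L f) :
    Acyclic L X :=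
  have : IsIso (isZero_zero.to_ Z) := ⟨hZ.to_ _, isZero_zero.eq_of_src _ _, hZ.eq_of_src _ _⟩
  hL.acyclic_of_mem hf (iso hE _)

include hE in
lemma acyclic_zero : Acyclic L (zero C) :=
  have : IsIso (isZero_zero.to_ (zero.{v, u, w} C)) :=
    ⟨𝟙 _, isZero_zero.eq_of_src _ _, isZero_zero.eq_of_src _ _⟩
  iso hE _

include hE in
lemma acyclic_coneOn (A : PshSp.{v, u, w} C) : Acyclic L (coneOn A) :=
  hE _ (eventualEquiv_zero_cone _)

include hL hE in
-- `f` and `coneOn A ⟶ cofiber f` are opposite sides of a homotopy cocartesian square, and `coneOn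
-- A` is acyclic.
lemma mem_iff_acyclic_cofiber {A X : PshSp.{v, u, w} C} (f : A ⟶ X) :
    L f ↔ Acyclic L (cofiber f) := by
  have h : L f ↔ L (coneToCofiber f) :=
    hL.homotopy_cocartesian (isPushout_cofiber f).flip (Or.inl (toCofiber_injective _))
  rw [h]
  exact ⟨fun h => hL.acyclic_of_mem h (acyclic_coneOn hE A),
    fun h => hL.mem_of_acyclic _ (acyclic_coneOn hE A) h⟩

include hL hE in
-- This is a cobase change of `toCone A`, whose source and target are acyclic.
lemma toCofiber_mem {A X : PshSp.{v, u, w} C} (f : A ⟶ X) (hA : Acyclic L A) :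
    L (toCofiber f) :=
  (hL.homotopy_cocartesian (isPushout_cofiber f) (Or.inr (toCofiber_injective _))).1
    (hL.mem_of_acyclic _ hA (acyclic_coneOn hE A))

include hL hE in
lemma boundary_mem {A X : PshSp.{v, u, w} C} (f : A ⟶ X) (hX : Acyclic L X) : L (boundary f) :=
  (hL.homotopy_cocartesian (cofiber_isPushout_boundary f) (Or.inl (toCofiber_injective _))).1
    (hL.mem_of_acyclic _ hX (acyclic_zero hE))

include hL hE in
-- The target and then the subobject are replaced, each by a cobase change. Injectivity of `f'`
-- makes the leg of the second push-out injective, so that this push-out is a homotopy push-out.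
lemma cofiberMap_mem {A X A' X' : PshSp.{v, u, w} C} (f : A ⟶ X) (f' : A' ⟶ X') (a : A ⟶ A')
    (x : X ⟶ X') (h : a ≫ f' = f ≫ x) (ha : L a) (hx : L x) (hf' : LevelInjective f') :
    L (cofiberMap f f' a x h) := by
  have h1 : L (cofiberMap f (f ≫ x) (𝟙 A) x rfl) :=
    (hL.homotopy_cocartesian (isPushout_cofiberMap_right f (f ≫ x) x rfl).flip
      (Or.inl (toCofiber_injective _))).1 hx
  have h2 : L (cofiberMap (f ≫ x) f' a (𝟙 X') h) :=
    (hL.homotopy_cocartesian (isPushout_cofiberMap_left (f ≫ x) f' a h)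
      (Or.inl (cofiberMap_injective _ _ _ _ _ (levelInjective_id _) hf'))).1
      (hL.mem_of_acyclic _ ((hL.mem_iff_acyclic_cofiber hE a).1 ha) (acyclic_coneOn hE A'))
  have h3 : cofiberMap f f' a x h =
      cofiberMap f (f ≫ x) (𝟙 A) x rfl ≫ cofiberMap (f ≫ x) f' a (𝟙 X') h :=
    cofiber_ext (fun _ _ _ => rfl) fun _ _ _ => rfl
  rw [h3]
  exact hL.comp h1 h2

include hL hE in
lemma cofiberMap_mem_of_isPushout {A X B Y : PshSp.{v, u, w} C} {f : A ⟶ X} {i : A ⟶ B}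
    {j : X ⟶ Y} {g : B ⟶ Y} (sq : IsPushout f i j g) (hi : LevelInjective i) :
    L (cofiberMap f g i j sq.w.symm) :=
  (hL.homotopy_cocartesian (isPushout_cofiberMap sq)
    (Or.inr (cofiberMap_injective _ _ _ _ _ hi hi))).1
    (hL.mem_of_acyclic _ (acyclic_coneOn hE A) (acyclic_coneOn hE B))

include hL hE in
/-- A morphism whose cofibre is identified with the cofibre of a morphism of acyclic objects. -/
lemma mem_of_cofiberMap_mem {A X A' X' : PshSp.{v, u, w} C} {f : A ⟶ X} {f' : A' ⟶ X'}
    {a : A ⟶ A'} {x : X ⟶ X'} {h : a ≫ f' = f ≫ x} (hm : L (cofiberMap f f' a x h))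
    (hA : Acyclic L A') (hX : Acyclic L X') : L f := by
  rw [hL.mem_iff_acyclic_cofiber hE]
  refine hL.of_postcomp hm ?_
  rw [isZero_zero.eq_of_src (_ ≫ _) (isZero_zero.to_ _)]
  exact (hL.mem_iff_acyclic_cofiber hE f').1 (hL.mem_of_acyclic _ hA hX)

end IsSaturatedClass

end SpectraLemmas

/-! ### Retracts as sequential colimits -/

section Retracts

variable {D : Type*} [Category D]

/-- The sequence of copies of an object with an idempotent as transition morphisms. -/
noncomputable def idempotentSequence {X : D} (e : X ⟶ X) (he : e ≫ e = e) : ULift.{w} ℕ ⥤ D where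
  obj _ := X
  map {a b} _ := open Classical in if a = b then 𝟙 X else e
  map_id _ := by simp
  map_comp {a b c} f g := by
    have h1 := leOfHom f
    have h2 := leOfHom g
    by_cases hab : a = b
    · subst hab
      simp
    · by_cases hbc : b = c
      · subst hbc
        simp [hab]
      · have hac : a ≠ c := fun h => hab (le_antisymm h1 (h ▸ h2))
        simp [hab, hbc, hac, he]

lemma idempotentSequence_map_eq {X : D} (e : X ⟶ X) (he : e ≫ e = e) {a b : ULift.{w} ℕ}
    (f : a ⟶ b) (h : a = b) : (idempotentSequence.{w} e he).map f = 𝟙 X :=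
  if_pos h

lemma idempotentSequence_map_ne {X : D} (e : X ⟶ X) (he : e ≫ e = e) {a b : ULift.{w} ℕ}
    (f : a ⟶ b) (h : a ≠ b) : (idempotentSequence.{w} e he).map f = e :=
  if_neg h

lemma idempotent_of_retract {X Y : D} {i : Y ⟶ X} {r : X ⟶ Y} (hir : i ≫ r = 𝟙 Y) :
    (r ≫ i) ≫ r ≫ i = r ≫ i := by
  rw [Category.assoc, reassoc_of% hir]

/-- The retract as a cocone. -/
noncomputable def idempotentCocone {X Y : D} (i : Y ⟶ X) (r : X ⟶ Y) (hir : i ≫ r = 𝟙 Y) :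
    Cocone (idempotentSequence.{w} (r ≫ i) (idempotent_of_retract hir)) where
  pt := Y
  ι :=
    { app := fun _ => r
      naturality := fun a b f => by
        refine Eq.trans ?_ (Category.comp_id r).symm
        by_cases hab : a = b
        · rw [idempotentSequence_map_eq _ _ _ hab]
          exact Category.id_comp r
        · rw [idempotentSequence_map_ne _ _ _ hab]
          exact (Category.assoc r i r).trans
            ((congrArg (fun t => r ≫ t) hir).trans (Category.comp_id r)) }

lemma retract_comp_eq {X Y Z : D} {i : Y ⟶ X} {r : X ⟶ Y} (hir : i ≫ r = 𝟙 Y)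
    (s : ULift.{w} ℕ → (X ⟶ Z)) (hs : ∀ k l, k < l → (r ≫ i) ≫ s l = s k) (j : ULift.{w} ℕ) :
    r ≫ i ≫ s ⟨0⟩ = s j := by
  -- The index `j + 1` is strictly above both `0` and `j`, also when `j = 0`; only strict
  -- inequalities have the idempotent as transition morphism.
  have hj : j < ⟨j.down + 1⟩ := Nat.lt_succ_self j.down
  rw [← hs ⟨0⟩ ⟨j.down + 1⟩ (Nat.succ_pos j.down), ← hs j _ hj]
  simp only [Category.assoc, reassoc_of% hir]

/-- The retract is the colimit of the sequence of idempotents. -/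
noncomputable def isColimitIdempotentCocone {X Y : D} (i : Y ⟶ X) (r : X ⟶ Y)
    (hir : i ≫ r = 𝟙 Y) : IsColimit (idempotentCocone.{w} i r hir) where
  desc s := i ≫ (show X ⟶ s.pt from s.ι.app ⟨0⟩)
  fac s j := retract_comp_eq hir (fun k => (show X ⟶ s.pt from s.ι.app k)) (fun k l h => by
    refine Eq.trans ?_ (s.w (homOfLE h.le))
    rw [idempotentSequence_map_ne _ _ _ h.ne]
    rfl) j
  uniq s m h := by
    have key : ∀ {Z : D} (m : Y ⟶ Z) (t : X ⟶ Z), r ≫ m = t → m = i ≫ t := by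
      rintro Z m _ rfl
      rw [reassoc_of% hir]
    exact key m _ (h ⟨0⟩)

end Retracts

/-! ### Closure under retracts; suspension spectra as a left adjoint -/

section SpectraLemmas

variable {C : Type u} [Category.{v} C]

namespace IsSaturatedClass

variable {L : MorphismProperty (PshSp.{v, u, w} C)} (hL : IsSaturatedClass L)

include hL in
-- Retracts are not among the axioms of a saturated class, but `f` is the filtered colimit of copies
-- of `g` along the idempotents of the retraction.
lemma mem_of_retract {X Y X' Y' : PshSp.{v, u, w} C} {f : X ⟶ Y} {g : X' ⟶ Y'} (hg : L g)
    (i : X ⟶ X') (r : X' ⟶ X) (hir : i ≫ r = 𝟙 X) (i' : Y ⟶ Y') (r' : Y' ⟶ Y)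
    (hir' : i' ≫ r' = 𝟙 Y) (hi : f ≫ i' = i ≫ g) (hr : g ≫ r' = r ≫ f) : L f := by
  have := hL.filtered
  have := this.isStableUnderColimitsOfShape (ULift.{w} ℕ)
  refine this.condition _ _ _ _ (isColimitIdempotentCocone.{w} i r hir)
    (isColimitIdempotentCocone.{w} i' r' hir')
    { app := fun _ => g
      naturality := fun a b φ => ?_ } (fun _ => hg) f fun _ => hr.symm
  by_cases hab : a = b
  · rw [idempotentSequence_map_eq _ _ _ hab, idempotentSequence_map_eq _ _ _ hab]
    exact (Category.id_comp g).trans (Category.comp_id g).symm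
  · rw [idempotentSequence_map_ne _ _ _ hab, idempotentSequence_map_ne _ _ _ hab]
    change (r ≫ i) ≫ g = g ≫ r' ≫ i'
    rw [reassoc_of% hr, hi, Category.assoc]

include hL in
-- `f` is a retract of `r ≫ f`. This serves coarse deformation retracts, where one composite is the
-- identity and the other is only close to it.
lemma mem_of_comp_eq_id {X Y : PshSp.{v, u, w} C} {f : X ⟶ Y} {r : Y ⟶ X} (hfr : f ≫ r = 𝟙 X)
    (h : L (r ≫ f)) : L f :=
  hL.mem_of_retract h f r hfr (𝟙 Y) (𝟙 Y) (Category.id_comp _)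
    (by rw [reassoc_of% hfr, Category.comp_id]) (Category.comp_id _)

end IsSaturatedClass

/-! ### Suspension spectra -/

/-- The presheaf of vertices of the zeroth level of a spectrum. -/
def verticesFunctor : PshSp.{v, u, w} C ⥤ (Cᵒᵖ ⥤ Type w) where
  obj X :=
    { obj := fun T => ((X.level 0).obj (T, op (SimplexCategory.mk 0))).X
      map := fun {T T'} φ => ↾((X.level 0).map
        ((φ, 𝟙 _) : (T, op (SimplexCategory.mk 0)) ⟶ (T', op (SimplexCategory.mk 0)))).toFun
      map_id := fun T => by
        ext x
        exact congrFun (congrArg Pointed.Hom.toFun ((X.level 0).map_id _)) x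
      map_comp := fun {T T' T''} φ ψ => by
        ext x
        exact congrFun (congrArg Pointed.Hom.toFun ((X.level 0).map_comp
          ((φ, 𝟙 _) : (T, op (SimplexCategory.mk 0)) ⟶ (T', op (SimplexCategory.mk 0)))
          ((ψ, 𝟙 _) : (T', op (SimplexCategory.mk 0)) ⟶ (T'', op (SimplexCategory.mk 0))))) x }
  map f :=
    { app := fun T => ↾((f.app 0).app (T, op (SimplexCategory.mk 0))).toFun
      naturality := fun T T' φ => by
        ext x
        exact PshSp.map_toFun f 0 _ x }

/-- The degeneracy from vertices to arbitrary simplices. -/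
abbrev degeneracy (j : Cᵒᵖ × SimplexCategoryᵒᵖ) :
    (j.1, op (SimplexCategory.mk 0)) ⟶ j :=
  (𝟙 _, (SimplexCategory.const j.2.unop (SimplexCategory.mk 0) 0).op)

lemma degeneracy_naturality {j k : Cᵒᵖ × SimplexCategoryᵒᵖ} (φ : j ⟶ k) :
    degeneracy j ≫ φ = ((φ.1, 𝟙 _) : (j.1, op (SimplexCategory.mk 0)) ⟶
      (k.1, op (SimplexCategory.mk 0))) ≫ degeneracy k := by
  refine Prod.ext ?_ (Quiver.Hom.unop_inj ?_)
  · exact (Category.id_comp _).trans (Category.comp_id _).symm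
  · ext i : 3
    exact Subsingleton.elim (α := Fin 1) _ _

/-- The levels of the morphism out of a suspension spectrum adjoint to a morphism of presheaves. -/
def suspLiftFun {P : Cᵒᵖ ⥤ Type w} {X : PshSp.{v, u, w} C} (f : P ⟶ verticesFunctor.obj X)
    (j : Cᵒᵖ × SimplexCategoryᵒᵖ) :
    ∀ n, { g : ((iterSusp (plusFunctor.obj P) n).obj j).X → ((X.level n).obj j).X //
      g ((iterSusp (plusFunctor.obj P) n).obj j).point = ((X.level n).obj j).point }
  | 0 => ⟨fun o => Option.elim (α := P.obj j.1) o ((X.level 0).obj j).point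
      (fun x => ((X.level 0).map (degeneracy j)).toFun (f.app j.1 x)), rfl⟩
  | n + 1 => ⟨Quot.lift (fun p => (X.σ n j p.2).toFun ((suspLiftFun f j n).1 p.1)) (by
      have key : ∀ p : ((iterSusp (plusFunctor.obj P) n).obj j).X × Itv j, Collapsed p →
          (X.σ n j p.2).toFun ((suspLiftFun f j n).1 p.1) = ((X.level (n + 1)).obj j).point := by
        rintro p (h | h)
        · rw [h, (suspLiftFun f j n).2]
          exact (X.σ n j p.2).map_point
        · exact X.σ_boundary n j _ h _
      intro p q h
      rw [key p h.1, key q h.2]), by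
      exact (congrArg _ (suspLiftFun f j n).2).trans (X.σ n j _).map_point⟩

lemma suspLiftFun_map {P : Cᵒᵖ ⥤ Type w} {X : PshSp.{v, u, w} C} (f : P ⟶ verticesFunctor.obj X)
    {j k : Cᵒᵖ × SimplexCategoryᵒᵖ} (φ : j ⟶ k) : ∀ n x,
    (suspLiftFun f k n).1 (((iterSusp (plusFunctor.obj P) n).map φ).toFun x) =
      ((X.level n).map φ).toFun ((suspLiftFun f j n).1 x)
  | 0, none => ((X.level 0).map φ).map_point.symm
  | 0, some x => by
    change ((X.level 0).map (degeneracy k)).toFun (f.app k.1 (P.map φ.1 x)) =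
      ((X.level 0).map φ).toFun (((X.level 0).map (degeneracy j)).toFun (f.app j.1 x))
    have h1 : f.app k.1 (P.map φ.1 x) = _ := NatTrans.naturality_apply f φ.1 x
    have h2 := congrFun (congrArg Pointed.Hom.toFun
      (congrArg (X.level 0).map (degeneracy_naturality φ))) (f.app j.1 x)
    rw [Functor.map_comp, Functor.map_comp] at h2
    rw [h1]
    exact h2.symm
  | n + 1, x => by
    induction x using Quot.ind with
    | mk p =>
      change (X.σ n k (φ.2.unop ≫ p.2)).toFun ((suspLiftFun f k n).1
        (((iterSusp (plusFunctor.obj P) n).map φ).toFun p.1)) = _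
      rw [suspLiftFun_map f φ n p.1]
      exact congrFun (congrArg Pointed.Hom.toFun (X.σ_naturality n φ p.2)) _

/-- The morphism out of a suspension spectrum adjoint to a morphism of presheaves. -/
def suspLift {P : Cᵒᵖ ⥤ Type w} {X : PshSp.{v, u, w} C} (f : P ⟶ verticesFunctor.obj X) :
    suspSpectrumPlus.obj P ⟶ X :=
  PshSp.homMk (fun n j => (suspLiftFun f j n).1) (fun n j => (suspLiftFun f j n).2)
    (fun n _ _ φ x => suspLiftFun_map f φ n x) (fun _ _ _ _ => rfl)

/-- Every simplex of a suspension spectrum in positive level is the value of a structure map on a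
simplex one level lower, so level zero determines the morphism. -/
lemma suspSpectrumPlus_hom_ext {P : Cᵒᵖ ⥤ Type w} {X : PshSp.{v, u, w} C}
    {f g : suspSpectrumPlus.obj P ⟶ X}
    (h : ∀ j (x : P.obj j.1), ((f.app 0).app j).toFun (some x) = ((g.app 0).app j).toFun (some x)) :
    f = g := by
  refine PshSp.ext_toFun fun n => ?_
  induction n with
  | zero =>
    rintro j (_ | x)
    · exact ((f.app 0).app j).map_point.trans ((g.app 0).app j).map_point.symm
    · exact h j x
  | succ n ih =>
    intro j x
    induction x using Quot.ind with
    | mk p =>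
      refine (PshSp.σ_toFun f n j p.2 p.1).symm.trans (Eq.trans ?_ (PshSp.σ_toFun g n j p.2 p.1))
      exact congrArg (X.σ n j p.2).toFun (ih j p.1)

/-- The suspension spectrum functor is left adjoint to taking vertices in level zero. -/
def suspSpectrumPlusAdjunction :
    suspSpectrumPlus.{v, u, w} (C := C) ⊣ verticesFunctor :=
  Adjunction.mkOfHomEquiv
    { homEquiv := fun P X =>
        { toFun := fun f =>
            { app := fun T => ↾fun x =>
                ((f.app 0).app (T, op (SimplexCategory.mk 0))).toFun (some x)
              naturality := fun T T' φ => by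
                ext x
                exact PshSp.map_toFun f 0 ((φ, 𝟙 _) : (T, op (SimplexCategory.mk 0)) ⟶
                  (T', op (SimplexCategory.mk 0))) (some x) }
          invFun := suspLift
          left_inv := fun f => suspSpectrumPlus_hom_ext fun j x => by
            -- `P` is constant in the simplicial direction, so a simplex of level zero is a
            -- degeneracy of the vertex that it comes from.
            refine (PshSp.map_toFun f 0 (degeneracy j) (some x)).symm.trans ?_
            refine congrArg (fun y => ((f.app 0).app j).toFun (some y)) ?_
            exact congrFun (congrArg (fun g => (ConcreteCategory.hom g : P.obj j.1 → P.obj j.1))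
              (P.map_id j.1)) x
          right_inv := fun f => by
            ext T x
            change ((X.level 0).map (degeneracy (T, op (SimplexCategory.mk 0)))).toFun
              (f.app T x) = f.app T x
            have : degeneracy (C := C) (T, op (SimplexCategory.mk 0)) = 𝟙 _ :=
              Prod.ext rfl (Quiver.Hom.unop_inj (by
                ext i : 3
                exact Subsingleton.elim (α := Fin 1) _ _))
            refine (congrArg (fun φ => ((X.level 0).map φ).toFun (f.app T x)) this).trans ?_
            exact congrFun (congrArg Pointed.Hom.toFun ((X.level 0).map_id _)) _ }
      homEquiv_naturality_left_symm := fun f g => suspSpectrumPlus_hom_ext fun j x => rfl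
      homEquiv_naturality_right := fun f g => rfl }

/-- The adjunction is needed only for this: unions and push-outs of subpresheaves become colimits of
spectra, to which the saturation axioms apply. -/
instance : PreservesColimitsOfSize.{w, w} (suspSpectrumPlus.{v, u, w} (C := C)) :=
  suspSpectrumPlusAdjunction.leftAdjoint_preservesColimits

/-- An injective pointed map preserves and reflects the collapsed points, and outside of these the
quotient identifies nothing; the function `N` in the proof detects this. -/
lemma suspMap_injective {F F' : PtSPsh.{v, u, w} C} (f : F ⟶ F') (j : Cᵒᵖ × SimplexCategoryᵒᵖ)
    (hf : Function.Injective (f.app j).toFun) : Function.Injective ((suspMap f).app j).toFun := by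
  classical
  intro x y h
  induction x using Quot.ind with
  | mk p =>
    induction y using Quot.ind with
    | mk q =>
      let N : (F'.obj j).X × Itv j → Option ((F'.obj j).X × Itv j) := fun p =>
        if Collapsed p then none else some p
      have hN : ∀ p q, SuspRel F' j p q → N p = N q := fun p q h => by
        simp [N, h.1, h.2]
      have hc : ∀ p : (F.obj j).X × Itv j,
          Collapsed (F := F') (j := j) ((f.app j).toFun p.1, p.2) ↔ Collapsed p := fun p => by
        have : (f.app j).toFun p.1 = (F'.obj j).point ↔ p.1 = (F.obj j).point := by
          rw [← (f.app j).map_point]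
          exact hf.eq_iff
        simp only [Collapsed, this]
      have h' : N ((f.app j).toFun p.1, p.2) = N ((f.app j).toFun q.1, q.2) :=
        congrArg (Quot.lift N hN) h
      by_cases hp : Collapsed p
      · by_cases hq : Collapsed q
        · exact Quot.sound ⟨hp, hq⟩
        · simp [N, hc, hp, hq] at h'
      · by_cases hq : Collapsed q
        · simp [N, hc, hp, hq] at h'
        · simp only [N, hc, hp, hq, if_false, Option.some.injEq, Prod.mk.injEq] at h'
          exact congrArg _ (Prod.ext (hf h'.1) h'.2)

lemma suspSpectrumPlus_map_injective {P Q : Cᵒᵖ ⥤ Type w} (f : P ⟶ Q)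
    (hf : ∀ T, Function.Injective (f.app T)) : LevelInjective (suspSpectrumPlus.map f) := by
  intro n j
  induction n with
  | zero => exact Option.map_injective (hf j.1)
  | succ n ih => exact suspMap_injective _ _ ih

lemma isZero_suspSpectrumPlus {P : Cᵒᵖ ⥤ Type w} (hP : ∀ T, IsEmpty (P.obj T)) :
    IsZero (suspSpectrumPlus.obj P) := by
  refine PshSp.isZero_of_subsingleton _ fun n j => ?_
  induction n with
  | zero =>
    have := hP j.1
    exact inferInstanceAs (Subsingleton (Option (P.obj j.1)))
  | succ n ih =>
    refine ⟨fun x y => ?_⟩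
    induction x using Quot.ind with
    | mk p =>
      induction y using Quot.ind with
      | mk q => exact Quot.sound ⟨Or.inl (ih.elim _ _), Or.inl (ih.elim _ _)⟩

end SpectraLemmas

/-! ### Intersections and directed unions of subpresheaves -/

section SpectraLemmas

variable {C : Type u} [Category.{v} C]

lemma isPushout_subfunctor {Y : C ⥤ Type w} (P Q R S : Subfunctor Y) (hRP : R ≤ P) (hRQ : R ≤ Q)
    (hPS : P ≤ S) (hQS : Q ≤ S) (hR : P ⊓ Q ≤ R) (hS : S ≤ P ⊔ Q) :
    IsPushout (Subfunctor.homOfLe hRP) (Subfunctor.homOfLe hRQ) (Subfunctor.homOfLe hPS)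
      (Subfunctor.homOfLe hQS) where
  w := rfl
  isColimit' := ⟨evaluationJointlyReflectsColimits _ fun T =>
    (PushoutCocone.isColimitMapCoconeEquiv _ _).2 (by
      have h : Lattice.BicartSq (R.obj T) (P.obj T) (Q.obj T) (S.obj T) :=
        { sup_eq := le_antisymm (sup_le (hPS T) (hQS T)) (hS T)
          inf_eq := le_antisymm (hR T) (le_inf (hRP T) (hRQ T)) }
      exact (Types.isPushout_of_bicartSq h).isColimit)⟩

/-- The functor given by a monotone family of subfunctors. -/
def subfunctorDiagram {Y : C ⥤ Type w} {ι : Type*} [Preorder ι] (P : ι → Subfunctor Y)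
    (hP : Monotone P) : ι ⥤ C ⥤ Type w where
  obj i := (P i).toFunctor
  map f := Subfunctor.homOfLe (hP (leOfHom f))

/-- The union of a monotone family of subfunctors as a cocone. -/
def subfunctorCocone {Y : C ⥤ Type w} {ι : Type*} [Preorder ι] (P : ι → Subfunctor Y)
    (hP : Monotone P) : Cocone (subfunctorDiagram P hP) where
  pt := (⨆ i, P i).toFunctor
  ι := { app := fun i => Subfunctor.homOfLe (le_iSup P i) }

/-- A directed union of subfunctors is a filtered colimit. -/
noncomputable def isColimitSubfunctorCocone {Y : C ⥤ Type w} {ι : Type w} [Preorder ι]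
    [IsDirectedOrder ι] [Nonempty ι] (P : ι → Subfunctor Y) (hP : Monotone P) :
    IsColimit (subfunctorCocone P hP) :=
  evaluationJointlyReflectsColimits _ fun T => Types.FilteredColimit.isColimitOf' _ _
    (fun x => by
      obtain ⟨x, hx⟩ := x
      rw [Subfunctor.iSup_obj, Set.mem_iUnion] at hx
      obtain ⟨i, hi⟩ := hx
      exact ⟨i, ⟨x, hi⟩, rfl⟩)
    (fun i x y h => ⟨i, 𝟙 i, by
      have : x = y := Subtype.ext (congrArg (fun z : (⨆ i, P i).toFunctor.obj T => z.1) h)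
      rw [this]⟩)

namespace IsSaturatedClass

variable {L : MorphismProperty (PshSp.{v, u, w} C)} (hL : IsSaturatedClass L)

include hL in
lemma map_iSup_mem {Y : Cᵒᵖ ⥤ Type w} {ι : Type w} [Preorder ι] [IsDirectedOrder ι] [Nonempty ι]
    (P Q : ι → Subfunctor Y) (hP : Monotone P) (hQ : Monotone Q) (hPQ : ∀ i, P i ≤ Q i)
    (h : ∀ i, L (suspSpectrumPlus.map (Subfunctor.homOfLe (hPQ i)))) :
    L (suspSpectrumPlus.map (Subfunctor.homOfLe (iSup_mono hPQ))) := by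
  have := hL.filtered
  have := this.isStableUnderColimitsOfShape ι
  exact this.condition _ _ _ _
    (isColimitOfPreserves suspSpectrumPlus (isColimitSubfunctorCocone P hP))
    (isColimitOfPreserves suspSpectrumPlus (isColimitSubfunctorCocone Q hQ))
    { app := fun i => suspSpectrumPlus.map (Subfunctor.homOfLe (hPQ i))
      naturality := fun i j f => by
        exact (suspSpectrumPlus.map_comp _ _).symm.trans
          (suspSpectrumPlus.map_comp (Subfunctor.homOfLe (hPQ i))
            ((subfunctorDiagram Q hQ).map f)) } h _
    (fun j => (suspSpectrumPlus.map_comp _ _).symm.trans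
      (suspSpectrumPlus.map_comp (Subfunctor.homOfLe (hPQ j)) ((subfunctorCocone Q hQ).ι.app j)))

include hL in
-- `P` is the union of the constant family `P` over the nonempty index set, so this is a directed
-- colimit of the inclusions `P ≤ Q i`.
lemma map_le_iSup_mem (hE : EventualEquiv ≤ L) {Y : Cᵒᵖ ⥤ Type w} {ι : Type w} [Preorder ι]
    [IsDirectedOrder ι] [Nonempty ι] (P : Subfunctor Y) (Q : ι → Subfunctor Y) (hQ : Monotone Q)
    (hPQ : ∀ i, P ≤ Q i) (h : ∀ i, L (suspSpectrumPlus.map (Subfunctor.homOfLe (hPQ i))))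
    (hP : P ≤ ⨆ i, Q i) : L (suspSpectrumPlus.map (Subfunctor.homOfLe hP)) := by
  have h1 : P ≤ ⨆ _ : ι, P := le_of_eq iSup_const.symm
  have : IsIso (Subfunctor.homOfLe h1) := ⟨Subfunctor.homOfLe (le_of_eq iSup_const), rfl, rfl⟩
  have h2 := hL.comp (iso hE (suspSpectrumPlus.map (Subfunctor.homOfLe h1)))
    (hL.map_iSup_mem (fun _ => P) Q monotone_const hQ hPQ h)
  rwa [← Functor.map_comp] at h2

end IsSaturatedClass

lemma levelInjective_homOfLe {Y : Cᵒᵖ ⥤ Type w} {P Q : Subfunctor Y} (h : P ≤ Q) :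
    LevelInjective (suspSpectrumPlus.map (Subfunctor.homOfLe h)) :=
  suspSpectrumPlus_map_injective _ fun T _ _ h =>
    Subtype.ext (congrArg (fun z : Q.toFunctor.obj T => z.1) h)

end SpectraLemmas

/-! ### Close maps, embeddings and two-point homotopies -/

section CoarseMaps

variable {G : Type v} [Group G]

namespace GBornCoarse

/-- A map that is close to a morphism is a morphism. -/
def ofClose {T D : GBornCoarse.{v, u} G} (i : T ⟶ D) (f : T → D)
    (hf : ∀ (g : G) t, f (g • t) = g • f t)
    (h : D.coarse.IsEntourage {p | ∃ t, p = (fn i t, f t)}) : T ⟶ D where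
  toFun := f
  equivariant := hf
  controlled U hU := D.coarse.subset
    (D.coarse.comp (D.coarse.comp (D.coarse.inv h) (i.controlled U hU)) h) (by
      rintro _ ⟨⟨s, t⟩, hst, rfl⟩
      exact ⟨fn i t, ⟨fn i s, ⟨s, rfl⟩, ⟨(s, t), hst, rfl⟩⟩, t, rfl⟩)
  proper B hB := (i.proper _ (D.thicken_bounded _ B h hB)).subset fun t ht => ⟨f t, ht, t, rfl⟩

/-- A morphism that identifies its source with a subspace of its target. -/
structure IsEmbedding {T D : GBornCoarse.{v, u} G} (i : T ⟶ D) : Prop where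
  injective : Function.Injective (fn i)
  entourage : ∀ U, D.coarse.IsEntourage (Prod.map (fn i) (fn i) '' U) → T.coarse.IsEntourage U
  bounded : ∀ B, Bornology.IsBounded B → Bornology.IsBounded (fn i '' B)

lemma isEmbedding_incl (X : GBornCoarse.{v, u} G) (A : Set X) (hA : InvariantSet G A) :
    IsEmbedding (X.incl A hA) where
  injective _ _ h := Subtype.ext h
  entourage _ h := h
  bounded _ hB := (Bornology.isBounded_image_subtype_val (p := fun x => x ∈ A)).2 hB

/-- The factorization of a morphism through an embedding that contains its image. -/
noncomputable def IsEmbedding.lift {T D E : GBornCoarse.{v, u} G} {i : T ⟶ D} (hi : IsEmbedding i)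
    (f : E ⟶ D) (h : ∀ x, fn f x ∈ Set.range (fn i)) : E ⟶ T where
  toFun x := (h x).choose
  equivariant g x := hi.injective (by
    rw [(h (g • x)).choose_spec]
    refine (f.equivariant g x).trans ((congrArg _ (h x).choose_spec.symm).trans ?_)
    exact (i.equivariant g _).symm)
  controlled U hU := hi.entourage _ (D.coarse.subset (f.controlled U hU) (by
    rintro _ ⟨_, ⟨p, hp, rfl⟩, rfl⟩
    exact ⟨p, hp, Prod.ext (h p.1).choose_spec.symm (h p.2).choose_spec.symm⟩))
  proper B hB := (f.proper _ (hi.bounded B hB)).subset fun x hx =>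
    ⟨_, hx, (h x).choose_spec⟩

lemma IsEmbedding.fn_lift {T D E : GBornCoarse.{v, u} G} {i : T ⟶ D} (hi : IsEmbedding i)
    (f : E ⟶ D) (h : ∀ x, fn f x ∈ Set.range (fn i)) (x : E) :
    fn i (fn (hi.lift f h) x) = fn f x := (h x).choose_spec

/-- The inclusions of the points of `{0,1}`. -/
def twoPointIncl (X : GBornCoarse.{v, u} G) (b : Bool) : X ⟶ (twoPoint G).tensor X where
  toFun x := (b, x)
  equivariant _ _ := rfl
  controlled U hU := ⟨Set.univ, U, trivial, hU, by
    rintro _ ⟨p, hp, rfl⟩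
    exact ⟨trivial, hp⟩⟩
  proper B hB := ((Bornology.isBounded_image_fst_and_snd (α := twoPoint G) (β := X)).2 hB).2.subset
    fun x hx => ⟨_, hx, rfl⟩

/-- The homotopy between close morphisms. -/
def twoPointHomotopy {X Y : GBornCoarse.{v, u} G} (f g : X ⟶ Y)
    (h : Y.coarse.IsEntourage {p | ∃ x, p = (fn f x, fn g x)}) : (twoPoint G).tensor X ⟶ Y :=
  ofClose (twoPointProj X ≫ f) (fun p => bif p.1 then fn f p.2 else fn g p.2) (by
    rintro a ⟨b, x⟩
    change (bif b then fn f (a • x) else fn g (a • x)) = _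
    cases b
    · exact g.equivariant a x
    · exact f.equivariant a x) (Y.coarse.subset (Y.coarse.union h Y.coarse.diag) (by
    rintro _ ⟨⟨b, x⟩, rfl⟩
    cases b
    · exact Or.inl ⟨x, rfl⟩
    · exact Or.inr rfl))

end GBornCoarse

end CoarseMaps

/-! ### Coarse invariance for subpresheaves of a represented presheaf -/

section Motives

variable {G : Type u} [Group G]

open GBornCoarse PshSp

/-- The subpresheaf of morphisms with values in a subset. -/
def yoSub (D : GBornCoarse.{u, u} G) (S : Set D) : Subfunctor (yo D) where
  obj _ := {f | ∀ t, fn f.down t ∈ S}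
  map _ _ h _ := h _

lemma yoSub_mono {D : GBornCoarse.{u, u} G} {S S' : Set D} (h : S ⊆ S') : yoSub D S ≤ yoSub D S' :=
  fun _ _ hf t => h (hf t)

/-- The corestriction of a morphism to the presheaf of morphisms with values in a subset. -/
def yoToSub {T D : GBornCoarse.{u, u} G} (i : T ⟶ D) (S : Set D) (h : ∀ t, fn i t ∈ S) :
    yo T ⟶ (yoSub D S).toFunctor where
  app E := ↾fun f => ⟨⟨f.down ≫ i⟩, fun t => h _⟩

/-- This trades embedded spaces for subpresheaves of one fixed `yo D`, where intersections, unions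
and excision can be expressed. -/
lemma isIso_yoToSub {T D : GBornCoarse.{u, u} G} {i : T ⟶ D} (hi : IsEmbedding i) (S : Set D)
    (hS : S = Set.range (fn i)) : IsIso (yoToSub i S (by rw [hS]; exact Set.mem_range_self)) := by
  refine @NatIso.isIso_of_isIso_app _ _ _ _ _ _ _ fun E => ?_
  rw [isIso_iff_bijective]
  constructor
  · intro f g h
    have h' : f.down ≫ i = g.down ≫ i :=
      congrArg (fun k : (yoSub D S).toFunctor.obj E => k.1.down) h
    refine ULift.ext _ _ (GBornCoarse.hom_ext fun x => hi.injective ?_)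
    exact congrArg (fun k => fn k x) h'
  · rintro ⟨f, hf⟩
    refine ⟨⟨hi.lift f.down fun x => hS ▸ hf x⟩, Subtype.ext (ULift.ext _ _ ?_)⟩
    exact GBornCoarse.hom_ext fun x => hi.fn_lift _ _ x

namespace IsSaturatedClass

variable {L : MorphismProperty (CoarsePshSp G)} (hL : IsSaturatedClass L)
  (hE : EventualEquiv ≤ L) (hG : CoarseGenerator ≤ L)

include hL hE hG in
-- Close morphisms are the two restrictions of a single morphism on `{0,1} ⊗ X`, and both point
-- inclusions are equivalences because they are sections of the projection.
lemma yoSp_map_mem_of_close {X Y : GBornCoarse.{u, u} G} (f g : X ⟶ Y)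
    (h : Y.coarse.IsEntourage {p | ∃ x, p = (fn f x, fn g x)}) (hf : L (yoSp.map f)) :
    L (yoSp.map g) := by
  have hi : ∀ b, L (yoSp.map (twoPointIncl X b)) := fun b => by
    refine hL.of_postcomp (hG _ (.invariance X)) ?_
    rw [← Functor.map_comp, show twoPointIncl X b ≫ twoPointProj X = 𝟙 X from rfl]
    exact iso hE _
  have e : ∀ b k, twoPointIncl X b ≫ twoPointHomotopy f g h = k →
      (L (yoSp.map (twoPointHomotopy f g h)) ↔ L (yoSp.map k)) := by
    rintro b _ rfl
    rw [Functor.map_comp]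
    exact ⟨hL.comp (hi b), hL.of_precomp (hi b)⟩
  exact (e false g rfl).1 ((e true f rfl).2 hf)

include hL hE hG in
/-- The inclusion of a coarse deformation retract is an equivalence. -/
lemma homOfLe_mem_of_retraction {D : GBornCoarse.{u, u} G} {S S' : Set D} (hS : InvariantSet G S)
    (hS' : InvariantSet G S') (h : S ⊆ S') (ρ : D → D) (hρ : ∀ (g : G) x, ρ (g • x) = g • ρ x)
    (hρS : ∀ x ∈ S', ρ x ∈ S) (hid : ∀ x ∈ S, ρ x = x)
    (hclose : D.coarse.IsEntourage {p | ∃ x ∈ S', p = (x, ρ x)}) :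
    L (suspSpectrumPlus.map (Subfunctor.homOfLe (yoSub_mono h))) := by
  let j : D.sub S hS ⟶ D.sub S' hS' := GBornCoarse.lift (D.incl S hS) S' hS' fun x => h x.2
  have hcl : D.coarse.IsEntourage {p | ∃ t : D.sub S' hS', p = (fn (D.incl S' hS') t, ρ (val t))} :=
    D.coarse.subset hclose (by
      rintro _ ⟨t, rfl⟩
      exact ⟨_, t.2, rfl⟩)
  let r : D.sub S' hS' ⟶ D.sub S hS :=
    GBornCoarse.lift (ofClose (D.incl S' hS') (fun x => ρ (val x))
    (fun g x => hρ g _) hcl) S hS fun x => hρS _ x.2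
  have hjr : j ≫ r = 𝟙 _ := GBornCoarse.hom_ext fun x => Subtype.ext (hid _ x.2)
  -- `r` is a strict left inverse of `j`, and `r ≫ j` is close to the identity, hence in `L`.
  have hj : L (yoSp.map j) := by
    refine hL.mem_of_comp_eq_id (r := yoSp.map r)
      (by rw [← Functor.map_comp, hjr, CategoryTheory.Functor.map_id]) ?_
    rw [← Functor.map_comp]
    refine hL.yoSp_map_mem_of_close hE hG (𝟙 _) _ (D.coarse.subset hclose ?_) (iso hE _)
    rintro _ ⟨_, ⟨x, rfl⟩, rfl⟩
    exact ⟨_, x.2, rfl⟩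
  have h1 := isIso_yoToSub (isEmbedding_incl D S hS) S Subtype.range_val.symm
  have h2 := isIso_yoToSub (isEmbedding_incl D S' hS') S' Subtype.range_val.symm
  -- The inclusion of subspaces `j` is transported to the inclusion of subpresheaves along the
  -- isomorphisms `h1` and `h2`.
  refine hL.of_precomp (iso hE (suspSpectrumPlus.map (yoToSub (D.incl S hS) S fun x => x.2))) ?_
  have h3 := hL.comp hj (iso hE (suspSpectrumPlus.map (yoToSub (D.incl S' hS') S' fun x => x.2)))
  have h4 : L (suspSpectrumPlus.map (uliftYoneda.{u + 1}.map j ≫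
      yoToSub (D.incl S' hS') S' fun x => x.2)) := by
    rw [Functor.map_comp]
    exact h3
  rw [← Functor.map_comp]
  exact h4

end IsSaturatedClass

end Motives

/-! ### Cofibres of maps of suspension spectra -/

section SpectraLemmas

variable {C : Type u} [Category.{v} C]

open PshSp

/-- The morphism of cofibres of suspension spectra induced by a square of presheaves. -/
abbrev suspCofiberMap {P Q P' Q' : Cᵒᵖ ⥤ Type w} (f : P ⟶ Q) (f' : P' ⟶ Q') (a : P ⟶ P')
    (x : Q ⟶ Q') (h : a ≫ f' = f ≫ x) :
    cofiber (suspSpectrumPlus.map f) ⟶ cofiber (suspSpectrumPlus.map f') :=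
  cofiberMap _ _ (suspSpectrumPlus.map a) (suspSpectrumPlus.map x) (by
    rw [← Functor.map_comp, ← Functor.map_comp, h])

lemma suspCofiberMap_comp {P Q P' Q' P'' Q'' : Cᵒᵖ ⥤ Type w} (f : P ⟶ Q) (f' : P' ⟶ Q')
    (f'' : P'' ⟶ Q'') (a : P ⟶ P') (x : Q ⟶ Q') (h : a ≫ f' = f ≫ x) (a' : P' ⟶ P'') (x' : Q' ⟶ Q'')
    (h' : a' ≫ f'' = f' ≫ x') :
    suspCofiberMap f f' a x h ≫ suspCofiberMap f' f'' a' x' h' =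
      suspCofiberMap f f'' (a ≫ a') (x ≫ x') (by
        rw [Category.assoc, h', reassoc_of% h]) := by
  have e1 := suspSpectrumPlus.{v, u, w}.map_comp a a'
  have e2 := suspSpectrumPlus.{v, u, w}.map_comp x x'
  refine cofiber_ext (fun n j y => ?_) fun n j y => ?_
  · exact congrArg (fun y => Quot.mk _ (Sum.inl y)) (congr_toFun e2 n j y).symm
  · exact congrArg (fun b => Quot.mk _ (Sum.inr (b, y.2))) (congr_toFun e1 n j y.1).symm

lemma IsSaturatedClass.suspCofiberMap_mem_comp {L : MorphismProperty (PshSp.{v, u, w} C)}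
    (hL : IsSaturatedClass L) {P Q P' Q' P'' Q'' : Cᵒᵖ ⥤ Type w} {f : P ⟶ Q} {f' : P' ⟶ Q'}
    {f'' : P'' ⟶ Q''} {a : P ⟶ P'} {x : Q ⟶ Q'} {h : a ≫ f' = f ≫ x} {a' : P' ⟶ P''} {x' : Q' ⟶ Q''}
    {h' : a' ≫ f'' = f' ≫ x'} (h1 : L (suspCofiberMap f f' a x h))
    (h2 : L (suspCofiberMap f' f'' a' x' h')) :
    L (suspCofiberMap f f'' (a ≫ a') (x ≫ x') (by rw [Category.assoc, h', reassoc_of% h])) := by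
  rw [← suspCofiberMap_comp f f' f'' a x h a' x' h']
  exact hL.comp h1 h2

end SpectraLemmas

/-! ### From excision to Mayer–Vietoris for two subspaces -/

section MayerVietoris

namespace GBornCoarse

variable {G : Type v} [Group G]

lemma invariant_range {T D : GBornCoarse.{v, u} G} (i : T ⟶ D) :
    InvariantSet G (Set.range (fn i)) := by
  rintro g _ ⟨t, rfl⟩
  exact ⟨g • t, i.equivariant g t⟩

/-- The invariant sets between a given set and one of its thickenings. -/
def thickenings (D : GBornCoarse.{v, u} G) (S : Set D) : Set (Set D) :=
  {B | InvariantSet G B ∧ S ⊆ B ∧ ∃ U, D.coarse.IsEntourage U ∧ B ⊆ thicken U S}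

lemma mem_thickenings_self {D : GBornCoarse.{v, u} G} {S : Set D} (hS : InvariantSet G S) :
    S ∈ D.thickenings S :=
  ⟨hS, subset_rfl, _, D.coarse.diag, fun x hx => ⟨x, hx, rfl⟩⟩

lemma directedOn_thickenings (D : GBornCoarse.{v, u} G) (S : Set D) :
    DirectedOn (· ⊆ ·) (D.thickenings S) := by
  rintro A ⟨hA, hSA, U, hU, hAU⟩ B ⟨hB, hSB, V, hV, hBV⟩
  refine ⟨A ∪ B, ⟨?_, fun x hx => Or.inl (hSA hx), U ∪ V, D.coarse.union hU hV, ?_⟩,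
    Set.subset_union_left, Set.subset_union_right⟩
  · rintro g x (hx | hx)
    exacts [Or.inl (hA g x hx), Or.inr (hB g x hx)]
  · rintro x (hx | hx)
    · obtain ⟨b, hb, h⟩ := hAU hx
      exact ⟨b, hb, Or.inl h⟩
    · obtain ⟨b, hb, h⟩ := hBV hx
      exact ⟨b, hb, Or.inr h⟩

lemma isBigFamily_thickenings (D : GBornCoarse.{v, u} G) {S : Set D} (hS : InvariantSet G S) :
    D.IsBigFamily (D.thickenings S) where
  nonempty := ⟨S, mem_thickenings_self hS⟩
  directed := directedOn_thickenings D S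
  invariant _ hA := hA.1
  absorbs := by
    rintro A ⟨hA, hSA, U, hU, hAU⟩ V hV
    -- The diagonal ensures that `A`, and thus `S`, lies in `W[A]`; invariance of `W` makes `W[A]`
    -- invariant.
    obtain ⟨W, hW, hVW, hi⟩ := D.invariant_cofinal _ (D.coarse.union hV D.coarse.diag)
    refine ⟨thicken W A, ⟨?_, fun x hx => ⟨x, hSA hx, hVW (Or.inr rfl)⟩, _,
      D.coarse.comp hW hU, ?_⟩,
      fun x ⟨b, hb, h⟩ => ⟨b, hb, hVW (Or.inl h)⟩⟩
    · rintro g x ⟨b, hb, h⟩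
      exact ⟨g • b, hA g b hb, hi g _ _ h⟩
    · rintro x ⟨b, hb, h⟩
      obtain ⟨c, hc, h'⟩ := hAU hb
      exact ⟨c, hc, b, h, h'⟩

end GBornCoarse

variable {G : Type u} [Group G]

open GBornCoarse PshSp

namespace IsSaturatedClass

variable {L : MorphismProperty (CoarsePshSp G)} (hL : IsSaturatedClass L)
  (hE : EventualEquiv ≤ L) (hG : CoarseGenerator ≤ L)

include hL hE hG in
-- For every member `A` of the family, `ρ` retracts `T ∩ A` onto `T ∩ S` and is close to the
-- identity there, since `A` lies in one thickening of `S`. The claim follows by passing to the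
-- directed union.
lemma homOfLe_thickenings_mem {D : GBornCoarse.{u, u} G} {S T : Set D} (hS : InvariantSet G S)
    (hT : InvariantSet G T) (ρ : D → D) (hρ : ∀ (g : G) x, ρ (g • x) = g • ρ x)
    (hρS : ∀ x, ρ x ∈ S) (hρT : ∀ x ∈ T, ρ x ∈ T) (hid : ∀ x ∈ S, ρ x = x)
    (hclose : ∀ U, D.coarse.IsEntourage U →
      D.coarse.IsEntourage {p | ∃ x ∈ thicken U S, p = (x, ρ x)})
    (h : yoSub D (T ∩ S) ≤ ⨆ A : ULift.{u + 1} (D.thickenings S), yoSub D (T ∩ A.down.1)) :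
    L (suspSpectrumPlus.map (Subfunctor.homOfLe h)) := by
  have : IsDirectedOrder (ULift.{u + 1} (D.thickenings S)) := ⟨fun A B => by
    obtain ⟨E, hE, hAE, hBE⟩ := directedOn_thickenings D S A.down.1 A.down.2 B.down.1 B.down.2
    exact ⟨⟨⟨E, hE⟩⟩, hAE, hBE⟩⟩
  have : Nonempty (ULift.{u + 1} (D.thickenings S)) := ⟨⟨⟨S, mem_thickenings_self hS⟩⟩⟩
  refine hL.map_le_iSup_mem hE _ (fun A : ULift.{u + 1} (D.thickenings S) => yoSub D (T ∩ A.down.1))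
    (fun A B hAB => yoSub_mono (Set.inter_subset_inter_right _ hAB))
    (fun A => yoSub_mono (Set.inter_subset_inter_right _ A.down.2.2.1)) (fun A => ?_) h
  obtain ⟨⟨A, hA, hSA, U, hU, hAU⟩⟩ := A
  refine hL.homOfLe_mem_of_retraction hE hG (invariant_inter hT hS) (invariant_inter hT hA)
    (Set.inter_subset_inter_right _ hSA) ρ hρ
    (fun x hx => ⟨hρT x hx.1, hρS x⟩) (fun x hx => hid x hx.2) (D.coarse.subset (hclose U hU) ?_)
  rintro _ ⟨x, hx, rfl⟩
  exact ⟨x, hAU hx.2, rfl⟩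

include hL hE hG in
/-- Excision for a decomposition of a space into two subspaces, one of which is a coarse
deformation retract of its thickenings, compatibly with the other one. -/
theorem mayerVietoris {A Z P D : GBornCoarse.{u, u} G} (i : A ⟶ Z) (i' : A ⟶ P) (z : Z ⟶ D)
    (p : P ⟶ D) (hz : IsEmbedding z) (hp : IsEmbedding p) (hA : IsEmbedding (i ≫ z))
    (hc : i ≫ z = i' ≫ p)
    (hinter : Set.range (fn z) ∩ Set.range (fn p) = Set.range (fn (i ≫ z)))
    (hunion : Set.range (fn z) ∪ Set.range (fn p) = Set.univ)
    (ρ : D → D) (hρ : ∀ (g : G) x, ρ (g • x) = g • ρ x) (hρP : ∀ x, ρ x ∈ Set.range (fn p))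
    (hρZ : ∀ x ∈ Set.range (fn z), ρ x ∈ Set.range (fn z)) (hid : ∀ x, ρ (fn p x) = fn p x)
    (hclose : ∀ U, D.coarse.IsEntourage U →
      D.coarse.IsEntourage {q | ∃ x ∈ thicken U (Set.range (fn p)), q = (x, ρ x)})
    (hw : yoSp.map i ≫ yoSp.map z = yoSp.map i' ≫ yoSp.map p) :
    L (cofiberMap (yoSp.map i') (yoSp.map z) (yoSp.map i) (yoSp.map p) hw) := by
  set SZ := Set.range (fn z) with hSZ
  set SP := Set.range (fn p) with hSP
  have hSP' : InvariantSet G SP := invariant_range p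
  have hSZ' : InvariantSet G SZ := invariant_range z
  have hid' : ∀ x ∈ SP, ρ x = x := by
    rintro _ ⟨x, rfl⟩
    exact hid x
  let F := D.thickenings SP
  have hF : D.IsComplementaryPair SZ F :=
    ⟨hSZ', isBigFamily_thickenings D hSP', SP, mem_thickenings_self hSP', hunion⟩
  -- The superfluous intersection with `Set.univ` gives `QF` and `QZ` the same shape, so that
  -- `homOfLe_thickenings_mem` covers both.
  let QF : Subfunctor (yo D) := ⨆ A : ULift.{u + 1} F, yoSub D (Set.univ ∩ A.down.1)
  let QZ : Subfunctor (yo D) := ⨆ A : ULift.{u + 1} F, yoSub D (SZ ∩ A.down.1)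
  let A₀ : ULift.{u + 1} F := ⟨⟨SP, mem_thickenings_self hSP'⟩⟩
  have l1 : yoSub D (Set.univ ∩ SP) ≤ QF :=
    le_iSup (fun A : ULift.{u + 1} F => yoSub D (Set.univ ∩ A.down.1)) A₀
  have l2 : yoSub D (SZ ∩ SP) ≤ QZ :=
    le_iSup (fun A : ULift.{u + 1} F => yoSub D (SZ ∩ A.down.1)) A₀
  have l3 : yoSub D (SZ ∩ SP) ≤ yoSub D (Set.univ ∩ SP) :=
    yoSub_mono (Set.inter_subset_inter_left _ (Set.subset_univ _))
  have l4 : QZ ≤ QF := iSup_mono fun A =>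
    yoSub_mono (Set.inter_subset_inter_left _ (Set.subset_univ _))
  have l5 : QZ ≤ yoSub D SZ := iSup_le fun A => yoSub_mono Set.inter_subset_left
  have l6 : QF ≤ excisionSub D SZ F := iSup_le fun A _ f hf =>
    Or.inr ⟨A.down.1, A.down.2, fun t => (hf t).2⟩
  have l7 : yoSub D SZ ≤ excisionSub D SZ F := fun _ f hf => Or.inl hf
  have l8 : QF ⊓ yoSub D SZ ≤ QZ := by
    rintro T f ⟨hf, hf'⟩
    rw [Subfunctor.iSup_obj, Set.mem_iUnion] at hf ⊢
    obtain ⟨A, hA⟩ := hf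
    exact ⟨A, fun t => ⟨hf' t, (hA t).2⟩⟩
  have l9 : excisionSub D SZ F ≤ QF ⊔ yoSub D SZ := by
    rintro T f (hf | ⟨A, hA, hf⟩)
    · exact Or.inr hf
    · refine Or.inl ?_
      rw [Subfunctor.iSup_obj, Set.mem_iUnion]
      exact ⟨⟨⟨A, hA⟩⟩, fun t => ⟨trivial, hf t⟩⟩
  have hiA : IsIso (yoToSub (i ≫ z) (SZ ∩ SP) (by rw [hinter]; exact Set.mem_range_self)) :=
    isIso_yoToSub hA _ hinter
  have hiP : IsIso (yoToSub p (Set.univ ∩ SP) (by rw [Set.univ_inter]; exact Set.mem_range_self)) :=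
    isIso_yoToSub hp _ (Set.univ_inter _)
  have hiZ : IsIso (yoToSub z SZ Set.mem_range_self) := isIso_yoToSub hz _ rfl
  -- Replacement of the spaces `A` and `P` by subpresheaves of `yo D`.
  have c1 : L (suspCofiberMap (uliftYoneda.{u + 1}.map i') (Subfunctor.homOfLe l3)
      (yoToSub (i ≫ z) (SZ ∩ SP) (by rw [hinter]; exact Set.mem_range_self))
      (yoToSub p (Set.univ ∩ SP) (by rw [Set.univ_inter]; exact Set.mem_range_self)) (by
        ext T f
        refine Subtype.ext (ULift.ext _ _ ?_)
        exact congrArg (fun k => f.down ≫ k) hc)) :=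
    hL.cofiberMap_mem hE _ _ _ _ _ (iso hE _) (iso hE _) (levelInjective_homOfLe _)
  -- Passage from `Z ∩ P` and `P` to the unions over all thickenings of `P`.
  have c2 : L (suspCofiberMap (Subfunctor.homOfLe l3) (Subfunctor.homOfLe l4)
      (Subfunctor.homOfLe l2) (Subfunctor.homOfLe l1) rfl) :=
    hL.cofiberMap_mem hE _ _ _ _ _
      (hL.homOfLe_thickenings_mem hE hG hSP' hSZ' ρ hρ hρP hρZ hid' hclose l2)
      (hL.homOfLe_thickenings_mem hE hG hSP' (T := Set.univ) (fun _ _ _ => trivial) ρ hρ hρP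
        (fun _ _ => trivial)
        hid' hclose l1) (levelInjective_homOfLe _)
  -- The excision subpresheaf is the push-out of `yoSub D SZ` and `QF` along `QZ`, so the cofibres
  -- agree.
  have c3 : L (suspCofiberMap (Subfunctor.homOfLe l4) (Subfunctor.homOfLe l7)
      (Subfunctor.homOfLe l5) (Subfunctor.homOfLe l6) rfl) :=
    hL.cofiberMap_mem_of_isPushout hE
      ((isPushout_subfunctor _ _ _ _ l4 l5 l6 l7 l8 l9).map suspSpectrumPlus)
      (levelInjective_homOfLe _)
  have hι : LevelInjective (suspSpectrumPlus.map (yoSub D SZ).ι) :=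
    suspSpectrumPlus_map_injective _ fun _ _ _ h => Subtype.ext h
  -- This is where the excision generator is used.
  have c4 : L (suspCofiberMap (Subfunctor.homOfLe l7) (yoSub D SZ).ι (𝟙 _)
      (excisionSub D SZ F).ι rfl) :=
    hL.cofiberMap_mem hE _ _ _ _ _ (iso hE _) (hG _ (.excision D SZ F hF)) hι
  have c5 : L (suspCofiberMap (uliftYoneda.{u + 1}.map z) (yoSub D SZ).ι
      (yoToSub z SZ Set.mem_range_self) (𝟙 _) rfl) :=
    hL.cofiberMap_mem hE _ _ _ _ _ (iso hE _) (iso hE _) hι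
  have c := hL.suspCofiberMap_mem_comp (hL.suspCofiberMap_mem_comp
    (hL.suspCofiberMap_mem_comp c1 c2) c3) c4
  have hw' : uliftYoneda.{u + 1}.map i ≫ uliftYoneda.{u + 1}.map z =
      uliftYoneda.{u + 1}.map i' ≫ uliftYoneda.{u + 1}.map p := by
    rw [← Functor.map_comp, ← Functor.map_comp, hc]
  -- The morphism in question followed by the identification `c5` of `yo Z` with its image is the
  -- composite of `c1` to `c4`.
  refine hL.of_postcomp (f := suspCofiberMap (uliftYoneda.{u + 1}.map i')
    (uliftYoneda.{u + 1}.map z) (uliftYoneda.{u + 1}.map i) (uliftYoneda.{u + 1}.map p) hw') c5 ?_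
  rw [suspCofiberMap_comp]
  · exact c
  · rfl

end IsSaturatedClass

end MayerVietoris

/-! ### Coarse cylinders in the product with the real line -/

section Cylinders

namespace GBornCoarse

variable {G : Type v} [Group G]

lemma isEmbedding_lift {T D : GBornCoarse.{v, u} G} {i : T ⟶ D} (hi : IsEmbedding i) (A : Set D)
    (hA : InvariantSet G A) (h : ∀ t, fn i t ∈ A) : IsEmbedding (lift i A hA h) where
  injective _ _ hxy := hi.injective (congrArg val hxy)
  entourage U hU := hi.entourage U (D.coarse.subset hU (by
    rintro _ ⟨p, hp, rfl⟩
    exact ⟨_, ⟨p, hp, rfl⟩, rfl⟩))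
  bounded B hB := (Bornology.isBounded_image_subtype_val (p := fun x => x ∈ A)).1
    ((hi.bounded B hB).subset (by
      rintro _ ⟨_, ⟨x, hx, rfl⟩, rfl⟩
      exact ⟨x, hx, rfl⟩))

/-- The product with the real line. -/
abbrev lineTensor (X : GBornCoarse.{v, u} G) : GBornCoarse.{v, u} G :=
  (GUBC.line G).toGBornCoarse.tensor X

/-- The real coordinate. -/
def height {X : GBornCoarse.{v, u} G} (q : lineTensor X) : ℝ := q.1

lemma val_mem {D : GBornCoarse.{v, u} G} {A : Set D} {hA : InvariantSet G A} (a : D.sub A hA) :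
    val a ∈ A := a.2

lemma isBounded_sub_iff {D : GBornCoarse.{v, u} G} {A : Set D} {hA : InvariantSet G A}
    {B : Set (D.sub A hA)} : Bornology.IsBounded B ↔ Bornology.IsBounded (val '' B) :=
  (Bornology.isBounded_image_subtype_val (p := fun x => x ∈ A)).symm

lemma isBounded_lineTensor_iff {X : GBornCoarse.{v, u} G} {B : Set (lineTensor X)} :
    Bornology.IsBounded B ↔ Bornology.IsBounded (height '' B) ∧
      Bornology.IsBounded (Prod.snd '' B) :=
  (Bornology.isBounded_image_fst_and_snd (α := ℝ) (β := X)).symm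

/-- The functions that bound coarse cylinders. -/
structure IsGauge (X : GBornCoarse.{v, u} G) (p : X → ℝ) : Prop where
  nonneg : ∀ x, 0 ≤ p x
  invariant : ∀ (g : G) x, p (g • x) = p x
  controlled : ∀ U, X.coarse.IsEntourage U → ∃ c, ∀ q ∈ U, |p q.1 - p q.2| ≤ c
  bounded : ∀ B : Set X, Bornology.IsBounded B → ∃ c, ∀ x ∈ B, p x ≤ c

/-- With this gauge the zero section and the lower half of `ℝ ⊗ X` become instances of the graph and
of the region below it. -/
lemma isGauge_zero (X : GBornCoarse.{v, u} G) : IsGauge X (fun _ => 0) where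
  nonneg _ := le_rfl
  invariant _ _ := rfl
  controlled _ _ := ⟨0, fun _ _ => by simp⟩
  bounded _ _ := ⟨0, fun _ _ => le_rfl⟩

variable {X : GBornCoarse.{v, u} G} {p : X → ℝ}

/-- The morphism `x ↦ (p x, x)`. -/
def IsGauge.graph (hp : IsGauge X p) : X ⟶ lineTensor X where
  toFun x := (p x, x)
  equivariant g x := Prod.ext (hp.invariant g x) rfl
  controlled U hU := by
    obtain ⟨c, hc⟩ := hp.controlled U hU
    refine ⟨{q : ℝ × ℝ | |q.1 - q.2| ≤ c}, U, ⟨c, fun _ hq => hq⟩, hU, ?_⟩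
    rintro _ ⟨q, hq, rfl⟩
    exact ⟨hc q hq, hq⟩
  proper B hB := ((Bornology.isBounded_image_fst_and_snd (α := ℝ) (β := X)).2 hB).2.subset
    fun x hx => ⟨_, hx, rfl⟩

lemma IsGauge.isEmbedding_graph (hp : IsGauge X p) : IsEmbedding hp.graph where
  injective _ _ h := congrArg Prod.snd h
  entourage U hU := by
    obtain ⟨_, V, _, hV, h⟩ := hU
    exact X.coarse.subset hV fun q hq => (h _ ⟨q, hq, rfl⟩).2
  bounded B hB := by
    refine (Bornology.isBounded_image_fst_and_snd (α := ℝ) (β := X)).1 ⟨?_, hB.subset ?_⟩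
    · obtain ⟨c, hc⟩ := hp.bounded B hB
      refine (Metric.isBounded_Icc 0 c).subset ?_
      rintro _ ⟨_, ⟨x, hx, rfl⟩, rfl⟩
      exact ⟨hp.nonneg x, hc x hx⟩
    · rintro _ ⟨_, ⟨x, hx, rfl⟩, rfl⟩
      exact hx

lemma IsGauge.invariant_below (hp : IsGauge X p) :
    InvariantSet G (X := lineTensor X) {q : lineTensor X | height q ≤ p q.2} := fun g q hq => by
  change height q ≤ p (g • q.2)
  rw [hp.invariant]
  exact hq

lemma IsGauge.invariant_cylinder (hp : IsGauge X p) :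
    InvariantSet G (X := lineTensor X) {q : lineTensor X | 0 ≤ height q ∧ height q ≤ p q.2} :=
  fun g q hq => ⟨hq.1, hp.invariant_below g q hq.2⟩

/-- The subspace of points below the graph. -/
abbrev IsGauge.below (hp : IsGauge X p) : GBornCoarse.{v, u} G :=
  (lineTensor X).sub _ hp.invariant_below

/-- The coarse cylinder: the subspace of points between zero and the graph. -/
abbrev IsGauge.cylinder (hp : IsGauge X p) : GBornCoarse.{v, u} G :=
  (lineTensor X).sub _ hp.invariant_cylinder

/-- The downward shift by one. -/
def IsGauge.shift (hp : IsGauge X p) : hp.below ⟶ hp.below :=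
  lift (ofClose ((lineTensor X).incl _ hp.invariant_below)
    (fun q => (height (val q) - 1, (val q).2)) (fun _ _ => rfl)
    ⟨{q : ℝ × ℝ | |q.1 - q.2| ≤ 1}, _, ⟨1, fun _ hq => hq⟩, X.coarse.diag, by
      rintro _ ⟨q, rfl⟩
      refine ⟨?_, rfl⟩
      change |height (val q) - (height (val q) - 1)| ≤ 1
      simp⟩) _ hp.invariant_below
    (fun q => (sub_le_self (height (val q)) zero_le_one).trans q.2)

lemma IsGauge.height_shift_iterate (hp : IsGauge X p) (n : ℕ) (q : hp.below) :
    height (val ((fn hp.shift)^[n] q)) = height (val q) - n := by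
  induction n with
  | zero => simp
  | succ n ih =>
    rw [Function.iterate_succ_apply']
    change height (val ((fn hp.shift)^[n] q)) - 1 = _
    rw [ih]
    push_cast
    ring

lemma IsGauge.snd_shift_iterate (hp : IsGauge X p) (n : ℕ) (q : hp.below) :
    (val ((fn hp.shift)^[n] q)).2 = (val q).2 := by
  induction n with
  | zero => rfl
  | succ n ih =>
    rw [Function.iterate_succ_apply']
    exact ih

/-- The downward shift has displacement one and preserves differences of heights. It leaves bounded
sets because heights over a bounded part of `X`, and by invariance over its orbit, are bounded above
by the gauge. -/
lemma IsGauge.isFlasque_below (hp : IsGauge X p) : IsFlasque hp.below := by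
  refine ⟨hp.shift, ⟨{q : ℝ × ℝ | |q.1 - q.2| ≤ 1}, _, ⟨1, fun _ hq => hq⟩, X.coarse.diag, ?_⟩,
    ?_, ?_⟩
  · rintro _ ⟨⟨q', q⟩, hq, rfl⟩
    obtain rfl : q' = fn hp.shift q := hq
    refine ⟨?_, rfl⟩
    refine (congrArg abs
      (sub_sub_cancel_left (height (val (hA := hp.invariant_below) q)) 1)).trans_le ?_
    simp
  · rintro U ⟨A, B, ⟨c, hc⟩, hB, h⟩
    refine ⟨{q : ℝ × ℝ | |q.1 - q.2| ≤ c}, B, ⟨c, fun _ hq => hq⟩, hB, ?_⟩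
    rintro _ ⟨_, hq', rfl⟩
    obtain ⟨n, q, hq, rfl⟩ := Set.mem_iUnion.1 hq'
    have h3 := h _ ⟨q, hq, rfl⟩
    have h4 : |height (val q.1) - height (val q.2)| ≤ c := hc _ h3.1
    refine ⟨?_, ?_⟩
    · change |height (val ((fn hp.shift)^[n] q.1)) - height (val ((fn hp.shift)^[n] q.2))| ≤ c
      rw [hp.height_shift_iterate, hp.height_shift_iterate]
      simpa using h4
    · change ((val ((fn hp.shift)^[n] q.1)).2, (val ((fn hp.shift)^[n] q.2)).2) ∈ B
      rw [hp.snd_shift_iterate, hp.snd_shift_iterate]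
      exact h3.2
  · intro B hB
    rw [isBounded_sub_iff, isBounded_lineTensor_iff] at hB
    obtain ⟨c, hc⟩ := hp.bounded _ hB.2
    obtain ⟨d, hd⟩ := hB.1.subset_closedBall (0 : ℝ)
    -- After `n` steps the height over the orbit of the base of `B` is at most `c - n < -d`, while
    -- `B` has heights at least `-d`.
    obtain ⟨n, hn⟩ := exists_nat_gt (c + d)
    refine ⟨n, Set.eq_empty_iff_forall_notMem.2 ?_⟩
    rintro _ ⟨⟨q, rfl⟩, g, b, hb, h⟩
    have e1 := hp.height_shift_iterate n q
    have e2 := hp.snd_shift_iterate n q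
    rw [h] at e1 e2
    change height (val b) = _ at e1
    change g • (val b).2 = _ at e2
    have e3 : height (val b) ∈ Metric.closedBall (0 : ℝ) d := hd ⟨_, ⟨b, hb, rfl⟩, rfl⟩
    have e4 : p (val b).2 ≤ c := hc _ ⟨_, ⟨b, hb, rfl⟩, rfl⟩
    have e5 : height (val q) ≤ p (val q).2 := q.2
    rw [← e2, hp.invariant] at e5
    rw [Metric.mem_closedBall, Real.dist_eq, sub_zero] at e3
    have := (abs_le.1 e3).1
    linarith

/-- The bottom of the coarse cylinder. -/
def IsGauge.bottom (hp : IsGauge X p) : X ⟶ hp.cylinder :=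
  lift (isGauge_zero X).graph _ hp.invariant_cylinder fun x => ⟨le_refl (0 : ℝ), hp.nonneg x⟩

/-- The top of the coarse cylinder. -/
def IsGauge.top (hp : IsGauge X p) : X ⟶ hp.cylinder :=
  lift hp.graph _ hp.invariant_cylinder fun x => ⟨hp.nonneg x, le_refl (p x)⟩

/-- The projection of the coarse cylinder. -/
def IsGauge.proj (hp : IsGauge X p) : hp.cylinder ⟶ X where
  toFun q := (val q).2
  equivariant _ _ := rfl
  controlled := by
    rintro U ⟨_, V, _, hV, h⟩
    refine X.coarse.subset hV ?_
    rintro _ ⟨q, hq, rfl⟩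
    exact (h _ ⟨q, hq, rfl⟩).2
  proper B hB := by
    -- Properness of the projection is the reason for requiring gauges to be bounded on bounded
    -- sets.
    obtain ⟨c, hc⟩ := hp.bounded B hB
    rw [isBounded_sub_iff, isBounded_lineTensor_iff]
    refine ⟨(Metric.isBounded_Icc 0 c).subset ?_, hB.subset ?_⟩
    · rintro _ ⟨_, ⟨x, hx, rfl⟩, rfl⟩
      exact ⟨(val_mem x).1, (val_mem x).2.trans (hc _ hx)⟩
    · rintro _ ⟨_, ⟨x, hx, rfl⟩, rfl⟩
      exact hx

end GBornCoarse

end Cylinders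

/-! ### Homotopy invariance of the coarse motive -/

section Motives

variable {G : Type u} [Group G]

open GBornCoarse PshSp

namespace IsSaturatedClass

variable {L : MorphismProperty (CoarsePshSp G)} (hL : IsSaturatedClass L)
  (hE : EventualEquiv ≤ L)

include hL hE in
lemma acyclic_of_subIncl_bot {X : GBornCoarse.{u, u} G}
    (h : L (subIncl (⊥ : Subfunctor (yo X)))) : Acyclic L (yoSp.obj X) :=
  hL.acyclic_of_isZero hE (isZero_suspSpectrumPlus
    (P := (⊥ : Subfunctor (yo X)).toFunctor) fun _ => ⟨fun x => x.2⟩) h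

include hL hE in
-- The region below the graph is the union of the lower half line and the cylinder, which meet in
-- the bottom `X`. Mayer–Vietoris maps the cofibre of the bottom inclusion by an equivalence to the
-- cofibre of a morphism between two flasque spaces.
lemma bottom_mem (hG : CoarseGenerator ≤ L) {X : GBornCoarse.{u, u} G} {p : X → ℝ}
    (hp : IsGauge X p) : L (yoSp.map hp.bottom) := by
  have h0 : ∀ x, (0 : ℝ) ≤ p x := hp.nonneg
  let i : X ⟶ (isGauge_zero X).below :=
    lift (isGauge_zero X).graph _ (isGauge_zero X).invariant_below fun x => le_refl (0 : ℝ)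
  let z : (isGauge_zero X).below ⟶ hp.below :=
    lift ((lineTensor X).incl _ (isGauge_zero X).invariant_below) _ hp.invariant_below
      fun q => (show height (val q) ≤ 0 from q.2).trans (h0 _)
  let k : hp.cylinder ⟶ hp.below :=
    lift ((lineTensor X).incl _ hp.invariant_cylinder) _ hp.invariant_below fun q => q.2.2
  have hz : ∀ q : hp.below, q ∈ Set.range (fn z) ↔ height (val q) ≤ 0 := fun q =>
    ⟨by rintro ⟨q, rfl⟩; exact q.2, fun h => ⟨⟨val q, h⟩, rfl⟩⟩
  have hk : ∀ q : hp.below, q ∈ Set.range (fn k) ↔ 0 ≤ height (val q) := fun q =>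
    ⟨by rintro ⟨q, rfl⟩; exact q.2.1, fun h => ⟨⟨val q, h, q.2⟩, rfl⟩⟩
  have hiz : ∀ q : hp.below, q ∈ Set.range (fn (i ≫ z)) ↔ height (val q) = 0 := fun q =>
    ⟨by rintro ⟨q, rfl⟩; rfl, fun h => ⟨(val q).2, Subtype.ext (Prod.ext h.symm rfl)⟩⟩
  have hmem : ∀ q : hp.below, max (height (val q)) 0 ≤ p (val q).2 := fun q => max_le q.2 (h0 _)
  have key := hL.mayerVietoris hE hG i hp.bottom z k
    (isEmbedding_lift (isEmbedding_incl _ _ _) _ _ _)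
    (isEmbedding_lift (isEmbedding_incl _ _ _) _ _ _)
    (isEmbedding_lift (isGauge_zero X).isEmbedding_graph _ hp.invariant_below h0) rfl
    (by
      ext q
      rw [Set.mem_inter_iff, hz, hk, hiz]
      exact ⟨fun h => le_antisymm h.1 h.2, fun h => ⟨h.le, h.ge⟩⟩)
    (by
      ext q
      rw [Set.mem_union, hz, hk]
      simpa using le_total _ _)
    (fun q => ⟨((max (height (val q)) 0 : ℝ), (val q).2), hmem q⟩)
    (fun g q => rfl)
    (fun q => (hk _).2 (le_max_right _ _))
    (fun q hq => by
      rw [hz] at hq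
      exact (hz _).2 (max_le hq le_rfl))
    (fun q => Subtype.ext (Prod.ext (max_eq_left q.2.1) rfl))
    (by
      -- A point of negative height in the thickening of the cylinder has a partner of nonnegative
      -- height within distance `c`, so `ρ` lifts it by at most `c`.
      rintro U ⟨A, B, ⟨c, hc⟩, hB, h⟩
      refine ⟨{q : ℝ × ℝ | |q.1 - q.2| ≤ c}, _, ⟨c, fun _ hq => hq⟩, X.coarse.diag, ?_⟩
      rintro _ ⟨_, ⟨q, ⟨b, hb, hqb⟩, rfl⟩, rfl⟩
      refine ⟨?_, rfl⟩
      have h1 : |height (val q) - height (val b)| ≤ c := hc _ (h _ ⟨_, hqb, rfl⟩).1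
      have h2 := (hk b).1 hb
      have h3 := abs_le.1 h1
      have h4 := (abs_nonneg _).trans h1
      change |height (val q) - max (height (val q)) 0| ≤ c
      rcases le_total (height (val q)) 0 with h5 | h5
      · rw [max_eq_right h5, sub_zero, abs_of_nonpos h5]
        linarith
      · rw [max_eq_left h5, sub_self, abs_zero]
        exact h4)
    (by rw [← Functor.map_comp, ← Functor.map_comp]; rfl)
  exact hL.mem_of_cofiberMap_mem hE key
    (hL.acyclic_of_subIncl_bot hE (hG _ (.flasque _ (isGauge_zero X).isFlasque_below)))
    (hL.acyclic_of_subIncl_bot hE (hG _ (.flasque _ hp.isFlasque_below)))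

end IsSaturatedClass

/-- Morphisms that are homotopic along a coarse cylinder have the same motive. -/
lemma motive_map_eq_of_homotopy {X Y : GBornCoarse.{u, u} G} {p : X → ℝ} (hp : IsGauge X p)
    (h : hp.cylinder ⟶ Y) : motive.map (hp.bottom ≫ h) = motive.map (hp.top ≫ h) := by
  have h1 : IsIso (motive.map hp.bottom) :=
    Localization.inverts (localEquivalences CoarseGenerator).Q (localEquivalences CoarseGenerator) _
      fun L hL hE hG => hL.bottom_mem hE hG hp
  -- Top and bottom are both sections of the projection, which is invertible because `bottom` is;
  -- hence they have the same motive.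
  have h2 : motive.map hp.bottom ≫ motive.map hp.proj = 𝟙 _ := by
    rw [← Functor.map_comp]
    exact motive.map_id X
  have h3 : motive.map hp.top ≫ motive.map hp.proj = 𝟙 _ := by
    rw [← Functor.map_comp]
    exact motive.map_id X
  have h4 : IsIso (motive.map hp.bottom ≫ motive.map hp.proj) := by
    rw [h2]
    infer_instance
  have h5 : IsIso (motive.map hp.proj) := IsIso.of_isIso_comp_left (motive.map hp.bottom) _
  rw [Functor.map_comp, Functor.map_comp, (cancel_mono (motive.map hp.proj)).1 (h2.trans h3.symm)]

end Motives

/-! ### The hybrid structure on cones in coordinates -/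

section Cones

variable {G : Type v} [Group G]

open GBornCoarse Uniformity

namespace GUBC

/-- The cone coordinate. -/
def time {N : GUBC.{v, u} G} (q : cone.obj N) : ℝ :=
  (GBornCoarse.val (hA := invariant_nonneg N) q).1

/-- The projection of a cone to its base. -/
def base {N : GUBC.{v, u} G} (q : cone.obj N) : N :=
  (GBornCoarse.val (hA := invariant_nonneg N) q).2

lemma time_nonneg {N : GUBC.{v, u} G} (q : cone.obj N) : 0 ≤ time q :=
  val_mem (hA := invariant_nonneg N) q

/-- The point of a cone with given coordinates. -/
def conePoint {N : GUBC.{v, u} G} (t : ℝ) (ht : 0 ≤ t) (x : N) : cone.obj N := ⟨(t, x), ht⟩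

lemma cone_ext {N : GUBC.{v, u} G} {q q' : cone.obj N} (ht : time q = time q')
    (hb : base q = base q') : q = q' := Subtype.ext (Prod.ext ht hb)

lemma cone_isBounded_iff {N : GUBC.{v, u} G} {B : Set (cone.obj N)} :
    Bornology.IsBounded B ↔ (∃ c, ∀ q ∈ B, time q ≤ c) ∧ Bornology.IsBounded (base '' B) := by
  have h : Bornology.IsBounded B ↔ Bornology.IsBounded (time '' B) ∧
      Bornology.IsBounded (base '' B) := by
    refine (isBounded_sub_iff (hA := invariant_nonneg N)).trans
      ((Bornology.isBounded_image_fst_and_snd (α := ℝ) (β := N)).symm.trans ?_)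
    exact and_congr (iff_of_eq (congrArg Bornology.IsBounded (Set.image_image
        (Prod.fst : ℝ × N → ℝ) (GBornCoarse.val (hA := invariant_nonneg N)) B)))
      (iff_of_eq (congrArg Bornology.IsBounded (Set.image_image
        (Prod.snd : ℝ × N → N) (GBornCoarse.val (hA := invariant_nonneg N)) B)))
  refine h.trans (and_congr_left fun _ => ⟨fun h => ?_, fun ⟨c, hc⟩ => ?_⟩)
  · obtain ⟨c, hc⟩ := h.bddAbove
    exact ⟨c, fun q hq => hc ⟨q, hq, rfl⟩⟩
  · exact (Metric.isBounded_Icc 0 c).subset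
      (Set.image_subset_iff.2 fun q hq => ⟨time_nonneg q, hc q hq⟩)

lemma cone_isEntourage_iff {N : GUBC.{v, u} G} {U : Set (cone.obj N × cone.obj N)} :
    (cone.obj N).coarse.IsEntourage U ↔
      (∃ c V, N.coarse.IsEntourage V ∧
        ∀ p ∈ U, |time p.1 - time p.2| ≤ c ∧ (base p.1, base p.2) ∈ V) ∧
      ∀ δ > 0, ∀ E ∈ 𝓤 N, ∃ n : ℕ, ∀ p ∈ U,
        (|time p.1 - time p.2| < δ ∧ (base p.1, base p.2) ∈ E) ∨
          (time p.1 ≤ n ∧ time p.2 ≤ n) := by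
  constructor
  · rintro ⟨⟨A, V, ⟨c, hc⟩, hV, h⟩, hu⟩
    refine ⟨⟨c, V, hV, fun p hp => ?_⟩, fun δ hδ E hE => ?_⟩
    · have := h _ ⟨p, hp, rfl⟩
      exact ⟨hc _ this.1, this.2⟩
    · obtain ⟨n, hn⟩ := hu _ (entourageProd_mem_uniformity (α := ℝ) (β := N)
        (Metric.dist_mem_uniformity hδ) hE)
      exact ⟨n, fun p hp => hn _ ⟨p, hp, rfl⟩⟩
  · rintro ⟨⟨c, V, hV, h⟩, hu⟩
    refine ⟨⟨{q : ℝ × ℝ | |q.1 - q.2| ≤ c}, V, ⟨c, fun _ hq => hq⟩, hV, ?_⟩, fun E hE => ?_⟩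
    · rintro _ ⟨p, hp, rfl⟩
      exact h p hp
    · obtain ⟨A, hA, B, hB, hAB⟩ := entourageProd_subset (α := ℝ) (β := N) hE
      obtain ⟨δ, hδ, hA⟩ := Metric.mem_uniformity_dist.1 hA
      obtain ⟨n, hn⟩ := hu δ hδ B hB
      refine ⟨n, ?_⟩
      rintro _ ⟨p, hp, rfl⟩
      exact (hn p hp).imp_left fun h => hAB ⟨hA h.1, h.2⟩

/-- A coarse embedding of the bases is not enough: the hybrid structure also sees the uniform
structure, so the latter must be induced as well, which is the condition `hu`. -/
lemma isEmbedding_cone_map {N N' : GUBC.{v, u} G} {f : N ⟶ N'} (hf : IsEmbedding f.base)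
    (hu : ∀ E ∈ 𝓤 N, ∃ E' ∈ 𝓤 N', ∀ x y, (fn f x, fn f y) ∈ E' → (x, y) ∈ E) :
    IsEmbedding (cone.map f) where
  injective q q' h := cone_ext (congrArg (time (N := N')) h)
    (hf.injective (congrArg (base (N := N')) h))
  entourage U hU := by
    obtain ⟨⟨c, V, hV, h⟩, h'⟩ := cone_isEntourage_iff.1 hU
    refine cone_isEntourage_iff.2 ⟨⟨c, _, hf.entourage (Prod.map (fn f) (fn f) ⁻¹' V)
      (N'.coarse.subset hV (Set.image_preimage_subset _ _)), fun p hp => h _ ⟨p, hp, rfl⟩⟩,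
      fun δ hδ E hE => ?_⟩
    obtain ⟨E', hE', hEE⟩ := hu E hE
    obtain ⟨n, hn⟩ := h' δ hδ E' hE'
    exact ⟨n, fun p hp => (hn _ ⟨p, hp, rfl⟩).imp_left fun h => ⟨h.1, hEE _ _ h.2⟩⟩
  bounded B hB := by
    obtain ⟨⟨c, hc⟩, hb⟩ := cone_isBounded_iff.1 hB
    refine cone_isBounded_iff.2 ⟨⟨c, ?_⟩, (hf.bounded _ hb).subset ?_⟩
    · rintro _ ⟨q, hq, rfl⟩
      exact hc q hq
    · rintro _ ⟨_, ⟨q, hq, rfl⟩, rfl⟩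
      exact ⟨_, ⟨q, hq, rfl⟩, rfl⟩

lemma isEmbedding_cone_map_incl (N : GUBC.{v, u} G) (A : Set N) (hA : InvariantSet G A) :
    IsEmbedding (cone.map (N.incl A hA)) :=
  isEmbedding_cone_map (isEmbedding_incl _ A hA)
    fun _ ⟨E', hE', h⟩ => ⟨E', hE', fun _ _ hxy => h hxy⟩

lemma isEmbedding_zeroSection (M : GUBC.{v, u} G) : IsEmbedding (zeroSection M).base :=
  (isGauge_zero M.toGBornCoarse).isEmbedding_graph

lemma isEmbedding_cone_map_zeroSection (M : GUBC.{v, u} G) :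
    IsEmbedding (cone.map (zeroSection M)) :=
  isEmbedding_cone_map (isEmbedding_zeroSection M) fun _ hE =>
    ⟨_, entourageProd_mem_uniformity (α := ℝ) (β := M) Filter.univ_mem hE, fun _ _ h => h.2⟩

variable {M : GUBC.{v, u} G}

/-- The real coordinate of the base of the cone over `ℝ ⊗ M`. -/
def coord (q : cone.obj ((line G).tensor M)) : ℝ := (base q).1

/-- The projection of the cone over `ℝ ⊗ M` to `M`. -/
def foot (q : cone.obj ((line G).tensor M)) : M := (base q).2

lemma cone_line_isBounded_iff {B : Set (cone.obj ((line G).tensor M))} :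
    Bornology.IsBounded B ↔ (∃ c, ∀ q ∈ B, time q ≤ c) ∧ (∃ c, ∀ q ∈ B, |coord q| ≤ c) ∧
      Bornology.IsBounded (foot '' B) := by
  rw [cone_isBounded_iff]
  refine and_congr_right fun _ =>
    (isBounded_lineTensor_iff (X := M.toGBornCoarse)).trans (and_congr ?_ ?_)
  · refine ⟨fun h => ?_, fun ⟨c, hc⟩ => ?_⟩
    · obtain ⟨c, hc⟩ := h.exists_norm_le
      exact ⟨c, fun q hq => hc _ ⟨_, ⟨q, hq, rfl⟩, rfl⟩⟩
    · refine isBounded_iff_forall_norm_le.2 ⟨c, ?_⟩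
      rintro _ ⟨_, ⟨q, hq, rfl⟩, rfl⟩
      exact hc q hq
  · exact iff_of_eq (congrArg Bornology.IsBounded
      (Set.image_image (Prod.snd : ℝ × M → M) (base (N := (line G).tensor M)) B))

lemma cone_line_isEntourage_iff
    {U : Set (cone.obj ((line G).tensor M) × cone.obj ((line G).tensor M))} :
    (cone.obj ((line G).tensor M)).coarse.IsEntourage U ↔
      (∃ c V, M.coarse.IsEntourage V ∧ ∀ p ∈ U, |time p.1 - time p.2| ≤ c ∧
        |coord p.1 - coord p.2| ≤ c ∧ (foot p.1, foot p.2) ∈ V) ∧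
      ∀ δ > 0, ∀ E ∈ 𝓤 M, ∃ n : ℕ, ∀ p ∈ U, (|time p.1 - time p.2| < δ ∧
        |coord p.1 - coord p.2| < δ ∧ (foot p.1, foot p.2) ∈ E) ∨
          (time p.1 ≤ n ∧ time p.2 ≤ n) := by
  rw [cone_isEntourage_iff]
  constructor
  · rintro ⟨⟨c, _, ⟨A, V, ⟨d, hd⟩, hV, h⟩, hU⟩, hu⟩
    refine ⟨⟨max c d, V, hV, fun p hp => ?_⟩, fun δ hδ E hE => ?_⟩
    · have h1 := h _ (hU p hp).2
      exact ⟨(hU p hp).1.trans (le_max_left _ _), (hd _ h1.1).trans (le_max_right _ _), h1.2⟩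
    · exact hu δ hδ _ (entourageProd_mem_uniformity (α := ℝ) (β := M)
        (Metric.dist_mem_uniformity hδ) hE)
  · rintro ⟨⟨c, V, hV, h⟩, hu⟩
    refine ⟨⟨c, {q | |height (X := M.toGBornCoarse) q.1 - height (X := M.toGBornCoarse) q.2| ≤ c ∧
      (q.1.2, q.2.2) ∈ V}, ⟨{q : ℝ × ℝ | |q.1 - q.2| ≤ c}, V, ⟨c, fun _ hq => hq⟩, hV,
        fun _ hq => hq⟩, h⟩, fun δ hδ E hE => ?_⟩
    obtain ⟨A, hA, B, hB, hAB⟩ := entourageProd_subset (α := ℝ) (β := M) hE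
    obtain ⟨ε, hε, hA⟩ := Metric.mem_uniformity_dist.1 hA
    obtain ⟨n, hn⟩ := hu (min δ ε) (lt_min hδ hε) B hB
    exact ⟨n, fun p hp => (hn p hp).imp_left fun h =>
      ⟨h.1.trans_le (min_le_left _ _), hAB ⟨hA (h.2.1.trans_le (min_le_right _ _)), h.2.2⟩⟩⟩

end GUBC

end Cones

/-! ### Sliding along the real line with speed inverse to the cone coordinate -/

section HalfLines

variable {G : Type u} [Group G]

open GBornCoarse GUBC Uniformity

/-- The decay of this bound in `t'` makes the slide compatible with the hybrid structure. Over the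
denominator `1 + t'` the numerator is `(s - s') + (s / (1 + t)) (t' - t)`, and the coefficient of
`t' - t` is at most one. -/
lemma abs_div_sub_div_le {s s' t t' : ℝ} (hs : 0 ≤ s) (hst : s ≤ 1 + t) (ht : 0 ≤ t)
    (ht' : 0 ≤ t') : |s / (1 + t) - s' / (1 + t')| ≤ (|s - s'| + |t - t'|) / (1 + t') := by
  have h : s / (1 + t) - s' / (1 + t') = ((s - s') + s / (1 + t) * (t' - t)) / (1 + t') := by
    have : 1 + t ≠ 0 := by positivity
    have : 1 + t' ≠ 0 := by positivity
    field_simp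
    ring
  have h1 : 0 ≤ s / (1 + t) := by positivity
  have h2 : s / (1 + t) ≤ 1 := div_le_one_of_le₀ hst (by positivity)
  rw [h, abs_div, abs_of_pos (show 0 < 1 + t' by positivity)]
  gcongr
  refine (abs_add_le _ _).trans (add_le_add_right ?_ _)
  rw [abs_mul, abs_of_nonneg h1, abs_sub_comm t t']
  exact mul_le_of_le_one_left (abs_nonneg _) h2

namespace GBornCoarse

variable {X : GBornCoarse.{u, u} G} {p : X → ℝ}

/-- The real coordinate of a coarse cylinder. -/
def IsGauge.param (hp : IsGauge X p) (x : hp.cylinder) : ℝ := height (val x)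

lemma IsGauge.param_nonneg (hp : IsGauge X p) (x : hp.cylinder) : 0 ≤ hp.param x := (val_mem x).1

lemma IsGauge.param_le (hp : IsGauge X p) (x : hp.cylinder) : hp.param x ≤ p (fn hp.proj x) :=
  (val_mem x).2

lemma IsGauge.param_controlled (hp : IsGauge X p) {U : Set (hp.cylinder × hp.cylinder)}
    (hU : hp.cylinder.coarse.IsEntourage U) : ∃ c, ∀ q ∈ U, |hp.param q.1 - hp.param q.2| ≤ c := by
  obtain ⟨_, _, ⟨c, hc⟩, _, h⟩ := hU
  exact ⟨c, fun q hq => hc _ (h _ ⟨q, hq, rfl⟩).1⟩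

end GBornCoarse

namespace GUBC

/-- The summand `1` keeps the denominators of `fraction` positive at the tip of the cone, so the
slide covers a full unit at the top of the cylinder over every point. -/
lemma isGauge_time {Q : GBornCoarse.{u, u} G} {N : GUBC.{u, u} G} {e : Q ⟶ cone.obj N}
    (he : IsEmbedding e) : IsGauge Q (fun q => 1 + time (GBornCoarse.fn e q)) where
  nonneg q := add_nonneg zero_le_one (time_nonneg _)
  invariant g q := by
    have h := congrArg (time (N := N)) (e.equivariant g q)
    exact congrArg (1 + ·) h
  controlled U hU := by
    obtain ⟨⟨c, _, _, h⟩, _⟩ := cone_isEntourage_iff.1 (e.controlled U hU)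
    refine ⟨c, fun p hp => ?_⟩
    rw [add_sub_add_left_eq_sub]
    exact (h _ ⟨p, hp, rfl⟩).1
  bounded B hB := by
    obtain ⟨⟨c, hc⟩, _⟩ := cone_isBounded_iff.1 (he.bounded B hB)
    exact ⟨1 + c, fun q hq => add_le_add_right (hc _ ⟨q, hq, rfl⟩) 1⟩

variable {M : GUBC.{u, u} G}

lemma cone_line_ext {q q' : cone.obj ((line G).tensor M)} (ht : time q = time q')
    (hc : coord q = coord q') (hf : foot q = foot q') : q = q' :=
  cone_ext ht (Prod.ext hc hf)

/-- The point of the cone over `ℝ ⊗ M` with given coordinates. -/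
def coneLinePoint (t : ℝ) (ht : 0 ≤ t) (r : ℝ) (m : M) : cone.obj ((line G).tensor M) :=
  conePoint (N := (line G).tensor M) t ht (r, m)

lemma mem_range_cone_map_incl {A : Set ((line G).tensor M)} {hA : InvariantSet G A}
    {q : cone.obj ((line G).tensor M)} :
    q ∈ Set.range (GBornCoarse.fn (cone.map (((line G).tensor M).incl A hA))) ↔ base q ∈ A :=
  ⟨by rintro ⟨q, rfl⟩; exact Subtype.property (p := fun x => x ∈ A) (base q),
    fun h => ⟨conePoint (N := ((line G).tensor M).sub A hA) (time q) (time_nonneg q) ⟨base q, h⟩,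
      rfl⟩⟩

section Slide

variable {Q : GBornCoarse.{u, u} G} {e : Q ⟶ cone.obj ((line G).tensor M)} (he : IsEmbedding e)

/-- The covered fraction of the homotopy `slide`. -/
noncomputable def fraction (x : (isGauge_time he).cylinder) : ℝ :=
  (isGauge_time he).param x / (1 + time (GBornCoarse.fn ((isGauge_time he).proj ≫ e) x))

lemma fraction_nonneg (x : (isGauge_time he).cylinder) : 0 ≤ fraction he x :=
  div_nonneg ((isGauge_time he).param_nonneg x) ((isGauge_time he).nonneg _)

lemma fraction_le_one (x : (isGauge_time he).cylinder) : fraction he x ≤ 1 :=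
  div_le_one_of_le₀ ((isGauge_time he).param_le x) ((isGauge_time he).nonneg _)

variable {ε : ℝ} (hε : |ε| = 1)

include hε in
lemma abs_mul_fraction_le (x : (isGauge_time he).cylinder) : |ε * fraction he x| ≤ 1 := by
  rw [abs_mul, hε, one_mul, abs_of_nonneg (fraction_nonneg he x)]
  exact fraction_le_one he x

/-- The homotopy that moves the points along the real line with a speed that is inverse to the
cone coordinate. -/
noncomputable def slide : (isGauge_time he).cylinder ⟶ cone.obj ((line G).tensor M) where
  toFun x := coneLinePoint (time (GBornCoarse.fn ((isGauge_time he).proj ≫ e) x)) (time_nonneg _)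
    (coord (GBornCoarse.fn ((isGauge_time he).proj ≫ e) x) + ε * fraction he x)
    (foot (GBornCoarse.fn ((isGauge_time he).proj ≫ e) x))
  equivariant g x := by
    have h := ((isGauge_time he).proj ≫ e).equivariant g x
    have ht := congrArg (time (N := (line G).tensor M)) h
    have hr : fraction he (g • x) = fraction he x :=
      congrArg (fun t => (isGauge_time he).param x / (1 + t)) ht
    have hc := congrArg (coord (M := M)) h
    have hf := congrArg (foot (M := M)) h
    exact cone_line_ext ht (congrArg₂ (fun r s => r + ε * s) hc hr) hf
  controlled U hU := by
    set u := (isGauge_time he).proj ≫ e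
    obtain ⟨c, hc⟩ := (isGauge_time he).param_controlled hU
    obtain ⟨⟨d, E, hE, hd⟩, hu⟩ := cone_line_isEntourage_iff.1 (u.controlled U hU)
    have hr : ∀ q ∈ U, |fraction he q.1 - fraction he q.2| ≤
        (c + d) / (1 + time (GBornCoarse.fn u q.2)) := fun q hq =>
      (abs_div_sub_div_le ((isGauge_time he).param_nonneg _) ((isGauge_time he).param_le _)
        (time_nonneg _) (time_nonneg _)).trans
        (div_le_div_of_nonneg_right (add_le_add (hc q hq) (hd _ ⟨q, hq, rfl⟩).1)
          ((isGauge_time he).nonneg _))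
    -- Each of the two points moves by at most one, hence `d + 2`.
    refine cone_line_isEntourage_iff.2 ⟨⟨d + 2, E, hE, ?_⟩, fun δ hδ F hF => ?_⟩
    · rintro _ ⟨q, hq, rfl⟩
      obtain ⟨h1, h2, h3⟩ := hd _ ⟨q, hq, rfl⟩
      refine ⟨h1.trans (by linarith), ?_, h3⟩
      change |(coord (GBornCoarse.fn u q.1) + ε * fraction he q.1) -
        (coord (GBornCoarse.fn u q.2) + ε * fraction he q.2)| ≤ d + 2
      change |coord (GBornCoarse.fn u q.1) - coord (GBornCoarse.fn u q.2)| ≤ d at h2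
      have h4 := abs_le.1 (abs_mul_fraction_le he hε q.1)
      have h5 := abs_le.1 (abs_mul_fraction_le he hε q.2)
      have h6 := abs_le.1 h2
      exact abs_le.2 ⟨by linarith, by linarith⟩
    · obtain ⟨n, hn⟩ := hu (δ / 2) (half_pos hδ) F hF
      -- Times differ by at most `d`. If either one exceeds `k`, the second exceeds `n`, so that the
      -- original coordinates differ by less than `δ / 2`, and also `(c + d) / (δ / 2)`, so that the
      -- displacements differ by at most `δ / 2`.
      obtain ⟨k, hk⟩ := exists_nat_gt (max (n : ℝ) ((c + d) / (δ / 2)) + |d|)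
      refine ⟨k, ?_⟩
      rintro _ ⟨q, hq, rfl⟩
      have h1 : |time (GBornCoarse.fn u q.1) - time (GBornCoarse.fn u q.2)| ≤ d :=
        (hd _ ⟨q, hq, rfl⟩).1
      have h2 := abs_le.1 h1
      have h3 := le_abs_self d
      have h4 := le_max_left (n : ℝ) ((c + d) / (δ / 2))
      have h5 := le_max_right (n : ℝ) ((c + d) / (δ / 2))
      by_cases hx : time (GBornCoarse.fn u q.1) ≤ k ∧ time (GBornCoarse.fn u q.2) ≤ k
      · exact Or.inr hx
      · left
        have hbig : max (n : ℝ) ((c + d) / (δ / 2)) < time (GBornCoarse.fn u q.2) := by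
          rcases not_and_or.1 hx with h | h <;> rw [not_le] at h
          · linarith
          · linarith [abs_nonneg d]
        obtain ⟨h6, h7, h8⟩ := (hn _ ⟨q, hq, rfl⟩).resolve_right fun h =>
          absurd h.2 (not_le.2 (h4.trans_lt hbig))
        refine ⟨h6.trans (half_lt_self hδ), ?_, h8⟩
        change |(coord (GBornCoarse.fn u q.1) + ε * fraction he q.1) -
          (coord (GBornCoarse.fn u q.2) + ε * fraction he q.2)| < δ
        change |coord (GBornCoarse.fn u q.1) - coord (GBornCoarse.fn u q.2)| < δ / 2 at h7
        have h9 : (c + d) / (1 + time (GBornCoarse.fn u q.2)) ≤ δ / 2 := by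
          have := h5.trans_lt hbig
          rw [div_lt_iff₀ (half_pos hδ)] at this
          rw [div_le_iff₀ (by linarith [time_nonneg (GBornCoarse.fn u q.2)])]
          linarith
        have h10 : |ε * (fraction he q.1 - fraction he q.2)| ≤ δ / 2 := by
          rw [abs_mul, hε, one_mul]
          exact (hr q hq).trans h9
        rw [add_sub_add_comm, ← mul_sub]
        exact (abs_add_le _ _).trans_lt (by linarith)
  proper B hB := by
    obtain ⟨ht, ⟨c, hc⟩, hf⟩ := cone_line_isBounded_iff.1 hB
    -- The slide changes only the real coordinate, by at most one, so the preimage of `B` lies in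
    -- the preimage of this enlargement under the projection followed by `e`.
    let B' : Set (cone.obj ((line G).tensor M)) :=
      {d | ∃ b ∈ B, time d = time b ∧ |coord d| ≤ |coord b| + 1 ∧ foot d = foot b}
    have hB' : Bornology.IsBounded B' := by
      refine cone_line_isBounded_iff.2 ⟨?_, ⟨c + 1, ?_⟩, hf.subset ?_⟩
      · obtain ⟨a, ha⟩ := ht
        refine ⟨a, ?_⟩
        rintro d ⟨b, hb, h, -⟩
        exact h.trans_le (ha b hb)
      · rintro d ⟨b, hb, -, h, -⟩
        exact h.trans (add_le_add_left (hc b hb) 1)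
      · rintro _ ⟨d, ⟨b, hb, -, -, h⟩, rfl⟩
        exact ⟨b, hb, h.symm⟩
    refine (((isGauge_time he).proj ≫ e).proper B' hB').subset fun x hx => ⟨_, hx, rfl, ?_, rfl⟩
    change |coord (GBornCoarse.fn ((isGauge_time he).proj ≫ e) x)| ≤
      |coord (GBornCoarse.fn ((isGauge_time he).proj ≫ e) x) + ε * fraction he x| + 1
    have h := abs_add_le (coord (GBornCoarse.fn ((isGauge_time he).proj ≫ e) x) +
      ε * fraction he x) (-(ε * fraction he x))
    rw [add_neg_cancel_right, abs_neg] at h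
    exact h.trans (add_le_add_right (abs_mul_fraction_le he hε x) _)

end Slide

end GUBC

end HalfLines

/-! ### Weak flasqueness of cones over half lines -/

section WeakFlasqueness

variable {G : Type u} [Group G]

open GBornCoarse GUBC Uniformity

namespace GUBC

variable {M : GUBC.{u, u} G} {Q : GBornCoarse.{u, u} G} {e : Q ⟶ cone.obj ((line G).tensor M)}
  (he : IsEmbedding e) {ε : ℝ} (hε : |ε| = 1)
  (hr : ∀ q, q ∈ Set.range (GBornCoarse.fn e) ↔ 0 ≤ ε * coord q)

include hr in
-- The slide moves in the direction `ε`, and `ε * ε = 1`, so `ε * coord` can only increase. The sign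
-- `ε` treats both half lines at once.
lemma slide_mem_range (x : (isGauge_time he).cylinder) :
    GBornCoarse.fn (slide he hε) x ∈ Set.range (GBornCoarse.fn e) := by
  rw [hr]
  have h := (hr _).1 ⟨GBornCoarse.fn (isGauge_time he).proj x, rfl⟩
  change 0 ≤ ε * (coord (GBornCoarse.fn ((isGauge_time he).proj ≫ e) x) + ε * fraction he x)
  rw [mul_add, ← mul_assoc, ← abs_mul_abs_self ε, hε, one_mul, one_mul]
  exact add_nonneg h (fraction_nonneg he x)

/-- The endomorphism of the cone of a half line that moves the points by one. -/
noncomputable def halfLineShift : Q ⟶ Q :=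
  (isGauge_time he).top ≫ he.lift (slide he hε) (slide_mem_range he hε hr)

lemma fn_halfLineShift (q : Q) : GBornCoarse.fn e (GBornCoarse.fn (halfLineShift he hε hr) q) =
    coneLinePoint (time (GBornCoarse.fn e q)) (time_nonneg _) (coord (GBornCoarse.fn e q) + ε)
      (foot (GBornCoarse.fn e q)) := by
  refine (he.fn_lift _ (slide_mem_range he hε hr) _).trans (cone_line_ext rfl ?_ rfl)
  -- At the top of the cylinder the covered fraction is one.
  change coord (GBornCoarse.fn e q) + ε * ((1 + time (GBornCoarse.fn e q)) /
    (1 + time (GBornCoarse.fn e q))) = coord (GBornCoarse.fn e q) + ε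
  rw [div_self (by linarith [time_nonneg (GBornCoarse.fn e q)]), mul_one]

/-- The shift is the slide at the top of the cylinder; at the bottom the covered fraction is zero
and the slide is the identity. -/
lemma motive_map_halfLineShift : motive.map (halfLineShift he hε hr) = 𝟙 (motive.obj Q) := by
  rw [halfLineShift, ← motive_map_eq_of_homotopy, ← motive.map_id]
  refine congrArg motive.map (GBornCoarse.hom_ext fun q => he.injective ?_)
  refine (he.fn_lift _ (slide_mem_range he hε hr) _).trans (cone_line_ext rfl ?_ rfl)
  change coord (GBornCoarse.fn e q) + ε * (0 / (1 + time (GBornCoarse.fn e q))) =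
    coord (GBornCoarse.fn e q)
  rw [zero_div, mul_zero, add_zero]

lemma fn_halfLineShift_iterate (n : ℕ) (q : Q) :
    GBornCoarse.fn e ((GBornCoarse.fn (halfLineShift he hε hr))^[n] q) =
      coneLinePoint (time (GBornCoarse.fn e q)) (time_nonneg _)
        (coord (GBornCoarse.fn e q) + n * ε) (foot (GBornCoarse.fn e q)) := by
  induction n with
  | zero =>
    refine cone_line_ext rfl ?_ rfl
    change coord (GBornCoarse.fn e q) = coord (GBornCoarse.fn e q) + ((0 : ℕ) : ℝ) * ε
    rw [Nat.cast_zero, zero_mul, add_zero]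
  | succ n ih =>
    rw [Function.iterate_succ_apply', fn_halfLineShift]
    have ht := congrArg (time (N := (line G).tensor M)) ih
    have hc := congrArg (coord (M := M)) ih
    have hf := congrArg (foot (M := M)) ih
    refine cone_line_ext ht ?_ hf
    change coord _ + ε = coord (GBornCoarse.fn e q) + ((n + 1 : ℕ) : ℝ) * ε
    rw [hc]
    change coord (GBornCoarse.fn e q) + n * ε + ε = _
    push_cast
    ring

/-- The `n`-th iterate translates the real coordinate by `n * ε`. Every estimate that describes an
entourage involves only times, feet and differences of the real coordinate, so it persists for all
`n` with the same constants. -/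
lemma isShift_halfLineShift : IsShift (halfLineShift he hε hr) where
  union_entourage U hU := by
    obtain ⟨⟨c, E, hE, hc⟩, hu⟩ := cone_line_isEntourage_iff.1 (e.controlled U hU)
    have key : ∀ p ∈ Prod.map (GBornCoarse.fn e) (GBornCoarse.fn e) ''
        (⋃ n : ℕ, Prod.map (GBornCoarse.fn (halfLineShift he hε hr))^[n]
          (GBornCoarse.fn (halfLineShift he hε hr))^[n] '' U),
        ∃ q ∈ Prod.map (GBornCoarse.fn e) (GBornCoarse.fn e) '' U,
          time p.1 = time q.1 ∧ time p.2 = time q.2 ∧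
            coord p.1 - coord p.2 = coord q.1 - coord q.2 ∧ foot p.1 = foot q.1 ∧
              foot p.2 = foot q.2 := by
      rintro _ ⟨_, hp, rfl⟩
      obtain ⟨n, q, hq, rfl⟩ := Set.mem_iUnion.1 hp
      refine ⟨_, ⟨q, hq, rfl⟩, ?_⟩
      simp only [Prod.map_fst, Prod.map_snd, fn_halfLineShift_iterate]
      exact ⟨rfl, rfl, add_sub_add_right_eq_sub _ _ _, rfl, rfl⟩
    refine he.entourage _ (cone_line_isEntourage_iff.2 ⟨⟨c, E, hE, fun p hp => ?_⟩,
      fun δ hδ F hF => ?_⟩)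
    · obtain ⟨q, hq, h1, h2, h3, h4, h5⟩ := key p hp
      rw [h1, h2, h3, h4, h5]
      exact hc q hq
    · obtain ⟨n, hn⟩ := hu δ hδ F hF
      refine ⟨n, fun p hp => ?_⟩
      obtain ⟨q, hq, h1, h2, h3, h4, h5⟩ := key p hp
      rw [h1, h2, h3, h4, h5]
      exact hn q hq
  leaves_bounded B hB := by
    obtain ⟨-, ⟨c, hc⟩, -⟩ := cone_line_isBounded_iff.1 (he.bounded B hB)
    -- On the image of the `n`-th iterate `ε * coord` is at least `n`, while on `B` and its
    -- translates it is at most `c`.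
    obtain ⟨n, hn⟩ := exists_nat_gt c
    refine ⟨n, Set.eq_empty_iff_forall_notMem.2 ?_⟩
    rintro _ ⟨⟨q, rfl⟩, g, b, hb, h⟩
    have h1 := congrArg coord
      ((fn_halfLineShift_iterate he hε hr n q).symm.trans (congrArg (GBornCoarse.fn e) h))
    have h2 : coord (GBornCoarse.fn e (g • b)) = coord (GBornCoarse.fn e b) := by
      have h3 := congrArg (coord (M := M)) (e.equivariant g b)
      exact h3
    rw [h2] at h1
    change coord (GBornCoarse.fn e q) + n * ε = _ at h1
    have h4 := (hr _).1 ⟨q, rfl⟩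
    have h5 : ε * coord (GBornCoarse.fn e b) ≤ c := (le_abs_self _).trans (by
      rw [abs_mul, hε, one_mul]
      exact hc _ ⟨b, hb, rfl⟩)
    have h6 : ε * ε = 1 := by rw [← abs_mul_abs_self, hε, one_mul]
    rw [← h1] at h5
    have h7 : ε * (coord (GBornCoarse.fn e q) + n * ε) =
      ε * coord (GBornCoarse.fn e q) + n * (ε * ε) := by ring
    rw [h7, h6] at h5
    linarith

include he hε hr in
lemma isWeaklyFlasque_of_halfLine : Q.IsWeaklyFlasque :=
  ⟨halfLineShift he hε hr, motive_map_halfLineShift he hε hr, isShift_halfLineShift he hε hr⟩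

lemma mem_range_cone_map_plusIncl (q : cone.obj ((line G).tensor M)) :
    q ∈ Set.range (GBornCoarse.fn (cone.map M.plusIncl)) ↔ 0 ≤ coord q :=
  mem_range_cone_map_incl

lemma mem_range_cone_map_minusIncl (q : cone.obj ((line G).tensor M)) :
    q ∈ Set.range (GBornCoarse.fn (cone.map M.minusIncl)) ↔ coord q ≤ 0 :=
  mem_range_cone_map_incl

lemma isEmbedding_cone_map_plusIncl (M : GUBC.{u, u} G) : IsEmbedding (cone.map M.plusIncl) :=
  isEmbedding_cone_map_incl _ _ _

lemma isEmbedding_cone_map_minusIncl (M : GUBC.{u, u} G) : IsEmbedding (cone.map M.minusIncl) :=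
  isEmbedding_cone_map_incl _ _ _

lemma isWeaklyFlasque_cone_plusPart (M : GUBC.{u, u} G) : (cone.obj M.plusPart).IsWeaklyFlasque :=
  isWeaklyFlasque_of_halfLine (isEmbedding_cone_map_plusIncl M) abs_one
    fun q => (mem_range_cone_map_plusIncl q).trans (by rw [one_mul])

lemma isWeaklyFlasque_cone_minusPart (M : GUBC.{u, u} G) :
    (cone.obj M.minusPart).IsWeaklyFlasque :=
  isWeaklyFlasque_of_halfLine (isEmbedding_cone_map_minusIncl M)
    ((abs_neg (1 : ℝ)).trans abs_one)
    fun q => (mem_range_cone_map_minusIncl q).trans (by rw [neg_one_mul, neg_nonneg])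

end GUBC

end WeakFlasqueness

/-! ### The equivalences in the suspension diagram -/

section Suspension

variable {G : Type u} [Group G]

open GBornCoarse GUBC Uniformity PshSp

variable {L : MorphismProperty (CoarsePshSp G)} (hL : IsSaturatedClass L)
  (hE : EventualEquiv ≤ L) (M : GUBC.{u, u} G)

include hL hE in
-- Mayer–Vietoris for the cones over the two half lines, with the retraction `max(r, 0)` in the real
-- coordinate. Weak flasqueness plays no role here, so the coarse generators suffice.
lemma IsSaturatedClass.upperVertical_mem (hG : CoarseGenerator ≤ L) : L (upperVertical M) := by
  refine hL.mayerVietoris hE hG (cone.map M.toMinus) (cone.map M.toPlus) (cone.map M.minusIncl)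
    (cone.map M.plusIncl) (isEmbedding_cone_map_minusIncl M) (isEmbedding_cone_map_plusIncl M)
    (isEmbedding_cone_map_zeroSection M) rfl ?_ ?_
    (fun q => coneLinePoint (time q) (time_nonneg q) (max (coord q) 0) (foot q)) ?_ ?_ ?_ ?_ ?_ _
  · ext q
    rw [Set.mem_inter_iff, mem_range_cone_map_minusIncl, mem_range_cone_map_plusIncl]
    refine ⟨fun h => ⟨conePoint (time q) (time_nonneg q) (foot q),
      cone_line_ext rfl (le_antisymm h.2 h.1) rfl⟩, ?_⟩
    rintro ⟨q, rfl⟩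
    exact ⟨le_refl (0 : ℝ), le_refl (0 : ℝ)⟩
  · ext q
    rw [Set.mem_union, mem_range_cone_map_minusIncl, mem_range_cone_map_plusIncl]
    exact iff_of_true (le_total _ _) (Set.mem_univ _)
  · exact fun _ _ => rfl
  · exact fun q => (mem_range_cone_map_plusIncl _).2 (le_max_right _ _)
  · exact fun q hq => (mem_range_cone_map_minusIncl _).2
      (max_le ((mem_range_cone_map_minusIncl _).1 hq) le_rfl)
  · exact fun q => cone_line_ext rfl (max_eq_left
      ((mem_range_cone_map_plusIncl _).1 (Set.mem_range_self q))) rfl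
  · intro U hU
    obtain ⟨⟨c, _, _, hc⟩, hu⟩ := cone_line_isEntourage_iff.1 hU
    -- The distance from `x` to its retraction is at most the distance to any point of the half
    -- line. Hence the bounds of `U`, including the small ones far out in the cone, pass to the
    -- displacement of the retraction.
    have key : ∀ x b : cone.obj ((line G).tensor M),
        b ∈ Set.range (GBornCoarse.fn (cone.map M.plusIncl)) →
          |coord x - max (coord x) 0| ≤ |coord x - coord b| := by
      intro x b hb
      have h := (mem_range_cone_map_plusIncl b).1 hb
      rcases le_total (coord x) 0 with hx | hx
      · rw [max_eq_right hx, sub_zero, abs_of_nonpos hx]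
        exact le_abs.2 (Or.inr (by linarith))
      · rw [max_eq_left hx, sub_self, abs_zero]
        exact abs_nonneg _
    refine cone_line_isEntourage_iff.2 ⟨⟨c, _, M.coarse.diag, ?_⟩, fun δ hδ E hF => ?_⟩
    · rintro _ ⟨x, ⟨b, hb, hxb⟩, rfl⟩
      obtain ⟨h1, h2, -⟩ := hc _ hxb
      refine ⟨?_, (key x b hb).trans h2, rfl⟩
      exact (abs_eq_zero.2 (sub_self (time x))).trans_le ((abs_nonneg _).trans h1)
    · obtain ⟨n, hn⟩ := hu δ hδ E hF
      refine ⟨n, ?_⟩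
      rintro _ ⟨x, ⟨b, hb, hxb⟩, rfl⟩
      refine (hn _ hxb).imp (fun h => ⟨?_, (key x b hb).trans_lt h.2.1, refl_mem_uniformity hF⟩)
        fun h => ⟨h.1, h.1⟩
      exact (abs_eq_zero.2 (sub_self (time x))).trans_lt hδ

variable (hS : StrongGenerator ≤ L)

include hL hE hS in
lemma IsSaturatedClass.acyclic_of_isWeaklyFlasque {X : GBornCoarse.{u, u} G}
    (h : X.IsWeaklyFlasque) : Acyclic L (yoSp.obj X) :=
  hL.acyclic_of_subIncl_bot hE (hS _ (.weaklyFlasque _ h))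

include hL hE hS in
lemma IsSaturatedClass.markedOne_mem : L (markedOne M) :=
  hL.toCofiber_mem hE _ (hL.acyclic_of_isWeaklyFlasque hE hS (isWeaklyFlasque_cone_minusPart M))

include hL hE hS in
lemma IsSaturatedClass.markedTwo_mem : L (markedTwo M) :=
  hL.boundary_mem hE _ (hL.acyclic_of_isWeaklyFlasque hE hS (isWeaklyFlasque_cone_plusPart M))

lemma isIso_toWfl_map {X Y : CoarsePshSp G} {f : X ⟶ Y}
    (hf : localEquivalences StrongGenerator f) : IsIso ((toWfl G).map f) :=
  Localization.inverts (toWfl G) (localEquivalences StrongGenerator) f hf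

lemma isIso_markedOne : IsIso ((toWfl G).map (markedOne M)) :=
  isIso_toWfl_map fun _ hL hE hS => hL.markedOne_mem hE M hS

lemma isIso_markedTwo : IsIso ((toWfl G).map (markedTwo M)) :=
  isIso_toWfl_map fun _ hL hE hS => hL.markedTwo_mem hE M hS

lemma isIso_upperVertical : IsIso ((toWfl G).map (upperVertical M)) :=
  isIso_toWfl_map fun _ hL hE hS => hL.upperVertical_mem hE M fun _ _ f h => hS f (.coarse f h)

lemma isIso_suspMor (h : IsIso ((toWfl G).map (upperVertical M))) : IsIso (suspMor M h) := by
  have := isIso_markedOne M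
  have := isIso_markedTwo M
  unfold suspMor
  infer_instance

end Suspension

end CoarseMotives

theorem mainTheorem8 {G : Type u} [Group G] (Winf : GUBC.{u, u} G) (W Minf : Set Winf)
    (hW : InvariantSet G W) (hMinf : InvariantSet G Minf) (_hcover : Minf ∪ W = Set.univ)
    (φ : (interface Winf W Minf hW hMinf).plusPart ≅ Winf.sub Minf hMinf)
    (hφ : IsCollar Winf W Minf hW hMinf φ) :
    let M : GUBC.{u, u} G := interface Winf W Minf hW hMinf
    IsIso ((toWfl G).map (markedOne M)) ∧
    IsIso ((toWfl G).map (markedTwo M)) ∧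
    ∃ (_ : IsIso ((toWfl G).map (markedOne M)))
      (hup : IsIso ((toWfl G).map (upperVertical M))),
      IsIso (suspMor M hup) ∧
      ∀ hlow : IsIso ((toWfl G).map (lowerVertical Winf W Minf hW hMinf φ hφ)),
        boundaryPrime Winf W Minf hW hMinf φ hφ hlow =
          (toWfl G).map (PshSp.toCofiber (yoStripIncl Winf W hW)) ≫
          inv ((toWfl G).map (lowerVertical Winf W Minf hW hMinf φ hφ)) ≫
          (toWfl G).map (upperVertical M) ≫
          inv ((toWfl G).map (markedOne M)) ≫ suspMor M hup := by
  intro M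
  have h1 := isIso_markedOne M
  have h2 := isIso_upperVertical M
  refine ⟨h1, isIso_markedTwo M, h1, h2, isIso_suspMor M h2, fun hlow => ?_⟩
  unfold boundaryPrime suspMor
  -- Unfolding `susp` as `δ ∘ v⁻¹ ∘ c`, the factors `c`, `c⁻¹` and `v`, `v⁻¹` cancel and leave `δ`.
  rw [IsIso.inv_hom_id_assoc, IsIso.hom_inv_id_assoc]
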